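/- Let $d\ge 1$, let $I=\{\pm1,\dots,\pm d\}$ label the canonical basis $\{|\tau\rangle\}_{\tau\in I}$ of $\mathbb{C}^{2d}$, with orthogonal projectors $P_\tau=|\tau\rangle\langle\tau|$, and let $r:I\to\mathbb{Z}^d$ be a jump function. On $\mathfrak{h}=\mathbb{C}^{2d}\otimes\ell^2(\mathbb{Z}^d)$ let $$S=\sum_{\tau\in I,\;x\in\mathbb{Z}^d}P_\tau\otimes|x+r(\tau)\rangle\langle x|,$$ and for a unitary matrix $C\in U(2d)$ put $U(C)=S(C\otimes\mathbb{1})$. Let $(\Omega,\mu)$ be a probability space and $C:\Omega\to U(2d)$ a measurable map. For $\overline\omega=(\omega_1,\omega_2,\dots)\in\Omega^{\mathbb{N}^*}$, distributed according to $\mathbb{P}=\bigotimes_{k\ge1}\mu$, and a unit vector $\psi_0\in\mathbb{C}^{2d}$, let $\rho_0=|\psi_0\rangle\langle\psi_0|\otimes|0\rangle\langle0|$ and $\rho_n=U(C(\omega_n))\,\rho_{n-1}\,U(C(\omega_n))^*$ for $n\ge 1$. Let $X=(X_1,\dots,X_d)$ be the position operator on $\ell^2(\mathbb{Z}^d)$.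 For a function $f:\mathbb{Z}^d\to\mathbb{C}$ and for $y\in\mathbb{C}^d$ write $$\langle f(X)\rangle_{\psi_0}(n)=\mathbb{E}_{\overline\omega}\,\mathrm{Tr}\big(\rho_n\,(\mathbb{1}\otimes f(X))\big),\qquad \Phi_n^{\psi_0}(y)=\langle e^{iX\cdot y}\rangle_{\psi_0}(n),$$ where $a\cdot y=\sum_j a_jy_j$ (no complex conjugation). Let $\overline r=\frac1{2d}\sum_{\tau\in I}r(\tau)\in\mathbb{R}^d$, let $d(y)=\sum_{\tau\in I}e^{iy\cdot r(\tau)}|\tau\rangle\langle\tau|$ for $y\in\mathbb{R}^d$, and let $$\mathcal{M}(y,y')=\big(d(y)\otimes d(y')\big)\,\mathbb{E}\big(C(\omega)\otimes\overline{C(\omega)}\big)\in M_{4d^2}(\mathbb{C}).$$ **Theorem.** Assume that for all $v\in\mathbb{T}^d=(\mathbb{R}/2\pi\mathbb{Z})^d$ one has $\sigma(\mathcal{M}(v,-v))\cap\{|z|=1\}=\{1\}$ and the eigenvalue $1$ of $\mathcal{M}(v,-v)$ is simple. Then there is a real-analytic map $\mathbb{T}^d\ni v\mapsto\mathbb{D}(v)$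 with values in the real symmetric positive semidefinite $d\times d$ matrices, such that the function $$(t,y)\mapsto\int_{\mathbb{T}^d}e^{-\frac t2\sum_{i,j}y_i\mathbb{D}_{ij}(v)y_j}\,\frac{dv}{(2\pi)^d}$$ is analytic on $\mathbb{C}\times\mathbb{C}^d$ and such that for every unit vector $\psi_0\in\mathbb{C}^{2d}$ the following holds. 1. For all $n$ and $f:\mathbb{Z}^d\to\mathbb{C}$, the trace (in the canonical basis) and the expectation defining $\langle f(X)\rangle_{\psi_0}(n)$ converge absolutely. 2. Uniformly in $y$ in compact subsets of $\mathbb{C}^d$ and $t$ in compact subsets of $(0,\infty)$, $$\lim_{n\to\infty}\Phi^{\psi_0}_{[tn]}(y/n)=e^{it\,y\cdot\overline r},\qquad \lim_{n\to\infty}e^{-i[tn]\frac{\overline r\cdot y}{\sqrt n}}\,\Phi^{\psi_0}_{[tn]}(y/\sqrt n)=\int_{\mathbb{T}^d}e^{-\frac t2\sum_{i,j}y_i\mathbb{D}_{ij}(v)y_j}\,\frac{dv}{(2\pi)^d}.$$ 3. For all $i,j\in\{1,\dots,d\}$, $$\lim_{n\to\infty}\frac{\langle X_i\rangle_{\psi_0}(n)}n=\overline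 r_i,\qquad \lim_{n\to\infty}\frac{\langle(X-n\overline r)_i(X-n\overline r)_j\rangle_{\psi_0}(n)}n=\int_{\mathbb{T}^d}\mathbb{D}_{ij}(v)\,\frac{dv}{(2\pi)^d}.$$ -/

import Mathlib

open MeasureTheory Filter Topology

noncomputable section

namespace QWalk

/-- The set `I = {±1, …, ±d}` labelling the canonical basis of `ℂ^{2d}`. -/
abbrev Spin (d : ℕ) : Type := ↥((Finset.Icc (-(d : ℤ)) (d : ℤ)).erase 0)

/-- The lattice `ℤ^d`. -/
abbrev Lat (d : ℕ) : Type := Fin d → ℤ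

/-- `ℓ²(ℤ^d)`. -/
abbrev LatL2 (d : ℕ) : Type := lp (fun _ : Lat d => ℂ) 2

/-- `ℂ^{2d} ⊗ ℓ²(ℤ^d)`, realised as the Hilbert direct sum of copies of `ℓ²(ℤ^d)` indexed by `I`. -/
abbrev Hil (d : ℕ) : Type := PiLp 2 (fun _ : Spin d => LatL2 d)

/-- The operator `A ⊗ L` on `ℂ^{2d} ⊗ ℓ²(ℤ^d)`: `((A ⊗ L) ψ)_τ = ∑ σ, A_{τσ} L ψ_σ`. -/
def tensorOp {d : ℕ} (A : Matrix (Spin d) (Spin d) ℂ) (L : LatL2 d →L[ℂ] LatL2 d) :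
    Hil d →L[ℂ] Hil d :=
  (PiLp.continuousLinearEquiv 2 ℂ (fun _ : Spin d => LatL2 d)).symm.toContinuousLinearMap ∘L
    ContinuousLinearMap.pi (fun τ : Spin d =>
      ∑ σ : Spin d, A τ σ • (L ∘L PiLp.proj 2 (fun _ : Spin d => LatL2 d) σ))

theorem memlp_translate {d : ℕ} (a : Lat d) (φ : LatL2 d) :
    Memℓp (fun x : Lat d => φ (x - a)) 2 := by
  have h := lp.memℓp φ
  have h2 : (0 : ℝ) < (2 : ENNReal).toReal := by norm_num
  rw [memℓp_gen_iff h2] at h ⊢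
  exact (Equiv.subRight a).summable_iff.mpr h

theorem norm_translate {d : ℕ} (a : Lat d) (φ : LatL2 d) :
    ‖(⟨fun x : Lat d => φ (x - a), memlp_translate a φ⟩ : LatL2 d)‖ = ‖φ‖ := by
  have h2 : (0 : ℝ) < (2 : ENNReal).toReal := by norm_num
  rw [lp.norm_eq_tsum_rpow h2, lp.norm_eq_tsum_rpow h2]
  congr 1
  exact (Equiv.subRight a).tsum_eq (fun x => ‖φ x‖ ^ (2 : ENNReal).toReal)

/-- The translation `∑ x, |x + a⟩⟨x|` on `ℓ²(ℤ^d)`, that is `φ ↦ φ(· - a)`. -/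
def latTranslate {d : ℕ} (a : Lat d) : LatL2 d →L[ℂ] LatL2 d :=
  LinearIsometry.toContinuousLinearMap
    { toFun := fun φ => ⟨fun x : Lat d => φ (x - a), memlp_translate a φ⟩
      map_add' := fun φ χ => by ext x; rfl
      map_smul' := fun c φ => by ext x; rfl
      norm_map' := fun φ => norm_translate a φ }

/-- The shift `S = ∑ τ, P_τ ⊗ ∑ x, |x + r(τ)⟩⟨x|`. -/
def shift {d : ℕ} (r : Spin d → Lat d) : Hil d →L[ℂ] Hil d :=
  ∑ τ : Spin d, tensorOp (Matrix.single τ τ (1 : ℂ)) (latTranslate (r τ))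

/-- The one step evolution operator `U(C) = S (C ⊗ 1)`. -/
def stepOp {d : ℕ} (r : Spin d → Lat d) (C : Matrix (Spin d) (Spin d) ℂ) :
    Hil d →L[ℂ] Hil d :=
  shift r ∘L tensorOp C (ContinuousLinearMap.id ℂ (LatL2 d))

/-- The one step evolution of states, `ρ ↦ U(C) ρ U(C)^*`. -/
def stepState {d : ℕ} (r : Spin d → Lat d) (C : Matrix (Spin d) (Spin d) ℂ)
    (ρ : Hil d →L[ℂ] Hil d) : Hil d →L[ℂ] Hil d :=
  stepOp r C ∘L ρ ∘L ContinuousLinearMap.adjoint (stepOp r C)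

/-- The state at time `n`; the coin matrix used in step `k + 1` is `Cs k`. -/
def evolve {d : ℕ} (r : Spin d → Lat d) (Cs : ℕ → Matrix (Spin d) (Spin d) ℂ)
    (ρ : Hil d →L[ℂ] Hil d) : ℕ → (Hil d →L[ℂ] Hil d)
  | 0 => ρ
  | n + 1 => stepState r (Cs n) (evolve r Cs ρ n)

/-- The vector `|x⟩` of the canonical basis of `ℓ²(ℤ^d)`. -/
def ket {d : ℕ} (x : Lat d) : LatL2 d := lp.single 2 x (1 : ℂ)

/-- The initial state `|ψ₀⟩⟨ψ₀| ⊗ |0⟩⟨0|`. -/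
def initialState {d : ℕ} (ψ₀ : EuclideanSpace ℂ (Spin d)) : Hil d →L[ℂ] Hil d :=
  tensorOp (Matrix.of fun τ σ => ψ₀ τ * star (ψ₀ σ))
    (InnerProductSpace.rankOne ℂ (ket (0 : Lat d)) (ket (0 : Lat d)))

/-- The canonical basis vector `|τ⟩ ⊗ |x⟩`. -/
def basisVec {d : ℕ} (b : Spin d × Lat d) : Hil d :=
  WithLp.toLp 2 (Pi.single b.1 (ket b.2))

/-- The domain `{ψ | (x ↦ f(x) ψ_τ(x)) ∈ ℓ²(ℤ^d) for all τ}` of `1 ⊗ f(X)`. -/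
def obsDomain {d : ℕ} (f : Lat d → ℂ) : Submodule ℂ (Hil d) where
  carrier := {ψ | ∀ τ : Spin d, Memℓp (fun x : Lat d => f x * (ψ τ) x) 2}
  add_mem' := by
    intro ψ χ hψ hχ τ
    have h := (hψ τ).add (hχ τ)
    convert h using 1
    funext x
    simp [mul_add]
  zero_mem' := by
    intro τ
    have h : Memℓp (0 : Lat d → ℂ) 2 := zero_memℓp
    convert h using 1
    funext x
    simp
  smul_mem' := by
    intro c ψ hψ τ
    have h := (hψ τ).const_smul c
    convert h using 1
    funext x
    simp [mul_left_comm]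

/-- The (in general unbounded) operator `1 ⊗ f(X)` of multiplication by the function `f` of the
position, on its maximal domain. -/
def posObs {d : ℕ} (f : Lat d → ℂ) : Hil d →ₗ.[ℂ] Hil d where
  domain := obsDomain f
  toFun :=
    { toFun := fun ψ => WithLp.toLp 2 (fun τ : Spin d =>
        (⟨fun x : Lat d => f x * (ψ.1 τ) x, ψ.2 τ⟩ : LatL2 d))
      map_add' := by
        intro ψ χ
        ext τ x
        exact mul_add _ _ _
      map_smul' := by
        intro c ψ
        ext τ x
        exact mul_left_comm _ _ _ }

theorem basisVec_mem {d : ℕ} (f : Lat d → ℂ) (b : Spin d × Lat d) :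
    basisVec b ∈ (posObs f).domain := by
  intro τ
  have h := lp.memℓp (lp.single (E := fun _ : Lat d => ℂ) 2 b.2
    (f b.2 * (if τ = b.1 then 1 else 0)))
  convert h using 1
  funext x
  rw [lp.single_apply]
  by_cases hτ : τ = b.1
  · subst hτ
    by_cases hx : x = b.2
    · subst hx
      simp [basisVec, ket]
    · simp [basisVec, ket, hx]
  · simp [basisVec, hτ]

/-- The diagonal element of `ρ (1 ⊗ f(X))` at the canonical basis vector `b`. -/
def traceTerm {d : ℕ} (ρ : Hil d →L[ℂ] Hil d) (f : Lat d → ℂ) (b : Spin d × Lat d) : ℂ :=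
  inner ℂ (basisVec b) (ρ (posObs f ⟨basisVec b, basisVec_mem f b⟩))

/-- `Tr (ρ (1 ⊗ f(X)))`, computed in the canonical orthonormal basis. -/
def traceObs {d : ℕ} (ρ : Hil d →L[ℂ] Hil d) (f : Lat d → ℂ) : ℂ :=
  ∑' b : Spin d × Lat d, traceTerm ρ f b

/-- The random state at time `n`, for the sequence `ω` of outcomes. -/
def randomState {d : ℕ} {Ω : Type*} (r : Spin d → Lat d)
    (C : Ω → Matrix.unitaryGroup (Spin d) ℂ) (ψ₀ : EuclideanSpace ℂ (Spin d)) (n : ℕ)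
    (ω : ℕ → Ω) : Hil d →L[ℂ] Hil d :=
  evolve r (fun k => (C (ω k) : Matrix (Spin d) (Spin d) ℂ)) (initialState ψ₀) n

/-- `⟨f(X)⟩_{ψ₀}(n)`: the expectation, over i.i.d. coins, of `Tr (ρ_n (1 ⊗ f(X)))`. -/
def mean {d : ℕ} {Ω : Type*} [MeasurableSpace Ω] (μ : Measure Ω) [IsProbabilityMeasure μ]
    (r : Spin d → Lat d) (C : Ω → Matrix.unitaryGroup (Spin d) ℂ)
    (ψ₀ : EuclideanSpace ℂ (Spin d)) (n : ℕ) (f : Lat d → ℂ) : ℂ :=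
  ∫ ω : ℕ → Ω, traceObs (randomState r C ψ₀ n ω) f ∂(Measure.infinitePi fun _ : ℕ => μ)

/-- The characteristic function `Φ_n^{ψ₀}(y)`, at a complex argument `y ∈ ℂ^d`. -/
def charFn {d : ℕ} {Ω : Type*} [MeasurableSpace Ω] (μ : Measure Ω) [IsProbabilityMeasure μ]
    (r : Spin d → Lat d) (C : Ω → Matrix.unitaryGroup (Spin d) ℂ)
    (ψ₀ : EuclideanSpace ℂ (Spin d)) (n : ℕ) (y : Fin d → ℂ) : ℂ :=
  mean μ r C ψ₀ n (fun x => Complex.exp (Complex.I * ∑ j, (x j : ℂ) * y j))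

/-- The diagonal matrix `d(y) = ∑ τ, e^{i y·r(τ)} |τ⟩⟨τ|`. -/
def phase {d : ℕ} (r : Spin d → Lat d) (y : Fin d → ℝ) : Matrix (Spin d) (Spin d) ℂ :=
  Matrix.diagonal fun τ => Complex.exp (Complex.I * ∑ j, (y j : ℂ) * (r τ j : ℂ))

/-- The entrywise expectation of `C(ω) ⊗ conj C(ω)`. -/
def meanCoin {d : ℕ} {Ω : Type*} [MeasurableSpace Ω] (μ : Measure Ω)
    (C : Ω → Matrix.unitaryGroup (Spin d) ℂ) :
    Matrix (Spin d × Spin d) (Spin d × Spin d) ℂ :=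
  Matrix.of fun p q => ∫ ω, (Matrix.kronecker (C ω : Matrix (Spin d) (Spin d) ℂ)
    ((C ω : Matrix (Spin d) (Spin d) ℂ).map star)) p q ∂μ

/-- `M(y, y') = (d(y) ⊗ d(y')) E(C ⊗ conj C)`. -/
def transferMat {d : ℕ} {Ω : Type*} [MeasurableSpace Ω] (μ : Measure Ω) (r : Spin d → Lat d)
    (C : Ω → Matrix.unitaryGroup (Spin d) ℂ) (y y' : Fin d → ℝ) :
    Matrix (Spin d × Spin d) (Spin d × Spin d) ℂ :=
  Matrix.kronecker (phase r y) (phase r y') * meanCoin μ C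

/-- The mean jump `(1 / 2d) ∑ τ, r(τ) ∈ ℝ^d`. -/
def meanJump {d : ℕ} (r : Spin d → Lat d) : Fin d → ℝ :=
  fun j => (1 / (2 * (d : ℝ))) * ∑ τ : Spin d, (r τ j : ℝ)

/-- The product `a · y = ∑ j, a_j y_j` of `a ∈ ℝ^d` and `y ∈ ℂ^d`. -/
def dotC {d : ℕ} (a : Fin d → ℝ) (y : Fin d → ℂ) : ℂ := ∑ j, (a j : ℂ) * y j

/-- The fundamental cell `[0, 2π)^d` of the torus. -/
def cell (d : ℕ) : Set (Fin d → ℝ) := Set.univ.pi fun _ => Set.Ico 0 (2 * Real.pi)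

/-- `∫_{𝕋^d} exp(-(t/2) ∑ i j, y_i D_ij(v) y_j) dv / (2π)^d` for complex `t` and `y`. -/
def diffusiveLimit {d : ℕ} (D : (Fin d → ℝ) → Matrix (Fin d) (Fin d) ℝ) (t : ℂ)
    (y : Fin d → ℂ) : ℂ :=
  (∫ v in cell d, Complex.exp (-(t / 2) * ∑ i, ∑ j, y i * (D v i j : ℂ) * y j)) /
    (2 * Real.pi : ℂ) ^ d

end QWalk

end

/-! For fixed coins the state stays pure, and the Fourier transform turns each shift into a
multiplication by phases. Take the amplitude at quasi-momentum `v + y`, tensor it with the conjugate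
amplitude at `v`, and average. Since the coin of each step is independent of the past, the result
obeys a linear recursion with the matrix `B_y A_v`, where `A_v = M(v, -v)` and `B_y = d(y) ⊗ 1`
(`fourierCorr_succ`). Averaging over `v` selects equal positions, so the characteristic function is
the mean over the torus of a fixed linear functional of `(B_y A_v)^n` (`charFn_eq_integral`).

Unitarity of the coins makes `A_v` a contraction that fixes `∑ |τ⟩ ⊗ |τ⟩` from both sides. The
spectral projection `P` at the eigenvalue 1 is therefore orthogonal, of rank one and independent of
`v`. The spectral assumption puts the rest of the spectrum strictly inside the unit disc
(`spectralRadius_transferMat_sub`), uniformly over a closed period cell by compactness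
(`exists_spectralGap`).

Removing the drift replaces `B_y` by `exp N` with `N` of size `ε = O(|y|)` and `P N P = 0`. Second
order perturbation moves the eigenvalue 1 to `1 + κ/2 + O(ε³)`, with `κ P = P N² P + 2 P N A S N P`
and `S = (1 - A + P)⁻¹`. This is a Green-Kubo formula: `κ = -y·D(v)y` (`sum_diffMat`). The true
eigenvalue is never followed. An explicit approximate left eigenvector, with error `ε³` per step,
gives `P (BA)^n = e^{nκ/2} P + O((ε + nε³) e^{c n ε²})` (`SpectralGap.norm_P_pow_sub_exp`).
Integrated over `v`, this is `exists_norm_charFn_sub_le`.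

The matrix `D(v)` is real by the symmetry exchanging the two tensor factors with a conjugation, and
nonnegative because `A_v` is a contraction (`re_diffForm_nonneg`). Both scaling limits follow by
inserting `y/n` and `y/√n` into the estimate (`DiffusiveApprox.tendsto`). It holds for complex `y`,
so along complex lines holomorphic functions converge locally uniformly; their derivatives at 0 then
converge too, and these are the moments. -/

namespace QWalk

/-! ### Second order perturbation of a simple eigenvalue in a Banach algebra -/

noncomputable section AbstractPerturbation

set_option linter.unusedSectionVars false

variable {𝔸 : Type*} [NormedRing 𝔸] [NormedAlgebra ℂ 𝔸] [NormOneClass 𝔸]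

/-- `A` is a contraction with the simple eigenvalue `1`, spectral projection `P`, reduced resolvent
`S = (1 - A + P)⁻¹` and a quantitative gap for the rest of its spectrum. -/
structure SpectralGap (A P S : 𝔸) (s : ℝ) (m : ℕ) : Prop where
  PA : P * A = P
  AP : A * P = P
  PP : P * P = P
  inv_left : S * (1 - A + P) = 1
  inv_right : (1 - A + P) * S = 1
  norm_A : ‖A‖ ≤ 1
  norm_P : ‖P‖ = 1
  one_le_s : 1 ≤ s
  norm_S : ‖S‖ ≤ s
  one_le_m : 1 ≤ m
  gap : ‖A ^ m * (1 - P)‖ ≤ 1 / 2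

/-- `B` is a perturbation of the identity with generator `N` of size `ε`, such that the eigenvalue
`1` of `A` moves to `1 + κ / 2` to second order. -/
structure SecondOrder (A P S N B : 𝔸) (κ : ℂ) (ε : ℝ) : Prop where
  first : P * N * P = 0
  second : P * N * N * P + (2 : ℂ) • (P * N * A * S * N * P) = κ • P
  norm_N : ‖N‖ ≤ ε
  norm_B : ‖B - (1 + N + (1 / 2 : ℂ) • (N * N))‖ ≤ ε ^ 3
  nonneg : 0 ≤ ε
  le_one : ε ≤ 1

namespace SpectralGap

variable {A P S : 𝔸} {s : ℝ} {m : ℕ}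

theorem PS (h : SpectralGap A P S s m) : P * S = P := by
  have h1 : P * (1 - A + P) = P := by rw [mul_add, mul_sub, mul_one, h.PA, h.PP]; abel
  calc P * S = P * (1 - A + P) * S := by rw [h1]
    _ = P := by rw [mul_assoc, h.inv_right, mul_one]

theorem SP (h : SpectralGap A P S s m) : S * P = P := by
  have h1 : (1 - A + P) * P = P := by rw [add_mul, sub_mul, one_mul, h.AP, h.PP]; abel
  calc S * P = S * ((1 - A + P) * P) := by rw [h1]
    _ = P := by rw [← mul_assoc, h.inv_left, one_mul]

theorem S_one_sub (h : SpectralGap A P S s m) : S * (1 - A) = 1 - P := by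
  have := h.inv_left
  rw [mul_add, h.SP] at this
  exact eq_sub_of_add_eq this

/-- If `y * P = 0`, this says that `x = y * S` solves `x - x * A = y`. Both corrections of the left
eigenvector are obtained in this way. -/
theorem S_mul_A (h : SpectralGap A P S s m) : S * A = S - 1 + P := by
  have := h.S_one_sub
  rw [mul_sub, mul_one] at this
  rw [← sub_eq_zero] at this ⊢
  rw [← neg_eq_zero, ← this]; abel

theorem pow_mul_comm (h : SpectralGap A P S s m) (k : ℕ) (x : 𝔸) :
    A ^ k * (1 - P) * (A * x) = A ^ (k + 1) * (1 - P) * x := by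
  have : (1 - P) * A = A * (1 - P) := by rw [sub_mul, mul_sub, h.PA, h.AP]; simp
  rw [pow_succ, mul_assoc (A ^ k) A, ← this]; simp only [mul_assoc]

theorem norm_pow_le (h : SpectralGap A P S s m) (k : ℕ) : ‖A ^ k‖ ≤ 1 :=
  (_root_.norm_pow_le _ _).trans (pow_le_one₀ (norm_nonneg _) h.norm_A)

theorem norm_pow_mul_le (h : SpectralGap A P S s m) (k : ℕ) (x : 𝔸) : ‖A ^ k * x‖ ≤ ‖x‖ :=
  (norm_mul_le _ _).trans (mul_le_of_le_one_left (norm_nonneg _) (h.norm_pow_le k))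

theorem norm_one_sub_P (h : SpectralGap A P S s m) : ‖1 - P‖ ≤ 2 := by
  refine (norm_sub_le _ _).trans ?_
  rw [h.norm_P, norm_one]; norm_num

/-- The seminorm `x ↦ ∑_{k < m} ‖A^k (1 - P) x‖`, which `A` contracts. -/
def lyap (A P : 𝔸) (m : ℕ) (x : 𝔸) : ℝ := ∑ k ∈ Finset.range m, ‖A ^ k * (1 - P) * x‖

theorem lyap_le (h : SpectralGap A P S s m) (x : 𝔸) : lyap A P m x ≤ m * ‖(1 - P) * x‖ := by
  have : ∀ k ∈ Finset.range m, ‖A ^ k * (1 - P) * x‖ ≤ ‖(1 - P) * x‖ := fun k _ => by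
    rw [mul_assoc]; exact h.norm_pow_mul_le k _
  have := Finset.sum_le_card_nsmul _ _ _ this
  rwa [Finset.card_range, nsmul_eq_mul] at this

theorem le_lyap (h : SpectralGap A P S s m) (x : 𝔸) : ‖(1 - P) * x‖ ≤ lyap A P m x := by
  have h0 : 0 ∈ Finset.range m := Finset.mem_range.2 h.one_le_m
  have := Finset.single_le_sum (f := fun k => ‖A ^ k * (1 - P) * x‖)
    (fun k _ => norm_nonneg _) h0
  simpa [lyap] using this

/-- Applying `A` shifts the summation index: the term `‖(1 - P) x‖` leaves and `‖A^m (1 - P) x‖`, at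
most half of it, enters. The loss is compared with the whole sum by `lyap_le`. -/
theorem lyap_A (h : SpectralGap A P S s m) (x : 𝔸) :
    lyap A P m (A * x) ≤ (1 - 1 / (2 * m)) * lyap A P m x := by
  have hm : (1 : ℝ) ≤ m := by exact_mod_cast h.one_le_m
  have h1 : lyap A P m (A * x) = lyap A P m x - ‖(1 - P) * x‖ + ‖A ^ m * (1 - P) * x‖ := by
    have e1 := Finset.sum_range_succ (fun k => ‖A ^ k * (1 - P) * x‖) m
    have e2 := Finset.sum_range_succ' (fun k => ‖A ^ k * (1 - P) * x‖) m
    simp only [lyap, h.pow_mul_comm]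
    simp only [pow_zero, one_mul] at e2
    linarith
  have h2 : ‖A ^ m * (1 - P) * x‖ ≤ 1 / 2 * ‖(1 - P) * x‖ := by
    have : A ^ m * (1 - P) * x = (A ^ m * (1 - P)) * ((1 - P) * x) := by
      have : (1 - P) * (1 - P) = 1 - P := by
        rw [mul_sub, mul_one, sub_mul, one_mul, h.PP, sub_self, sub_zero]
      rw [mul_assoc (A ^ m) (1 - P) ((1 - P) * x), ← mul_assoc (1 - P) (1 - P) x, this, mul_assoc]
    rw [this]
    exact (norm_mul_le _ _).trans (mul_le_mul_of_nonneg_right h.gap (norm_nonneg _))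
  have h3 := h.lyap_le x
  have h4 : lyap A P m x / (2 * m) ≤ 1 / 2 * ‖(1 - P) * x‖ := by
    rw [div_le_iff₀ (by positivity)]; linarith
  have h5 : (1 - 1 / (2 * m)) * lyap A P m x = lyap A P m x - lyap A P m x / (2 * m) := by ring
  linarith

theorem lyap_add_le (A P : 𝔸) (m : ℕ) (x y : 𝔸) :
    lyap A P m (x + y) ≤ lyap A P m x + lyap A P m y := by
  unfold lyap
  rw [← Finset.sum_add_distrib]
  exact Finset.sum_le_sum fun k _ => by rw [mul_add]; exact norm_add_le _ _

theorem lyap_le_norm (h : SpectralGap A P S s m) (x : 𝔸) : lyap A P m x ≤ 2 * m * ‖x‖ := by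
  have h1 := h.lyap_le x
  have h2 : ‖(1 - P) * x‖ ≤ 2 * ‖x‖ :=
    (norm_mul_le _ _).trans (mul_le_mul_of_nonneg_right h.norm_one_sub_P (norm_nonneg _))
  have : (m : ℝ) * ‖(1 - P) * x‖ ≤ m * (2 * ‖x‖) := by gcongr
  linarith

variable {N B : 𝔸} {κ : ℂ} {ε : ℝ}

theorem norm_mul_A_le (h : SpectralGap A P S s m) (x : 𝔸) : ‖x * A‖ ≤ ‖x‖ :=
  (norm_mul_le _ _).trans (mul_le_of_le_one_right (norm_nonneg _) h.norm_A)

theorem norm_P_mul_le (h : SpectralGap A P S s m) (x : 𝔸) : ‖P * x‖ ≤ ‖x‖ :=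
  (norm_mul_le _ _).trans (by rw [h.norm_P, one_mul])

theorem norm_A_mul_le (h : SpectralGap A P S s m) (x : 𝔸) : ‖A * x‖ ≤ ‖x‖ :=
  (norm_mul_le _ _).trans (mul_le_of_le_one_left (norm_nonneg _) h.norm_A)

theorem norm_mul_S_le (h : SpectralGap A P S s m) {x : 𝔸} {c : ℝ} (hx : ‖x‖ ≤ c) :
    ‖x * S‖ ≤ c * s :=
  (norm_mul_le _ _).trans (mul_le_mul hx h.norm_S (norm_nonneg _) ((norm_nonneg _).trans hx))

theorem norm_mul_N_le (g : SecondOrder A P S N B κ ε) {x : 𝔸} {c : ℝ} (hx : ‖x‖ ≤ c) :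
    ‖x * N‖ ≤ c * ε :=
  (norm_mul_le _ _).trans (mul_le_mul hx g.norm_N (norm_nonneg _) ((norm_nonneg _).trans hx))

/-- `P * N * A * S` is the first order correction of the left eigenvector `P`. -/
theorem norm_first (h : SpectralGap A P S s m) (g : SecondOrder A P S N B κ ε) :
    ‖P * N * A * S‖ ≤ s * ε := by
  have h1 : ‖P * N‖ ≤ ε := (h.norm_P_mul_le _).trans g.norm_N
  have := h.norm_mul_S_le ((h.norm_mul_A_le _).trans h1)
  linarith

theorem norm_kappa (h : SpectralGap A P S s m) (g : SecondOrder A P S N B κ ε) :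
    ‖κ‖ ≤ 3 * s * ε ^ 2 := by
  have h0 : ‖κ • P‖ = ‖κ‖ := by rw [norm_smul, h.norm_P, mul_one]
  have h1 : ‖P * N‖ ≤ 1 * ε := norm_mul_N_le g h.norm_P.le
  have h2 := norm_mul_N_le g h1
  have h3 := norm_mul_N_le g (h.norm_first g)
  have h4 : ‖P * N * N * P‖ ≤ 1 * ε * ε :=
    (norm_mul_le _ _).trans (by rw [h.norm_P, mul_one]; exact h2)
  have h5 : ‖P * N * A * S * N * P‖ ≤ s * ε * ε :=
    (norm_mul_le _ _).trans (by rw [h.norm_P, mul_one]; exact h3)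
  rw [← h0, ← g.second]
  refine (norm_add_le _ _).trans ?_
  rw [norm_smul]
  have := mul_le_mul_of_nonneg_right h.one_le_s (sq_nonneg ε)
  have e2 : ‖(2 : ℂ)‖ = 2 := by norm_num
  rw [e2]
  nlinarith

/-- The second order correction to the left eigenvector. -/
def secondCorr (A P S N : 𝔸) (κ : ℂ) : 𝔸 :=
  ((1 / 2 : ℂ) • (P * N * N * A) + P * N * A * S * N * A - (κ / 2) • P) * S

theorem norm_secondCorr (h : SpectralGap A P S s m) (g : SecondOrder A P S N B κ ε) :
    ‖secondCorr A P S N κ‖ ≤ 3 * s ^ 2 * ε ^ 2 := by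
  have h1 : ‖P * N‖ ≤ 1 * ε := norm_mul_N_le g h.norm_P.le
  have h2 := (h.norm_mul_A_le _).trans (norm_mul_N_le g h1)
  have h3 := (h.norm_mul_A_le _).trans (norm_mul_N_le g (h.norm_first g))
  have hk := h.norm_kappa g
  have : ‖(1 / 2 : ℂ) • (P * N * N * A) + P * N * A * S * N * A - (κ / 2) • P‖ ≤
      3 * s * ε ^ 2 := by
    refine (norm_sub_le _ _).trans ((add_le_add_left (norm_add_le _ _) _).trans ?_)
    rw [norm_smul, norm_smul, h.norm_P, norm_div κ]
    have e2 : ‖(2 : ℂ)‖ = 2 := by norm_num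
    have e3 : ‖(1 / 2 : ℂ)‖ = 1 / 2 := by norm_num
    rw [e2, e3]
    have := mul_le_mul_of_nonneg_right h.one_le_s (sq_nonneg ε)
    nlinarith
  have := h.norm_mul_S_le this
  unfold secondCorr
  linarith

/-- The first order part of the eigenvector equation. Its solvability condition is `P * N * P = 0`,
so the eigenvalue has no first order shift. -/
theorem first_identity (h : SpectralGap A P S s m) (g : SecondOrder A P S N B κ ε) :
    P * N * A * S * A + P * N * A = P * N * A * S := by
  have : P * N * A * P = 0 := by rw [mul_assoc, h.AP, g.first]
  rw [mul_assoc _ S A, h.S_mul_A, mul_add, mul_sub, this, mul_one]; abel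

/-- The second order part of the eigenvector equation. The solvability condition `hz` is half of
`g.second`; it is what determines `κ`. -/
theorem second_identity (h : SpectralGap A P S s m) (g : SecondOrder A P S N B κ ε) :
    secondCorr A P S N κ * A + P * N * A * S * N * A + (1 / 2 : ℂ) • (P * N * N * A) =
      secondCorr A P S N κ + (κ / 2) • P := by
  have hz : ((1 / 2 : ℂ) • (P * N * N * A) + P * N * A * S * N * A - (κ / 2) • P) * P = 0 := by
    rw [sub_mul, add_mul, smul_mul_assoc, smul_mul_assoc, h.PP, mul_assoc _ A P, h.AP,
      mul_assoc _ A P, h.AP]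
    have := congrArg (fun z => (1 / 2 : ℂ) • z) g.second
    simp only [smul_add, smul_smul] at this
    rw [show (1 / 2 : ℂ) * 2 = 1 by norm_num, one_smul, show (1 / 2 : ℂ) * κ = κ / 2 by ring] at this
    rw [this, sub_self]
  unfold secondCorr
  rw [mul_assoc _ S A, h.S_mul_A, mul_add, mul_sub, hz, mul_one]; abel

theorem norm_B_sub_one (g : SecondOrder A P S N B κ ε) :
    ‖B - 1 - N‖ ≤ 2 * ε ^ 2 ∧ ‖B - 1‖ ≤ 3 * ε := by
  have e3 : ‖(1 / 2 : ℂ)‖ = 1 / 2 := by norm_num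
  have h0 := g.nonneg
  have h1' := g.le_one
  have hNN : ‖N * N‖ ≤ ε * ε := (norm_mul_le _ _).trans
    (mul_le_mul g.norm_N g.norm_N (norm_nonneg _) g.nonneg)
  have h1 : ‖B - 1 - N‖ ≤ ε ^ 3 + 1 / 2 * (ε * ε) := by
    have : B - 1 - N = (B - (1 + N + (1 / 2 : ℂ) • (N * N))) + (1 / 2 : ℂ) • (N * N) := by abel
    rw [this]
    refine (norm_add_le _ _).trans (add_le_add g.norm_B ?_)
    rw [norm_smul, e3]; gcongr
  have h2 : ‖B - 1‖ ≤ ‖B - 1 - N‖ + ‖N‖ := by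
    simpa using norm_add_le (B - 1 - N) N
  have h3 : ε ^ 3 ≤ ε ^ 2 := pow_le_pow_of_le_one h0 h1' (by norm_num)
  have h4 : ε ^ 2 ≤ ε := by nlinarith
  constructor
  · nlinarith
  · have := g.norm_N; nlinarith

/-- The first order left eigenvector is invariant up to an error of second order. -/
theorem norm_first_invariant (h : SpectralGap A P S s m) (g : SecondOrder A P S N B κ ε) :
    ‖(P + P * N * A * S) * (B * A) - (P + P * N * A * S)‖ ≤ 5 * s * ε ^ 2 := by
  obtain ⟨h1, h2⟩ := norm_B_sub_one g
  -- The orders zero and one cancel by `PA` and `first_identity`; only what `B` contains beyond them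
  -- survives.
  have key : (P + P * N * A * S) * (B * A) - (P + P * N * A * S) =
      P * (B - 1 - N) * A + P * N * A * S * (B - 1) * A := by
    have := h.first_identity g
    have hPA := h.PA
    linear_combination (norm := noncomm_ring) this + hPA
  rw [key]
  refine (norm_add_le _ _).trans ?_
  have a1 := (h.norm_mul_A_le _).trans ((h.norm_P_mul_le _).trans h1)
  have a2 : ‖P * N * A * S * (B - 1) * A‖ ≤ s * ε * (3 * ε) :=
    (h.norm_mul_A_le _).trans ((norm_mul_le _ _).trans
      (mul_le_mul (h.norm_first g) h2 (norm_nonneg _)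
        (mul_nonneg (zero_le_one.trans h.one_le_s) g.nonneg)))
  have := mul_le_mul_of_nonneg_right h.one_le_s (sq_nonneg ε)
  nlinarith

/-- The second order left eigenvector. -/
def leftVec (A P S N : 𝔸) (κ : ℂ) : 𝔸 := P + P * N * A * S + secondCorr A P S N κ

theorem norm_leftVec_sub (h : SpectralGap A P S s m) (g : SecondOrder A P S N B κ ε) :
    ‖leftVec A P S N κ - P‖ ≤ 4 * s ^ 2 * ε := by
  have e : leftVec A P S N κ - P = P * N * A * S + secondCorr A P S N κ := by
    unfold leftVec; abel
  rw [e]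
  refine (norm_add_le _ _).trans ?_
  have h1 := h.norm_first g
  have h2 := h.norm_secondCorr g
  have hs := h.one_le_s
  have h4 : ε ^ 2 ≤ ε := by have := g.nonneg; have := g.le_one; nlinarith
  have h5 : s * ε ≤ s ^ 2 * ε := mul_le_mul_of_nonneg_right (by nlinarith) g.nonneg
  have h6 : s ^ 2 * ε ^ 2 ≤ s ^ 2 * ε := mul_le_mul_of_nonneg_left h4 (sq_nonneg s)
  nlinarith

/-- The second order left eigenvector is an eigenvector up to an error of third order. -/
theorem norm_leftVec_invariant (h : SpectralGap A P S s m) (g : SecondOrder A P S N B κ ε) :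
    ‖leftVec A P S N κ * (B * A) - (1 + κ / 2) • leftVec A P S N κ‖ ≤ 18 * s ^ 3 * ε ^ 3 := by
  obtain ⟨h1, h2⟩ := norm_B_sub_one g
  have hs := h.one_le_s
  have hε := g.nonneg
  have hε1 := g.le_one
  -- The orders zero, one and two cancel. Each remaining term is of order at least three.
  have key : leftVec A P S N κ * (B * A) - (1 + κ / 2) • leftVec A P S N κ =
      P * (B - (1 + N + (1 / 2 : ℂ) • (N * N))) * A + P * N * A * S * (B - 1 - N) * A +
        secondCorr A P S N κ * (B - 1) * A -
        (κ / 2) • (P * N * A * S + secondCorr A P S N κ) := by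
    have i1 := h.first_identity g
    have i2 := h.second_identity g
    have hPA := h.PA
    unfold leftVec
    rw [add_smul, one_smul]
    simp only [mul_add, mul_sub, add_mul, sub_mul, smul_add, mul_one, mul_smul_comm,
      smul_mul_assoc, ← mul_assoc]
    linear_combination (norm := abel) i1 + i2 + hPA
  rw [key]
  have b1 := h.norm_first g
  have b2 := h.norm_secondCorr g
  have b3 := h.norm_kappa g
  have a1 := (h.norm_mul_A_le _).trans ((h.norm_P_mul_le _).trans g.norm_B)
  have a2 : ‖P * N * A * S * (B - 1 - N) * A‖ ≤ s * ε * (2 * ε ^ 2) :=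
    (h.norm_mul_A_le _).trans ((norm_mul_le _ _).trans
      (mul_le_mul b1 h1 (norm_nonneg _) (by positivity)))
  have a3 : ‖secondCorr A P S N κ * (B - 1) * A‖ ≤ 3 * s ^ 2 * ε ^ 2 * (3 * ε) :=
    (h.norm_mul_A_le _).trans ((norm_mul_le _ _).trans
      (mul_le_mul b2 h2 (norm_nonneg _) (by positivity)))
  have a4 : ‖P * N * A * S + secondCorr A P S N κ‖ ≤ s * ε + 3 * s ^ 2 * ε ^ 2 :=
    (norm_add_le _ _).trans (add_le_add b1 b2)
  have a5 : ‖(κ / 2) • (P * N * A * S + secondCorr A P S N κ)‖ ≤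
      3 / 2 * s * ε ^ 2 * (s * ε + 3 * s ^ 2 * ε ^ 2) := by
    rw [norm_smul, norm_div]
    have e2 : ‖(2 : ℂ)‖ = 2 := by norm_num
    rw [e2]
    refine mul_le_mul (by linarith) a4 (norm_nonneg _) (by positivity)
  -- The four bounds carry the constants `1`, `2`, `9` and `3/2 + 9/2`, which add up to 18 once all
  -- powers of `s` are raised to `s ^ 3`.
  refine (norm_sub_le _ _).trans ?_
  have := norm_add₃_le (a := P * (B - (1 + N + (1 / 2 : ℂ) • (N * N))) * A)
    (b := P * N * A * S * (B - 1 - N) * A) (c := secondCorr A P S N κ * (B - 1) * A)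
  have hε3 : 0 ≤ ε ^ 3 := by positivity
  have c1 : ε ^ 3 ≤ s ^ 3 * ε ^ 3 := le_mul_of_one_le_left hε3 (one_le_pow₀ hs)
  have c2 : s * ε ^ 3 ≤ s ^ 3 * ε ^ 3 :=
    mul_le_mul_of_nonneg_right (le_self_pow₀ hs (by norm_num)) hε3
  have c3 : s ^ 2 * ε ^ 3 ≤ s ^ 3 * ε ^ 3 :=
    mul_le_mul_of_nonneg_right (pow_le_pow_right₀ hs (by norm_num)) hε3
  have c4 : s ^ 3 * ε ^ 4 ≤ s ^ 3 * ε ^ 3 :=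
    mul_le_mul_of_nonneg_left (pow_le_pow_of_le_one hε hε1 (by norm_num)) (by positivity)
  nlinarith

/-- Power boundedness on the diffusive scale. -/
theorem norm_pow_perturbed (h : SpectralGap A P S s m) (g : SecondOrder A P S N B κ ε)
    (hsε : s * ε ≤ 1 / 2) (hmε : 48 * m ^ 2 * ε ≤ 1) (j : ℕ) :
    ‖(B * A) ^ j‖ ≤ 8 * (s + m) * (1 + 20 * s * ε ^ 2) ^ j := by
  obtain ⟨-, h2⟩ := norm_B_sub_one g
  have hs := h.one_le_s
  have hε := g.nonneg
  have hm : (1 : ℝ) ≤ m := by exact_mod_cast h.one_le_m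
  -- The norm is controlled by two quantities that behave well under `B * A`; the correction term
  -- has norm at most `‖x‖ / 2` and is absorbed.
  have hdom : ∀ x : 𝔸, ‖x‖ ≤ 2 * (‖(P + P * N * A * S) * x‖ + lyap A P m x) := by
    intro x
    have e : x = (P + P * N * A * S) * x - P * N * A * S * x + (1 - P) * x := by noncomm_ring
    have n1 : ‖x‖ ≤ ‖(P + P * N * A * S) * x‖ + ‖P * N * A * S * x‖ + ‖(1 - P) * x‖ := by
      conv_lhs => rw [e]
      exact (norm_add_le _ _).trans (add_le_add_left (norm_sub_le _ _) _)
    have n2 : ‖P * N * A * S * x‖ ≤ 1 / 2 * ‖x‖ :=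
      (norm_mul_le _ _).trans
        (mul_le_mul_of_nonneg_right ((h.norm_first g).trans hsε) (norm_nonneg _))
    have n3 := h.le_lyap x
    linarith
  -- The corrected component grows by `1 + O(ε²)` per step; the bound for `P` alone would give `1 +
  -- O(ε)`, too much over `ε⁻²` steps. The other component does not grow beyond `K`: the gain `1 /
  -- (2m)` from `lyap_A` beats the perturbation `24 m ε`, which is where `48 m² ε ≤ 1` enters.
  have hstep : ∀ (x : 𝔸) (K : ℝ), ‖(P + P * N * A * S) * x‖ ≤ K → lyap A P m x ≤ K →
      ‖(P + P * N * A * S) * (B * A * x)‖ ≤ (1 + 20 * s * ε ^ 2) * K ∧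
        lyap A P m (B * A * x) ≤ K := by
    intro x K ha hb
    have hx : ‖x‖ ≤ 4 * K := by have := hdom x; linarith
    constructor
    · have e : (P + P * N * A * S) * (B * A * x) =
        ((P + P * N * A * S) * (B * A) - (P + P * N * A * S)) * x + (P + P * N * A * S) * x := by
        noncomm_ring
      rw [e]
      refine (norm_add_le _ _).trans ?_
      have : ‖((P + P * N * A * S) * (B * A) - (P + P * N * A * S)) * x‖ ≤
          5 * s * ε ^ 2 * (4 * K) :=
        (norm_mul_le _ _).trans (mul_le_mul (h.norm_first_invariant g) hx (norm_nonneg _)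
          (by positivity))
      linarith
    · have e : B * A * x = A * x + (B - 1) * (A * x) := by noncomm_ring
      rw [e]
      refine (lyap_add_le _ _ _ _ _).trans ?_
      have l1 := h.lyap_A x
      have l2 := h.lyap_le_norm ((B - 1) * (A * x))
      have l3 : ‖(B - 1) * (A * x)‖ ≤ 3 * ε * (4 * K) :=
        (norm_mul_le _ _).trans (mul_le_mul h2 ((h.norm_A_mul_le x).trans hx) (norm_nonneg _)
          (by positivity))
      have l4 : 2 * (m : ℝ) * ‖(B - 1) * (A * x)‖ ≤ 2 * m * (3 * ε * (4 * K)) :=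
        mul_le_mul_of_nonneg_left l3 (by positivity)
      have hK : 0 ≤ K := (norm_nonneg _).trans ha
      have hm1 : 0 ≤ 1 - 1 / (2 * (m : ℝ)) := by
        rw [sub_nonneg, div_le_one (by positivity)]; linarith
      have l5 : (1 - 1 / (2 * (m : ℝ))) * lyap A P m x ≤ (1 - 1 / (2 * (m : ℝ))) * K :=
        mul_le_mul_of_nonneg_left hb hm1
      have l6 : 24 * m * ε ≤ 1 / (2 * (m : ℝ)) := by
        rw [le_div_iff₀ (by positivity)]; linarith
      have l7 : 24 * m * ε * K ≤ 1 / (2 * (m : ℝ)) * K := mul_le_mul_of_nonneg_right l6 hK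
      linarith
  have hq : 1 ≤ 1 + 20 * s * ε ^ 2 := by
    have : 0 ≤ s * ε ^ 2 := by positivity
    linarith
  have hind : ∀ j : ℕ, ‖(P + P * N * A * S) * (B * A) ^ j‖ ≤
      (1 + 20 * s * ε ^ 2) ^ j * (2 * (s + m)) ∧
      lyap A P m ((B * A) ^ j) ≤ (1 + 20 * s * ε ^ 2) ^ j * (2 * (s + m)) := by
    intro j
    induction j with
    | zero =>
      simp only [pow_zero, mul_one, one_mul]
      constructor
      · refine (norm_add_le _ _).trans ?_
        rw [h.norm_P]
        have := h.norm_first g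
        linarith
      · have := h.lyap_le_norm (1 : 𝔸)
        rw [norm_one] at this
        linarith
    | succ j ih =>
      have := hstep _ _ ih.1 ih.2
      rw [pow_succ' (B * A), pow_succ' (1 + 20 * s * ε ^ 2), mul_assoc (1 + 20 * s * ε ^ 2)]
      refine ⟨this.1, this.2.trans (le_mul_of_one_le_left ?_ hq)⟩
      positivity
  have h3 := hind j
  have h4 := hdom ((B * A) ^ j)
  linarith [h3.1, h3.2]

/-- For the approximate eigenvector `leftVec`, telescoping over `j` steps costs `O(ε³)` per step,
since the powers of `B * A` are controlled. Exchanging it for `P` in both terms costs `O(ε)` once.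
-/
theorem norm_P_pow_sub (h : SpectralGap A P S s m) (g : SecondOrder A P S N B κ ε)
    (hsε : s * ε ≤ 1 / 2) (hmε : 48 * m ^ 2 * ε ≤ 1) (j : ℕ) :
    ‖P * (B * A) ^ j - (1 + κ / 2) ^ j • P‖ ≤
      200 * s ^ 3 * (s + m) * (ε + j * ε ^ 3) * (1 + 20 * s * ε ^ 2) ^ j := by
  have hs := h.one_le_s
  have hε := g.nonneg
  have hm : (1 : ℝ) ≤ m := by exact_mod_cast h.one_le_m
  set q : ℝ := 1 + 20 * s * ε ^ 2 with hqdef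
  have hq : 1 ≤ q := by
    have : 0 ≤ s * ε ^ 2 := by positivity
    rw [hqdef]; linarith
  have hq0 : 0 ≤ q := zero_le_one.trans hq
  have hlam : ‖1 + κ / 2‖ ≤ q := by
    refine (norm_add_le _ _).trans ?_
    rw [norm_div, norm_one]
    have e2 : ‖(2 : ℂ)‖ = 2 := by norm_num
    have := h.norm_kappa g
    have : 0 ≤ s * ε ^ 2 := by positivity
    rw [e2, hqdef]; linarith
  set L := leftVec A P S N κ with hL
  have hpow := h.norm_pow_perturbed g hsε hmε
  have tel : ∀ j : ℕ, ‖L * (B * A) ^ j - (1 + κ / 2) ^ j • L‖ ≤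
      j * (18 * s ^ 3 * ε ^ 3 * (8 * (s + m))) * q ^ j := by
    intro j
    induction j with
    | zero => simp
    | succ j ih =>
      have e : L * (B * A) ^ (j + 1) - (1 + κ / 2) ^ (j + 1) • L =
          (L * (B * A) - (1 + κ / 2) • L) * (B * A) ^ j +
            (1 + κ / 2) • (L * (B * A) ^ j - (1 + κ / 2) ^ j • L) := by
        rw [pow_succ' (B * A), pow_succ' (1 + κ / 2), smul_sub, smul_smul, sub_mul,
          smul_mul_assoc, mul_assoc L]
        abel
      rw [e]
      refine (norm_add_le _ _).trans ?_
      have t1 : ‖(L * (B * A) - (1 + κ / 2) • L) * (B * A) ^ j‖ ≤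
          18 * s ^ 3 * ε ^ 3 * (8 * (s + m) * q ^ j) :=
        (norm_mul_le _ _).trans (mul_le_mul (h.norm_leftVec_invariant g) (hpow j) (norm_nonneg _)
          (by positivity))
      have t2 : ‖(1 + κ / 2) • (L * (B * A) ^ j - (1 + κ / 2) ^ j • L)‖ ≤
          q * (j * (18 * s ^ 3 * ε ^ 3 * (8 * (s + m))) * q ^ j) := by
        rw [norm_smul]
        exact mul_le_mul hlam ih (norm_nonneg _) hq0
      have t3 : 18 * s ^ 3 * ε ^ 3 * (8 * (s + m)) * q ^ j ≤
          18 * s ^ 3 * ε ^ 3 * (8 * (s + m)) * q ^ (j + 1) :=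
        mul_le_mul_of_nonneg_left (pow_le_pow_right₀ hq (by omega)) (by positivity)
      have t4 : q * (j * (18 * s ^ 3 * ε ^ 3 * (8 * (s + m))) * q ^ j) =
        j * (18 * s ^ 3 * ε ^ 3 * (8 * (s + m))) * q ^ (j + 1) := by ring
      push_cast
      linarith
  have e : P * (B * A) ^ j - (1 + κ / 2) ^ j • P =
      (L * (B * A) ^ j - (1 + κ / 2) ^ j • L) - (L - P) * (B * A) ^ j +
        (1 + κ / 2) ^ j • (L - P) := by
    rw [smul_sub, sub_mul]; abel
  rw [e]
  refine (norm_add_le _ _).trans ((add_le_add_left (norm_sub_le _ _) _).trans ?_)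
  have hLP := h.norm_leftVec_sub g
  rw [← hL] at hLP
  have u1 := tel j
  have u2 : ‖(L - P) * (B * A) ^ j‖ ≤ 4 * s ^ 2 * ε * (8 * (s + m) * q ^ j) :=
    (norm_mul_le _ _).trans (mul_le_mul hLP (hpow j) (norm_nonneg _) (by positivity))
  have u3 : ‖(1 + κ / 2) ^ j • (L - P)‖ ≤ q ^ j * (4 * s ^ 2 * ε) := by
    rw [norm_smul, norm_pow]
    exact mul_le_mul (pow_le_pow_left₀ (norm_nonneg _) hlam j) hLP (norm_nonneg _) (by positivity)
  have v0 : (1 : ℝ) ≤ s + m := by linarith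
  have v1 : s ^ 2 * (s + m) ≤ s ^ 3 * (s + m) :=
    mul_le_mul_of_nonneg_right (pow_le_pow_right₀ hs (by norm_num)) (by linarith)
  have v2 : s ^ 2 ≤ s ^ 2 * (s + m) := le_mul_of_one_le_right (by positivity) v0
  have hQ : 0 ≤ ε * q ^ j := by positivity
  have w1 := mul_le_mul_of_nonneg_right v1 hQ
  have w2 := mul_le_mul_of_nonneg_right (v2.trans v1) hQ
  have w3 : 0 ≤ s ^ 3 * (s + m) * (j * ε ^ 3) * q ^ j := by positivity
  have w4 : 0 ≤ s ^ 3 * (s + m) * (ε * q ^ j) := by positivity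
  nlinarith

theorem norm_pow_sub_pow_le {a b : ℂ} {Q : ℝ} (ha : ‖a‖ ≤ Q) (hb : ‖b‖ ≤ Q) (hQ : 1 ≤ Q) (j : ℕ) :
    ‖a ^ j - b ^ j‖ ≤ j * ‖a - b‖ * Q ^ j := by
  have hQ0 : 0 ≤ Q := zero_le_one.trans hQ
  induction j with
  | zero => simp
  | succ j ih =>
    have e : a ^ (j + 1) - b ^ (j + 1) = (a - b) * a ^ j + b * (a ^ j - b ^ j) := by ring
    rw [e]
    refine (norm_add_le _ _).trans ?_
    rw [norm_mul, norm_mul, norm_pow]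
    have h1 : ‖a - b‖ * ‖a‖ ^ j ≤ ‖a - b‖ * Q ^ (j + 1) := by
      refine mul_le_mul_of_nonneg_left ?_ (norm_nonneg _)
      exact (pow_le_pow_left₀ (norm_nonneg _) ha j).trans (pow_le_pow_right₀ hQ (by omega))
    have h2 : ‖b‖ * ‖a ^ j - b ^ j‖ ≤ Q * (j * ‖a - b‖ * Q ^ j) :=
      mul_le_mul hb ih (norm_nonneg _) hQ0
    have h3 : Q * (j * ‖a - b‖ * Q ^ j) = j * ‖a - b‖ * Q ^ (j + 1) := by ring
    push_cast
    linarith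

/-- The main perturbative estimate. -/
theorem norm_P_pow_sub_exp (h : SpectralGap A P S s m) (g : SecondOrder A P S N B κ ε)
    (hsε : s * ε ≤ 1 / 2) (hmε : 48 * m ^ 2 * ε ≤ 1) (j : ℕ) :
    ‖P * (B * A) ^ j - Complex.exp (j * (κ / 2)) • P‖ ≤
      210 * s ^ 3 * (s + m) * (ε + j * ε ^ 3) * Real.exp (20 * s * (j * ε ^ 2)) := by
  have hs := h.one_le_s
  have hε := g.nonneg
  have hε1 := g.le_one
  have hm : (1 : ℝ) ≤ m := by exact_mod_cast h.one_le_m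
  have e2 : ‖(2 : ℂ)‖ = 2 := by norm_num
  set Q : ℝ := Real.exp (20 * s * ε ^ 2) with hQdef
  have hsε2 : 0 ≤ s * ε ^ 2 := by positivity
  have hk := h.norm_kappa g
  have hk2 : ‖κ / 2‖ ≤ 3 / 2 * s * ε ^ 2 := by rw [norm_div, e2]; linarith
  have hqQ : 1 + 20 * s * ε ^ 2 ≤ Q := by
    rw [hQdef]; linarith [Real.add_one_le_exp (20 * s * ε ^ 2)]
  have hQ1 : 1 ≤ Q := by linarith
  have hlam : ‖1 + κ / 2‖ ≤ Q := by
    refine (norm_add_le _ _).trans ?_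
    rw [norm_one]
    linarith
  have hexp : ‖Complex.exp (κ / 2)‖ ≤ Q := by
    rw [Complex.norm_exp, hQdef]
    refine Real.exp_le_exp.2 ((Complex.re_le_norm _).trans ?_)
    linarith
  have hk1 : ‖κ / 2‖ ≤ 1 := by
    refine hk2.trans ?_
    nlinarith [mul_le_mul hsε hε1 hε (by norm_num)]
  -- The difference is of order `ε⁴`; the order `ε³` is enough, being that of the error per step
  -- already present.
  have hdiff : ‖1 + κ / 2 - Complex.exp (κ / 2)‖ ≤ 3 * s ^ 2 * ε ^ 3 := by
    have := Complex.norm_exp_sub_one_sub_id_le hk1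
    rw [norm_sub_rev, show Complex.exp (κ / 2) - (1 + κ / 2) = Complex.exp (κ / 2) - 1 - κ / 2 by
      ring]
    refine this.trans ((pow_le_pow_left₀ (norm_nonneg _) hk2 2).trans ?_)
    have : ε ^ 4 ≤ ε ^ 3 := pow_le_pow_of_le_one hε hε1 (by norm_num)
    have : s ^ 2 * ε ^ 4 ≤ s ^ 2 * ε ^ 3 := mul_le_mul_of_nonneg_left this (sq_nonneg s)
    have : 0 ≤ s ^ 2 * ε ^ 3 := by positivity
    nlinarith
  have hp := norm_pow_sub_pow_le hlam hexp hQ1 j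
  rw [← Complex.exp_nat_mul] at hp
  have hmain := h.norm_P_pow_sub g hsε hmε j
  have hQj : Q ^ j = Real.exp (20 * s * (j * ε ^ 2)) := by
    rw [hQdef, ← Real.exp_nat_mul]; congr 1; ring
  have e : P * (B * A) ^ j - Complex.exp (j * (κ / 2)) • P =
      (P * (B * A) ^ j - (1 + κ / 2) ^ j • P) +
        ((1 + κ / 2) ^ j - Complex.exp (j * (κ / 2))) • P := by
    rw [sub_smul]; abel
  rw [e, ← hQj]
  refine (norm_add_le _ _).trans ?_
  rw [norm_smul, h.norm_P, mul_one]
  have w1 : 200 * s ^ 3 * (s + m) * (ε + j * ε ^ 3) * (1 + 20 * s * ε ^ 2) ^ j ≤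
      200 * s ^ 3 * (s + m) * (ε + j * ε ^ 3) * Q ^ j :=
    mul_le_mul_of_nonneg_left (pow_le_pow_left₀ (by linarith) hqQ j) (by positivity)
  have w2 : j * ‖1 + κ / 2 - Complex.exp (κ / 2)‖ * Q ^ j ≤ j * (3 * s ^ 2 * ε ^ 3) * Q ^ j := by
    gcongr
  have v0 : (1 : ℝ) ≤ s + m := by linarith
  have v1 : s ^ 2 ≤ s ^ 3 * (s + m) :=
    (pow_le_pow_right₀ hs (by norm_num)).trans (le_mul_of_one_le_right (by positivity) v0)
  have w3 : s ^ 2 * (j * ε ^ 3 * Q ^ j) ≤ s ^ 3 * (s + m) * (j * ε ^ 3 * Q ^ j) :=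
    mul_le_mul_of_nonneg_right v1 (by positivity)
  have w4 : 0 ≤ s ^ 3 * (s + m) * (ε * Q ^ j) := by positivity
  have w5 : 0 ≤ s ^ 3 * (s + m) * (j * ε ^ 3 * Q ^ j) := by positivity
  nlinarith

end SpectralGap

end AbstractPerturbation

end QWalk

namespace QWalk

/-! ### Pure states, amplitudes and their Fourier transform -/

section Walk

variable {d : ℕ}

theorem tensorOp_apply (A : Matrix (Spin d) (Spin d) ℂ) (L : LatL2 d →L[ℂ] LatL2 d)
    (ψ : Hil d) (τ : Spin d) : tensorOp A L ψ τ = ∑ σ, A τ σ • L (ψ σ) := by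
  simp [tensorOp]

theorem latTranslate_apply (a : Lat d) (φ : LatL2 d) (x : Lat d) :
    latTranslate a φ x = φ (x - a) := rfl

theorem stepOp_apply (r : Spin d → Lat d) (C : Matrix (Spin d) (Spin d) ℂ) (ψ : Hil d)
    (τ : Spin d) (x : Lat d) :
    stepOp r C ψ τ x = ∑ σ, C τ σ * ψ σ (x - r τ) := by
  have h1 : stepOp r C ψ τ = latTranslate (r τ) (∑ σ, C τ σ • ψ σ) := by
    simp only [stepOp, shift, ContinuousLinearMap.comp_apply, sum_apply,
      WithLp.ofLp_sum, Finset.sum_apply, tensorOp_apply, ContinuousLinearMap.id_apply]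
    rw [Finset.sum_eq_single τ, Finset.sum_eq_single τ]
    · simp
    · intro σ _ h; simp [h.symm]
    · simp
    · intro σ _ h; simp [h]
    · simp
  rw [h1, latTranslate_apply, lp.coeFn_sum, Finset.sum_apply]
  rfl

/-- The amplitude at time `n` at the site `x`, in the spin state `τ`. -/
noncomputable def ampl (r : Spin d → Lat d) (Cs : ℕ → Matrix (Spin d) (Spin d) ℂ)
    (ψ₀ : EuclideanSpace ℂ (Spin d)) : ℕ → Spin d → Lat d → ℂ
  | 0, τ, x => if x = 0 then ψ₀ τ else 0
  | n + 1, τ, x => ∑ σ, Cs n τ σ * ampl r Cs ψ₀ n σ (x - r τ)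

/-- The state vector at time `n`. -/
noncomputable def walkVec (r : Spin d → Lat d) (Cs : ℕ → Matrix (Spin d) (Spin d) ℂ)
    (ψ₀ : EuclideanSpace ℂ (Spin d)) : ℕ → Hil d
  | 0 => WithLp.toLp 2 fun τ => ψ₀ τ • ket 0
  | n + 1 => stepOp r (Cs n) (walkVec r Cs ψ₀ n)

theorem walkVec_apply (r : Spin d → Lat d) (Cs : ℕ → Matrix (Spin d) (Spin d) ℂ)
    (ψ₀ : EuclideanSpace ℂ (Spin d)) (n : ℕ) (τ : Spin d) (x : Lat d) :
    walkVec r Cs ψ₀ n τ x = ampl r Cs ψ₀ n τ x := by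
  induction n generalizing τ x with
  | zero =>
    by_cases h : x = 0
    · subst h; simp [walkVec, ampl, ket]
    · simp [walkVec, ampl, ket, h]
  | succ n ih => simp only [walkVec, ampl, stepOp_apply, ih]

/-- Conjugating a rank one operator by `U` moves both of its vectors by `U`. So for fixed coins the
density matrix carries no more information than the recursion `ampl`. -/
theorem evolve_eq_rankOne (r : Spin d → Lat d) (Cs : ℕ → Matrix (Spin d) (Spin d) ℂ)
    (ψ₀ : EuclideanSpace ℂ (Spin d)) (n : ℕ) :
    evolve r Cs (initialState ψ₀) n =
      InnerProductSpace.rankOne ℂ (walkVec r Cs ψ₀ n) (walkVec r Cs ψ₀ n) := by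
  induction n with
  | zero =>
    refine ContinuousLinearMap.ext fun ψ => ?_
    refine PiLp.ext fun τ => ?_
    simp only [evolve, walkVec, initialState, tensorOp_apply, InnerProductSpace.rankOne_apply,
      PiLp.inner_apply, PiLp.smul_apply, Matrix.of_apply, inner_smul_left, smul_smul,
      ← Finset.sum_smul, Finset.sum_mul]
    refine congrArg (· • ket (0 : Lat d)) (Finset.sum_congr rfl fun σ _ => ?_)
    simp only [starRingEnd_apply]
    ring
  | succ n ih =>
    rw [evolve, ih, stepState, walkVec, InnerProductSpace.rankOne_comp,
      InnerProductSpace.comp_rankOne, ContinuousLinearMap.adjoint_adjoint]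

theorem posObs_basisVec (f : Lat d → ℂ) (b : Spin d × Lat d) :
    posObs f ⟨basisVec b, basisVec_mem f b⟩ = f b.2 • basisVec b := by
  refine PiLp.ext fun τ => lp.ext (funext fun x => ?_)
  change f x * (basisVec b τ) x = f b.2 * (basisVec b τ) x
  by_cases hτ : τ = b.1
  · subst hτ
    by_cases hx : x = b.2
    · subst hx; rfl
    · simp [basisVec, ket, hx]
  · simp [basisVec, hτ]

theorem inner_basisVec (b : Spin d × Lat d) (ψ : Hil d) :
    inner ℂ (basisVec b) ψ = ψ b.1 b.2 := by
  rw [PiLp.inner_apply, Finset.sum_eq_single b.1]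
  · simp only [basisVec, Pi.single_eq_same, ket]
    rw [lp.inner_single_left]
    simp
  · intro σ _ h
    simp [basisVec, h]
  · simp

theorem traceTerm_evolve (r : Spin d → Lat d) (Cs : ℕ → Matrix (Spin d) (Spin d) ℂ)
    (ψ₀ : EuclideanSpace ℂ (Spin d)) (n : ℕ) (f : Lat d → ℂ) (b : Spin d × Lat d) :
    traceTerm (evolve r Cs (initialState ψ₀) n) f b =
      f b.2 * (ampl r Cs ψ₀ n b.1 b.2 * star (ampl r Cs ψ₀ n b.1 b.2)) := by
  rw [traceTerm, posObs_basisVec, evolve_eq_rankOne, map_smul, inner_smul_right,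
    InnerProductSpace.rankOne_apply, inner_smul_right, inner_basisVec, ← inner_conj_symm,
    inner_basisVec, walkVec_apply, starRingEnd_apply]
  ring

/-- The sites that can be reached in `n` steps. -/
noncomputable def reach (r : Spin d → Lat d) : ℕ → Finset (Lat d)
  | 0 => {0}
  | n + 1 => Finset.univ.biUnion fun τ => (reach r n).map (Equiv.addRight (r τ)).toEmbedding

theorem ampl_eq_zero (r : Spin d → Lat d) (Cs : ℕ → Matrix (Spin d) (Spin d) ℂ)
    (ψ₀ : EuclideanSpace ℂ (Spin d)) (n : ℕ) (τ : Spin d) (x : Lat d) (hx : x ∉ reach r n) :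
    ampl r Cs ψ₀ n τ x = 0 := by
  induction n generalizing τ x with
  | zero => simp only [reach, Finset.mem_singleton] at hx; simp [ampl, hx]
  | succ n ih =>
    refine Finset.sum_eq_zero fun σ _ => ?_
    rw [ih, mul_zero]
    intro h
    refine hx (Finset.mem_biUnion.2 ⟨τ, Finset.mem_univ _, Finset.mem_map.2 ⟨_, h, ?_⟩⟩)
    simp

theorem traceTerm_evolve_eq_zero (r : Spin d → Lat d) (Cs : ℕ → Matrix (Spin d) (Spin d) ℂ)
    (ψ₀ : EuclideanSpace ℂ (Spin d)) (n : ℕ) (f : Lat d → ℂ) (b : Spin d × Lat d)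
    (hb : b ∉ (Finset.univ : Finset (Spin d)) ×ˢ reach r n) :
    traceTerm (evolve r Cs (initialState ψ₀) n) f b = 0 := by
  rw [traceTerm_evolve, ampl_eq_zero r Cs ψ₀ n b.1 b.2 (by simpa using hb)]
  simp

theorem summable_traceTerm (r : Spin d → Lat d) (Cs : ℕ → Matrix (Spin d) (Spin d) ℂ)
    (ψ₀ : EuclideanSpace ℂ (Spin d)) (n : ℕ) (f : Lat d → ℂ) :
    Summable (traceTerm (evolve r Cs (initialState ψ₀) n) f) :=
  summable_of_ne_finset_zero fun b hb => traceTerm_evolve_eq_zero r Cs ψ₀ n f b hb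

theorem traceObs_evolve (r : Spin d → Lat d) (Cs : ℕ → Matrix (Spin d) (Spin d) ℂ)
    (ψ₀ : EuclideanSpace ℂ (Spin d)) (n : ℕ) (f : Lat d → ℂ) :
    traceObs (evolve r Cs (initialState ψ₀) n) f =
      ∑ x ∈ reach r n, f x * ∑ τ, ampl r Cs ψ₀ n τ x * star (ampl r Cs ψ₀ n τ x) := by
  rw [traceObs, tsum_eq_sum fun b hb => traceTerm_evolve_eq_zero r Cs ψ₀ n f b hb,
    Finset.sum_product_right]
  simp only [traceTerm_evolve, Finset.mul_sum]

/-- A crude bound, exponential in `n`; it serves only to make the expectations at fixed time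
integrable. -/
theorem norm_ampl_le (r : Spin d → Lat d) {Cs : ℕ → Matrix (Spin d) (Spin d) ℂ}
    (hCs : ∀ k τ σ, ‖Cs k τ σ‖ ≤ 1)
    (ψ₀ : EuclideanSpace ℂ (Spin d)) (n : ℕ) (τ : Spin d) (x : Lat d) :
    ‖ampl r Cs ψ₀ n τ x‖ ≤ (Fintype.card (Spin d) : ℝ) ^ n * ‖ψ₀‖ := by
  induction n generalizing τ x with
  | zero =>
    simp only [ampl, pow_zero, one_mul]
    split_ifs
    · exact PiLp.norm_apply_le _ _
    · simp
  | succ n ih =>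
    refine (norm_sum_le _ _).trans ?_
    have : ∀ σ ∈ (Finset.univ : Finset (Spin d)),
        ‖Cs n τ σ * ampl r Cs ψ₀ n σ (x - r τ)‖ ≤ (Fintype.card (Spin d) : ℝ) ^ n * ‖ψ₀‖ :=
      fun σ _ => by
        rw [norm_mul]
        exact (mul_le_of_le_one_left (norm_nonneg _) (hCs _ _ _)).trans (ih _ _)
    refine (Finset.sum_le_card_nsmul _ _ _ this).trans (le_of_eq ?_)
    rw [nsmul_eq_mul, Finset.card_univ]
    ring

/-- The plane wave `e^{i x·k}` at complex quasi-momentum. -/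
noncomputable def wave (x : Lat d) (k : Fin d → ℂ) : ℂ :=
  Complex.exp (Complex.I * ∑ j, (x j : ℂ) * k j)

theorem wave_add_left (x x' : Lat d) (k : Fin d → ℂ) :
    wave (x + x') k = wave x k * wave x' k := by
  rw [wave, wave, wave, ← Complex.exp_add, ← mul_add, ← Finset.sum_add_distrib]
  congr 2
  refine Finset.sum_congr rfl fun j _ => ?_
  push_cast [Pi.add_apply]
  ring

theorem wave_add_right (x : Lat d) (k k' : Fin d → ℂ) :
    wave x (k + k') = wave x k * wave x k' := by
  rw [wave, wave, wave, ← Complex.exp_add, ← mul_add, ← Finset.sum_add_distrib]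
  congr 2
  refine Finset.sum_congr rfl fun j _ => ?_
  rw [Pi.add_apply]
  ring

/-- The Fourier transform of the amplitude, at complex quasi-momentum. -/
noncomputable def fourierAmpl (r : Spin d → Lat d) (Cs : ℕ → Matrix (Spin d) (Spin d) ℂ)
    (ψ₀ : EuclideanSpace ℂ (Spin d)) (k : Fin d → ℂ) : ℕ → Spin d → ℂ
  | 0, τ => ψ₀ τ
  | n + 1, τ => wave (r τ) k *
      ∑ σ, Cs n τ σ * fourierAmpl r Cs ψ₀ k n σ

/-- Plane waves are characters, so a translation becomes a phase. The sums are finite, so complex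
quasi-momenta are allowed. -/
theorem fourierAmpl_eq_sum (r : Spin d → Lat d) (Cs : ℕ → Matrix (Spin d) (Spin d) ℂ)
    (ψ₀ : EuclideanSpace ℂ (Spin d)) (k : Fin d → ℂ) (n : ℕ) (τ : Spin d) :
    fourierAmpl r Cs ψ₀ k n τ =
      ∑ x ∈ reach r n, wave x k * ampl r Cs ψ₀ n τ x := by
  induction n generalizing τ with
  | zero => simp [fourierAmpl, reach, ampl, wave]
  | succ n ih =>
    have hsub : (reach r n).map (Equiv.addRight (r τ)).toEmbedding ⊆ reach r (n + 1) :=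
      Finset.subset_biUnion_of_mem
        (fun τ => (reach r n).map (Equiv.addRight (r τ)).toEmbedding) (Finset.mem_univ τ)
    -- For the spin `τ`, only the translate of `reach r n` by `r τ` contributes to the next step.
    rw [← Finset.sum_subset hsub]
    · rw [Finset.sum_map, fourierAmpl]
      simp only [ih, Finset.mul_sum]
      rw [Finset.sum_comm]
      refine Finset.sum_congr rfl fun x _ => ?_
      simp only [ampl, Finset.mul_sum, Equiv.coe_toEmbedding, Equiv.coe_addRight,
        add_sub_cancel_right]
      refine Finset.sum_congr rfl fun σ _ => ?_
      rw [wave_add_left]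
      ring
    · intro x _ hx
      have : ampl r Cs ψ₀ (n + 1) τ x = 0 := by
        refine Finset.sum_eq_zero fun σ _ => ?_
        rw [ampl_eq_zero, mul_zero]
        intro h
        exact hx (Finset.mem_map.2 ⟨_, h, by simp⟩)
      rw [this, mul_zero]

end Walk

end QWalk

namespace QWalk

/-! ### Averaging over the coins: the transfer matrix recursion -/

noncomputable section Expectation

set_option linter.unusedSectionVars false

variable {d : ℕ} {Ω : Type*} [MeasurableSpace Ω] (μ : Measure Ω) [IsProbabilityMeasure μ]

/-- The law of a sequence of i.i.d. coins. -/
abbrev seqLaw : Measure (ℕ → Ω) := Measure.infinitePi fun _ : ℕ => μ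

/-- Independence of the coordinate `n` from the earlier ones, for an `H` given on the whole sequence
space. -/
theorem integral_mul_of_dependsOn_lt (n : ℕ) {F : Ω → ℂ} (hF : Measurable F)
    {H : (ℕ → Ω) → ℂ} (hH : Measurable H)
    (hdep : ∀ ω ω' : ℕ → Ω, (∀ k < n, ω k = ω' k) → H ω = H ω') :
    ∫ ω, F (ω n) * H ω ∂(seqLaw μ) = (∫ ω, F ω ∂μ) * ∫ ω, H ω ∂(seqLaw μ) := by
  classical
  have hne : Nonempty Ω := nonempty_of_isProbabilityMeasure μ
  obtain ⟨ω₀⟩ := hne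
  have hind : ProbabilityTheory.iIndepFun (fun (i : ℕ) (ω : ℕ → Ω) => ω i) (seqLaw μ) :=
    ProbabilityTheory.iIndepFun_infinitePi (X := fun _ ω => ω) (fun _ => measurable_id)
  have hind2 := hind.indepFun_finset {n} (Finset.range n) (by simp)
    (fun i => measurable_pi_apply i)
  -- Filling the remaining coordinates with a fixed point exhibits `H` as a measurable function of
  -- the first `n`; by `hdep` the filling is irrelevant.
  let ext : (Finset.range n → Ω) → (ℕ → Ω) := fun u k =>
    if h : k ∈ Finset.range n then u ⟨k, h⟩ else ω₀
  have hext : Measurable ext := by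
    refine measurable_pi_lambda _ fun k => ?_
    by_cases h : k ∈ Finset.range n
    · simp only [ext, h, dif_pos]; exact measurable_pi_apply _
    · simp only [ext, h, dif_neg, not_false_eq_true]; exact measurable_const
  have hF' : Measurable fun u : (({n} : Finset ℕ) → Ω) => F (u ⟨n, by simp⟩) :=
    hF.comp (measurable_pi_apply _)
  have h := hind2.comp hF' (hH.comp hext)
  have key := h.integral_fun_mul_eq_mul_integral
    (hF'.comp (by fun_prop)).aestronglyMeasurable
    ((hH.comp hext).comp (by fun_prop)).aestronglyMeasurable
  have e1 : ∀ ω : ℕ → Ω, H (ext fun i : Finset.range n => ω i) = H ω := fun ω =>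
    hdep _ _ fun k hk => by simp [ext, hk]
  simp only [Function.comp_def, e1] at key
  rw [key]
  congr 1
  have := integral_map (μ := seqLaw μ) (measurable_pi_apply n).aemeasurable
    (f := F) hF.aestronglyMeasurable
  rw [Measure.infinitePi_map_eval] at this
  exact this.symm

variable (r : Spin d → Lat d) (C : Ω → Matrix.unitaryGroup (Spin d) ℂ)
  (ψ₀ : EuclideanSpace ℂ (Spin d))

/-- The sequence of coin matrices. -/
abbrev coins (ω : ℕ → Ω) (k : ℕ) : Matrix (Spin d) (Spin d) ℂ := C (ω k)

theorem norm_coin_le (U : Matrix.unitaryGroup (Spin d) ℂ) (τ σ : Spin d) :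
    ‖(U : Matrix (Spin d) (Spin d) ℂ) τ σ‖ ≤ 1 :=
  entry_norm_bound_of_unitary U.2 τ σ

section Measurability

variable {C}

theorem measurable_ampl
    (hC : ∀ τ σ, Measurable fun ω => (C ω : Matrix (Spin d) (Spin d) ℂ) τ σ)
    (n : ℕ) (τ : Spin d) (x : Lat d) :
    Measurable fun ω => ampl r (coins C ω) ψ₀ n τ x := by
  induction n generalizing τ x with
  | zero => exact measurable_const
  | succ n ih =>
    exact Finset.measurable_sum _ fun σ _ =>
      ((hC τ σ).comp (measurable_pi_apply n)).mul (ih σ _)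

theorem measurable_fourierAmpl
    (hC : ∀ τ σ, Measurable fun ω => (C ω : Matrix (Spin d) (Spin d) ℂ) τ σ)
    (k : Fin d → ℂ) (n : ℕ) (τ : Spin d) :
    Measurable fun ω => fourierAmpl r (coins C ω) ψ₀ k n τ := by
  simp only [fourierAmpl_eq_sum]
  exact Finset.measurable_sum _ fun x _ => (measurable_ampl r ψ₀ hC n τ x).const_mul _

theorem integrable_ampl_mul
    (hC : ∀ τ σ, Measurable fun ω => (C ω : Matrix (Spin d) (Spin d) ℂ) τ σ)
    (n : ℕ) (τ τ' : Spin d) (x x' : Lat d) :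
    Integrable (fun ω => ampl r (coins C ω) ψ₀ n τ x * star (ampl r (coins C ω) ψ₀ n τ' x'))
      (seqLaw μ) := by
  refine Integrable.of_bound ((measurable_ampl r ψ₀ hC n τ x).mul
    (continuous_star.measurable.comp (measurable_ampl r ψ₀ hC n τ' x'))).aestronglyMeasurable
    ((Fintype.card (Spin d) : ℝ) ^ n * ‖ψ₀‖ * ((Fintype.card (Spin d) : ℝ) ^ n * ‖ψ₀‖))
    (ae_of_all _ fun ω => ?_)
  rw [norm_mul, norm_star]
  have h : ∀ τ x, _ := norm_ampl_le r (Cs := coins C ω) (fun k => norm_coin_le (C (ω k))) ψ₀ n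
  exact mul_le_mul (h _ _) (h _ _) (norm_nonneg _) (by positivity)

theorem integrable_fourierAmpl_mul
    (hC : ∀ τ σ, Measurable fun ω => (C ω : Matrix (Spin d) (Spin d) ℂ) τ σ)
    (k k' : Fin d → ℂ) (n : ℕ) (τ τ' : Spin d) :
    Integrable (fun ω => fourierAmpl r (coins C ω) ψ₀ k n τ *
      star (fourierAmpl r (coins C ω) ψ₀ k' n τ')) (seqLaw μ) := by
  simp only [fourierAmpl_eq_sum, star_sum, Finset.sum_mul_sum, star_mul']
  refine integrable_finsetSum _ fun x _ => integrable_finsetSum _ fun x' _ => ?_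
  refine ((integrable_ampl_mul μ r ψ₀ hC n τ τ' x x').const_mul
    (wave x k * star (wave x' k'))).congr (ae_of_all _ fun ω => ?_)
  simp only
  ring

end Measurability

theorem fourierAmpl_congr {Cs Cs' : ℕ → Matrix (Spin d) (Spin d) ℂ} (k : Fin d → ℂ) (n : ℕ)
    (h : ∀ j < n, Cs j = Cs' j) : fourierAmpl r Cs ψ₀ k n = fourierAmpl r Cs' ψ₀ k n := by
  induction n with
  | zero => rfl
  | succ n ih =>
    funext τ
    rw [fourierAmpl, fourierAmpl, ih fun j hj => h j (by omega), h n (by omega)]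

/-- The two-point function of the amplitudes at time `n`. -/
def corr (n : ℕ) (x x' : Lat d) (p : Spin d × Spin d) : ℂ :=
  ∫ ω, ampl r (coins C ω) ψ₀ n p.1 x * star (ampl r (coins C ω) ψ₀ n p.2 x') ∂(seqLaw μ)

/-- The probability of being at `x` at time `n`. -/
def siteProb (n : ℕ) (x : Lat d) : ℂ := ∑ τ, corr μ r C ψ₀ n x x (τ, τ)

/-- The two-point function of the Fourier transforms of the amplitudes at time `n`. -/
def fourierCorr (v : Fin d → ℝ) (y : Fin d → ℂ) (n : ℕ) (p : Spin d × Spin d) : ℂ :=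
  ∫ ω, fourierAmpl r (coins C ω) ψ₀ ((fun j => (v j : ℂ)) + y) n p.1 *
    star (fourierAmpl r (coins C ω) ψ₀ (fun j => (v j : ℂ)) n p.2) ∂(seqLaw μ)

variable {C}

theorem integrable_traceObs
    (hC : ∀ τ σ, Measurable fun ω => (C ω : Matrix (Spin d) (Spin d) ℂ) τ σ)
    (n : ℕ) (f : Lat d → ℂ) :
    Integrable (fun ω => traceObs (randomState r C ψ₀ n ω) f) (seqLaw μ) := by
  simp only [randomState, traceObs_evolve]
  exact integrable_finsetSum _ fun x _ => (integrable_finsetSum _ fun τ _ =>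
    integrable_ampl_mul μ r ψ₀ hC n τ τ x x).const_mul _

theorem mean_eq_sum
    (hC : ∀ τ σ, Measurable fun ω => (C ω : Matrix (Spin d) (Spin d) ℂ) τ σ)
    (n : ℕ) (f : Lat d → ℂ) :
    mean μ r C ψ₀ n f = ∑ x ∈ reach r n, f x * siteProb μ r C ψ₀ n x := by
  simp only [mean, randomState, traceObs_evolve]
  rw [integral_finsetSum _ fun x _ => (integrable_finsetSum _ fun τ _ =>
    integrable_ampl_mul μ r ψ₀ hC n τ τ x x).const_mul _]
  refine Finset.sum_congr rfl fun x _ => ?_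
  rw [integral_const_mul, integral_finsetSum _ fun τ _ =>
    integrable_ampl_mul μ r ψ₀ hC n τ τ x x]
  rfl

theorem charFn_eq_sum
    (hC : ∀ τ σ, Measurable fun ω => (C ω : Matrix (Spin d) (Spin d) ℂ) τ σ)
    (n : ℕ) (y : Fin d → ℂ) :
    charFn μ r C ψ₀ n y = ∑ x ∈ reach r n, wave x y * siteProb μ r C ψ₀ n x :=
  mean_eq_sum μ r ψ₀ hC n _

theorem star_wave (x : Lat d) (v : Fin d → ℝ) :
    star (wave x fun j => (v j : ℂ)) = wave x fun j => ((-v j : ℝ) : ℂ) := by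
  rw [wave, wave, ← starRingEnd_apply, ← Complex.exp_conj]
  simp

/-- As `v` is real, the conjugated wave is the wave at the opposite site, so `v` enters only through
`x - x'`. The argument `y` sits in the unconjugated factor alone. -/
theorem fourierCorr_eq_sum
    (hC : ∀ τ σ, Measurable fun ω => (C ω : Matrix (Spin d) (Spin d) ℂ) τ σ)
    (v : Fin d → ℝ) (y : Fin d → ℂ) (n : ℕ) (p : Spin d × Spin d) :
    fourierCorr μ r C ψ₀ v y n p = ∑ x ∈ reach r n, ∑ x' ∈ reach r n,
      wave (x - x') (fun j => (v j : ℂ)) * (wave x y * corr μ r C ψ₀ n x x' p) := by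
  have e : ∀ x x' : Lat d, wave (x - x') (fun j => (v j : ℂ)) =
      wave x (fun j => (v j : ℂ)) * star (wave x' fun j => (v j : ℂ)) := fun x x' => by
    have h := wave_add_left (x - x') x' (fun j => (v j : ℂ))
    rw [sub_add_cancel] at h
    rw [h, mul_assoc, ← starRingEnd_apply, Complex.mul_conj, Complex.normSq_eq_norm_sq]
    have : ‖wave x' fun j => (v j : ℂ)‖ = 1 := by
      rw [wave, Complex.norm_exp]
      simp [← Complex.ofReal_intCast, ← Complex.ofReal_mul, ← Complex.ofReal_sum]
    rw [this]; simp
  simp only [fourierCorr, fourierAmpl_eq_sum, star_sum, Finset.sum_mul_sum, star_mul']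
  have hi : ∀ x x' : Lat d, Integrable (fun ω =>
      wave x ((fun j => (v j : ℂ)) + y) * ampl r (coins C ω) ψ₀ n p.1 x *
        (star (wave x' fun j => (v j : ℂ)) * star (ampl r (coins C ω) ψ₀ n p.2 x')))
        (seqLaw μ) := fun x x' =>
    ((integrable_ampl_mul μ r ψ₀ hC n p.1 p.2 x x').const_mul
      (wave x ((fun j => (v j : ℂ)) + y) * star (wave x' fun j => (v j : ℂ)))).congr
      (ae_of_all _ fun ω => by simp only; ring)
  rw [integral_finsetSum _ fun x _ => integrable_finsetSum _ fun x' _ => hi x x']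
  refine Finset.sum_congr rfl fun x _ => ?_
  rw [integral_finsetSum _ fun x' _ => hi x x']
  refine Finset.sum_congr rfl fun x' _ => ?_
  rw [e, corr, ← integral_const_mul, ← integral_const_mul]
  refine integral_congr_ae (ae_of_all _ fun ω => ?_)
  simp only [wave_add_right]
  ring

/-- The diagonal matrix `d(y) ⊗ 1` for complex `y`. -/
def phaseLeft (y : Fin d → ℂ) : Matrix (Spin d × Spin d) (Spin d × Spin d) ℂ :=
  Matrix.diagonal fun p => wave (r p.1) y

theorem meanCoin_apply (p q : Spin d × Spin d) :
    meanCoin μ C p q = ∫ ω, (C ω : Matrix (Spin d) (Spin d) ℂ) p.1 q.1 *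
      star ((C ω : Matrix (Spin d) (Spin d) ℂ) p.2 q.2) ∂μ := rfl

/-- `d(-v)` is the conjugate of `d(v)` for real `v`. Multiplying by `phaseLeft r y` thus realises
`M(v + y, -v)` for complex `y`, while `transferMat` takes only real arguments. -/
theorem phaseLeft_mul_transferMat_apply (v : Fin d → ℝ) (y : Fin d → ℂ)
    (p q : Spin d × Spin d) :
    (phaseLeft r y * transferMat μ r C v (-v)) p q =
      wave (r p.1) ((fun j => (v j : ℂ)) + y) * star (wave (r p.2) fun j => (v j : ℂ)) *
        meanCoin μ C p q := by
  have h1 : phase r v = Matrix.diagonal fun τ => wave (r τ) fun j => (v j : ℂ) := by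
    unfold phase wave
    simp only [mul_comm]
  have h2 : phase r (-v) = Matrix.diagonal fun τ => star (wave (r τ) fun j => (v j : ℂ)) := by
    simp only [star_wave]
    unfold phase wave
    simp only [mul_comm, Pi.neg_apply]
  rw [transferMat, h1, h2, phaseLeft, Matrix.kronecker, Matrix.diagonal_kronecker_diagonal,
    Matrix.diagonal_mul, Matrix.diagonal_mul, wave_add_right]
  ring

/-- The coin `ω n` is independent of the amplitudes at time `n`, so the expectation factorises and
the coin enters only through `meanCoin`. -/
theorem fourierCorr_succ
    (hC : ∀ τ σ, Measurable fun ω => (C ω : Matrix (Spin d) (Spin d) ℂ) τ σ)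
    (v : Fin d → ℝ) (y : Fin d → ℂ) (n : ℕ) :
    fourierCorr μ r C ψ₀ v y (n + 1) =
      (phaseLeft r y * transferMat μ r C v (-v)).mulVec (fourierCorr μ r C ψ₀ v y n) := by
  funext p
  rw [Matrix.mulVec, dotProduct, Fintype.sum_prod_type]
  set k : Fin d → ℂ := (fun j => (v j : ℂ)) + y with hk
  set k' : Fin d → ℂ := fun j => (v j : ℂ) with hk'
  have hind : ∀ σ σ' : Spin d,
      ∫ ω, ((C (ω n) : Matrix (Spin d) (Spin d) ℂ) p.1 σ *
          star ((C (ω n) : Matrix (Spin d) (Spin d) ℂ) p.2 σ')) *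
        (fourierAmpl r (coins C ω) ψ₀ k n σ * star (fourierAmpl r (coins C ω) ψ₀ k' n σ'))
        ∂(seqLaw μ) = meanCoin μ C p (σ, σ') * fourierCorr μ r C ψ₀ v y n (σ, σ') := by
    intro σ σ'
    rw [meanCoin_apply]
    refine integral_mul_of_dependsOn_lt μ n
      (F := fun ω => (C ω : Matrix (Spin d) (Spin d) ℂ) p.1 σ *
          star ((C ω : Matrix (Spin d) (Spin d) ℂ) p.2 σ'))
      (H := fun ω => fourierAmpl r (coins C ω) ψ₀ k n σ *
        star (fourierAmpl r (coins C ω) ψ₀ k' n σ')) ?_ ?_ ?_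
    · exact (hC _ _).mul (continuous_star.measurable.comp (hC _ _))
    · exact (measurable_fourierAmpl r ψ₀ hC _ _ _).mul
        (continuous_star.measurable.comp (measurable_fourierAmpl r ψ₀ hC _ _ _))
    · intro ω ω' h
      have h' : ∀ j < n, coins C ω j = coins C ω' j := fun j hj => by rw [coins, h j hj]
      simp only [fourierAmpl_congr r ψ₀ k n h', fourierAmpl_congr r ψ₀ k' n h']
  have hint : ∀ σ σ' : Spin d, Integrable (fun ω =>
      ((C (ω n) : Matrix (Spin d) (Spin d) ℂ) p.1 σ *
          star ((C (ω n) : Matrix (Spin d) (Spin d) ℂ) p.2 σ')) *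
        (fourierAmpl r (coins C ω) ψ₀ k n σ * star (fourierAmpl r (coins C ω) ψ₀ k' n σ')))
        (seqLaw μ) := by
    intro σ σ'
    refine (integrable_fourierAmpl_mul μ r ψ₀ hC k k' n σ σ').bdd_mul (c := 1) ?_
      (ae_of_all _ fun ω => ?_)
    · exact (((hC _ _).comp (measurable_pi_apply n)).mul
        (continuous_star.measurable.comp
          ((hC _ _).comp (measurable_pi_apply n)))).aestronglyMeasurable
    · rw [norm_mul, norm_star]
      exact mul_le_one₀ (norm_coin_le _ _ _) (norm_nonneg _) (norm_coin_le _ _ _)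
  have hexp : fourierCorr μ r C ψ₀ v y (n + 1) p = ∫ ω, ∑ σ, ∑ σ',
      (wave (r p.1) k * star (wave (r p.2) k')) *
      (((C (ω n) : Matrix (Spin d) (Spin d) ℂ) p.1 σ *
          star ((C (ω n) : Matrix (Spin d) (Spin d) ℂ) p.2 σ')) *
        (fourierAmpl r (coins C ω) ψ₀ k n σ * star (fourierAmpl r (coins C ω) ψ₀ k' n σ')))
        ∂(seqLaw μ) := by
    refine integral_congr_ae (ae_of_all _ fun ω => ?_)
    simp only [fourierAmpl, star_mul', star_sum, ← hk, ← hk']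
    rw [mul_mul_mul_comm, Finset.sum_mul_sum, Finset.mul_sum]
    refine Finset.sum_congr rfl fun σ _ => ?_
    rw [Finset.mul_sum]
    refine Finset.sum_congr rfl fun σ' _ => ?_
    ring
  rw [hexp, integral_finsetSum _ fun σ _ => integrable_finsetSum _ fun σ' _ =>
    (hint σ σ').const_mul _]
  refine Finset.sum_congr rfl fun σ _ => ?_
  rw [integral_finsetSum _ fun σ' _ => (hint σ σ').const_mul _]
  refine Finset.sum_congr rfl fun σ' _ => ?_
  rw [integral_const_mul, hind, phaseLeft_mul_transferMat_apply, ← hk]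
  ring

/-- The tensor product `ψ₀ ⊗ conj ψ₀`. -/
def initialVec (p : Spin d × Spin d) : ℂ := ψ₀ p.1 * star (ψ₀ p.2)

theorem fourierCorr_eq_pow
    (hC : ∀ τ σ, Measurable fun ω => (C ω : Matrix (Spin d) (Spin d) ℂ) τ σ)
    (v : Fin d → ℝ) (y : Fin d → ℂ) (n : ℕ) :
    fourierCorr μ r C ψ₀ v y n =
      ((phaseLeft r y * transferMat μ r C v (-v)) ^ n).mulVec (initialVec ψ₀) := by
  induction n with
  | zero =>
    funext p
    simp [fourierCorr, fourierAmpl, initialVec]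
  | succ n ih => rw [fourierCorr_succ μ r ψ₀ hC, ih, pow_succ', Matrix.mulVec_mulVec]

theorem integral_wave (x : Lat d) :
    ∫ v in cell d, wave x (fun j => (v j : ℂ)) =
      if x = 0 then (2 * Real.pi : ℂ) ^ d else 0 := by
  have h1 : ∀ m : ℤ, ∫ t in Set.Ico 0 (2 * Real.pi), Complex.exp (Complex.I * (m * (t : ℂ))) =
      if m = 0 then (2 * Real.pi : ℂ) else 0 := by
    intro m
    rw [integral_Ico_eq_integral_Ioc, ← intervalIntegral.integral_of_le (by positivity)]
    split_ifs with h
    · subst h; simp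
    · have hc : Complex.I * (m : ℂ) ≠ 0 := mul_ne_zero Complex.I_ne_zero (by exact_mod_cast h)
      simp only [← mul_assoc]
      rw [integral_exp_mul_complex hc]
      have : Complex.exp (Complex.I * m * ((2 * Real.pi : ℝ) : ℂ)) = 1 := by
        rw [Complex.exp_eq_one_iff]
        exact ⟨m, by push_cast; ring⟩
      rw [this]; simp
  have h2 : ∀ v : Fin d → ℝ, wave x (fun j => (v j : ℂ)) =
      ∏ j, Complex.exp (Complex.I * (x j * (v j : ℂ))) := fun v => by
    rw [wave, Finset.mul_sum, Complex.exp_sum]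
  simp only [h2]
  rw [cell, volume_pi, Measure.restrict_pi_pi,
    integral_fintype_prod_eq_prod (fun j (t : ℝ) => Complex.exp (Complex.I * (x j * (t : ℂ))))]
  simp only [h1]
  split_ifs with h
  · subst h; simp
  · obtain ⟨j, hj⟩ : ∃ j, x j ≠ 0 := by
      by_contra! hx
      exact h (funext hx)
    exact Finset.prod_eq_zero (Finset.mem_univ j) (if_neg hj)

theorem continuous_wave (x : Lat d) : Continuous fun v : Fin d → ℝ => wave x fun j => (v j : ℂ) := by
  unfold wave
  fun_prop

theorem integrableOn_cell {E : Type*} [NormedAddCommGroup E] {f : (Fin d → ℝ) → E}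
    (hf : Continuous f) : IntegrableOn f (cell d) := by
  have hK : IsCompact (Set.univ.pi fun _ : Fin d => Set.Icc 0 (2 * Real.pi)) :=
    isCompact_univ_pi fun _ => isCompact_Icc
  exact (hf.continuousOn.integrableOn_compact hK).mono_set
    (Set.pi_mono fun _ _ => Set.Ico_subset_Icc_self)

/-- The characteristic function as an average over quasi-momenta. -/
theorem charFn_eq_integral
    (hC : ∀ τ σ, Measurable fun ω => (C ω : Matrix (Spin d) (Spin d) ℂ) τ σ)
    (n : ℕ) (y : Fin d → ℂ) :
    charFn μ r C ψ₀ n y = (∫ v in cell d, ∑ τ, fourierCorr μ r C ψ₀ v y n (τ, τ)) /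
      (2 * Real.pi : ℂ) ^ d := by
  have hpi : (2 * Real.pi : ℂ) ^ d ≠ 0 :=
    pow_ne_zero _ (mul_ne_zero two_ne_zero (by exact_mod_cast Real.pi_ne_zero))
  have hi : ∀ (x x' : Lat d) (c : ℂ),
      Integrable (fun v : Fin d → ℝ => wave (x - x') (fun j => (v j : ℂ)) * c)
        (volume.restrict (cell d)) := fun x x' c =>
    integrableOn_cell ((continuous_wave _).mul continuous_const)
  rw [eq_div_iff hpi, charFn_eq_sum μ r ψ₀ hC]
  simp only [fourierCorr_eq_sum μ r ψ₀ hC]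
  rw [integral_finsetSum _ fun τ _ => integrable_finsetSum _ fun x _ =>
    integrable_finsetSum _ fun x' _ => hi _ _ _]
  have : ∀ τ : Spin d, ∫ v in cell d, ∑ x ∈ reach r n, ∑ x' ∈ reach r n,
      wave (x - x') (fun j => (v j : ℂ)) * (wave x y * corr μ r C ψ₀ n x x' (τ, τ)) =
      ∑ x ∈ reach r n, (2 * Real.pi : ℂ) ^ d * (wave x y * corr μ r C ψ₀ n x x (τ, τ)) := by
    intro τ
    rw [integral_finsetSum _ fun x _ => integrable_finsetSum _ fun x' _ => hi _ _ _]
    refine Finset.sum_congr rfl fun x hx => ?_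
    -- Orthogonality of the characters under the average over `v` keeps only `x' = x`.
    rw [integral_finsetSum _ fun x' _ => hi _ _ _, Finset.sum_eq_single x]
    · rw [integral_mul_const, integral_wave, if_pos (sub_self x)]
    · intro x' _ hne
      rw [integral_mul_const, integral_wave, if_neg (sub_ne_zero.2 hne.symm), zero_mul]
    · exact fun h => absurd hx h
  simp only [this]
  rw [Finset.sum_comm, Finset.sum_mul]
  refine Finset.sum_congr rfl fun x _ => ?_
  rw [siteProb, ← Finset.mul_sum, ← Finset.mul_sum]
  ring

end Expectation
end QWalk

namespace QWalk

/-! ### Spectrum of the transfer matrix at opposite momenta -/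

noncomputable section Spectral

set_option linter.unusedSectionVars false

open scoped Matrix.Norms.L2Operator
open Matrix (vecMulVec)

variable {d : ℕ}

/-- Operators on `ℂ^{2d} ⊗ ℂ^{2d}`. -/
abbrev CoinMat (d : ℕ) : Type := Matrix (Spin d × Spin d) (Spin d × Spin d) ℂ

/-- The vector `∑ τ, |τ⟩ ⊗ |τ⟩`. -/
def diagVec (d : ℕ) (p : Spin d × Spin d) : ℂ := if p.1 = p.2 then 1 else 0

/-- The normalisation `1 / 2d`. -/
def invCard (d : ℕ) : ℂ := (Fintype.card (Spin d) : ℂ)⁻¹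

/-- The orthogonal projection onto the span of `diagVec`. -/
def diagProj (d : ℕ) : CoinMat d := invCard d • vecMulVec (diagVec d) (diagVec d)

/-- The expectation of an operator in the state given by `diagVec`. -/
def diagMean (X : CoinMat d) : ℂ := invCard d * (diagVec d ⬝ᵥ X.mulVec (diagVec d))

theorem sum_diagVec_mul (g : Spin d × Spin d → ℂ) :
    diagVec d ⬝ᵥ g = ∑ τ, g (τ, τ) := by
  rw [dotProduct, Fintype.sum_prod_type]
  refine Finset.sum_congr rfl fun τ _ => ?_
  rw [Finset.sum_eq_single τ]
  · simp [diagVec]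
  · intro σ _ h; simp [diagVec, h.symm]
  · simp

theorem invCard_mul_dotProduct [Nonempty (Spin d)] :
    invCard d * (diagVec d ⬝ᵥ diagVec d) = 1 := by
  rw [sum_diagVec_mul]
  simp only [diagVec, if_true, Finset.sum_const, Finset.card_univ, nsmul_eq_mul, mul_one]
  exact inv_mul_cancel₀ (Nat.cast_ne_zero.2 Fintype.card_ne_zero)

/-- A compression by a rank one projection is a scalar. This turns the operator identities of
`SecondOrder` into scalar ones. -/
theorem diagProj_mul_mul (X : CoinMat d) :
    diagProj d * X * diagProj d = diagMean X • diagProj d := by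
  rw [diagProj, diagMean, smul_mul_assoc, smul_mul_assoc, mul_smul_comm, Matrix.mul_assoc,
    Matrix.mul_vecMulVec, Matrix.vecMulVec_mul_vecMulVec, Matrix.vecMulVec_smul, smul_smul,
    smul_smul, smul_smul]
  congr 1
  ring

theorem diagMean_one [Nonempty (Spin d)] : diagMean (1 : CoinMat d) = 1 := by
  rw [diagMean, Matrix.one_mulVec, invCard_mul_dotProduct]

theorem diagProj_mul_self [Nonempty (Spin d)] : diagProj d * diagProj d = diagProj d := by
  have := diagProj_mul_mul (1 : CoinMat d)
  rwa [mul_one, diagMean_one, one_smul] at this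

theorem diagProj_conjTranspose : (diagProj d).conjTranspose = diagProj d := by
  ext p q
  simp [diagProj, diagVec, invCard, Matrix.vecMulVec_apply, apply_ite (starRingEnd ℂ), mul_comm]

theorem diagProj_mulVec_diagVec [Nonempty (Spin d)] :
    (diagProj d).mulVec (diagVec d) = diagVec d := by
  rw [diagProj, Matrix.smul_mulVec, Matrix.vecMulVec_mulVec, op_smul_eq_smul, smul_smul,
    invCard_mul_dotProduct, one_smul]

theorem diagVec_ne_zero [Nonempty (Spin d)] : diagVec d ≠ 0 := fun h => by
  have := invCard_mul_dotProduct (d := d)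
  rw [h] at this
  simp at this

theorem norm_diagProj [Nonempty (Spin d)] : ‖diagProj d‖ = 1 := by
  have h1 := Matrix.l2_opNorm_conjTranspose_mul_self (diagProj d)
  rw [diagProj_conjTranspose, diagProj_mul_self] at h1
  have h2 : ‖diagProj d‖ ≠ 0 := by
    rw [norm_ne_zero_iff]
    intro h
    have := diagProj_mulVec_diagVec (d := d)
    rw [h, Matrix.zero_mulVec] at this
    exact diagVec_ne_zero this.symm
  exact (mul_eq_left₀ h2).1 h1.symm

variable {Ω : Type*} [MeasurableSpace Ω] (μ : Measure Ω) [IsProbabilityMeasure μ]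
  (r : Spin d → Lat d) (C : Ω → Matrix.unitaryGroup (Spin d) ℂ)

theorem transferMat_apply (v : Fin d → ℝ) (p q : Spin d × Spin d) :
    transferMat μ r C v (-v) p q =
      wave (r p.1) (fun j => (v j : ℂ)) * star (wave (r p.2) fun j => (v j : ℂ)) *
        meanCoin μ C p q := by
  have h := phaseLeft_mul_transferMat_apply μ r (C := C) v 0 p q
  have : phaseLeft r (0 : Fin d → ℂ) = 1 := by
    simp [phaseLeft, wave, Matrix.diagonal_one]
  rwa [this, one_mul, add_zero] at h

theorem norm_wave_real (x : Lat d) (v : Fin d → ℝ) : ‖wave x fun j => (v j : ℂ)‖ = 1 := by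
  rw [wave, Complex.norm_exp]
  simp [← Complex.ofReal_intCast, ← Complex.ofReal_mul, ← Complex.ofReal_sum]

theorem wave_mul_star (x : Lat d) (v : Fin d → ℝ) :
    wave x (fun j => (v j : ℂ)) * star (wave x fun j => (v j : ℂ)) = 1 := by
  rw [← starRingEnd_apply, Complex.mul_conj, Complex.normSq_eq_norm_sq, norm_wave_real]
  simp

variable {C}

theorem integrable_coin_mul
    (hC : ∀ τ σ, Measurable fun ω => (C ω : Matrix (Spin d) (Spin d) ℂ) τ σ)
    (τ σ τ' σ' : Spin d) :
    Integrable (fun ω => (C ω : Matrix (Spin d) (Spin d) ℂ) τ σ *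
      star ((C ω : Matrix (Spin d) (Spin d) ℂ) τ' σ')) μ := by
  refine Integrable.of_bound
    ((hC _ _).mul (continuous_star.measurable.comp (hC _ _))).aestronglyMeasurable 1
    (ae_of_all _ fun ω => ?_)
  rw [norm_mul, norm_star]
  exact mul_le_one₀ (norm_coin_le _ _ _) (norm_nonneg _) (norm_coin_le _ _ _)

/-- The rows of each coin matrix are orthonormal, and the average of a constant is that constant. -/
theorem meanCoin_mulVec_diagVec
    (hC : ∀ τ σ, Measurable fun ω => (C ω : Matrix (Spin d) (Spin d) ℂ) τ σ) :
    (meanCoin μ C).mulVec (diagVec d) = diagVec d := by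
  funext p
  rw [Matrix.mulVec, dotProduct_comm, sum_diagVec_mul]
  simp only [meanCoin_apply]
  rw [← integral_finsetSum _ fun σ _ => integrable_coin_mul μ hC _ _ _ _]
  have : ∀ ω, ∑ σ, (C ω : Matrix (Spin d) (Spin d) ℂ) p.1 σ *
      star ((C ω : Matrix (Spin d) (Spin d) ℂ) p.2 σ) = diagVec d p := fun ω => by
    have := congrFun (congrFun (Matrix.mem_unitaryGroup_iff.1 (C ω).2) p.1) p.2
    rw [Matrix.mul_apply, Matrix.one_apply] at this
    exact this
  simp only [this]
  simp

/-- The same for columns. Having both the left and the right fixed vector makes the spectral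
projection orthogonal. -/
theorem diagVec_vecMul_meanCoin
    (hC : ∀ τ σ, Measurable fun ω => (C ω : Matrix (Spin d) (Spin d) ℂ) τ σ) :
    Matrix.vecMul (diagVec d) (meanCoin μ C) = diagVec d := by
  funext q
  rw [Matrix.vecMul, sum_diagVec_mul]
  simp only [meanCoin_apply]
  rw [← integral_finsetSum _ fun σ _ => integrable_coin_mul μ hC _ _ _ _]
  have : ∀ ω, ∑ τ, (C ω : Matrix (Spin d) (Spin d) ℂ) τ q.1 *
      star ((C ω : Matrix (Spin d) (Spin d) ℂ) τ q.2) = diagVec d q := fun ω => by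
    have := congrFun (congrFun (Matrix.mem_unitaryGroup_iff'.1 (C ω).2) q.2) q.1
    rw [Matrix.mul_apply, Matrix.one_apply] at this
    rw [diagVec, ← ite_congr (propext eq_comm) (fun _ => rfl) (fun _ => rfl), ← this]
    exact Finset.sum_congr rfl fun τ _ => mul_comm _ _
  simp only [this]
  simp

/-- The phases at `v` and `-v` cancel where the two spins agree, so the fixed vector does not depend
on `v`. -/
theorem transferMat_mulVec_diagVec
    (hC : ∀ τ σ, Measurable fun ω => (C ω : Matrix (Spin d) (Spin d) ℂ) τ σ)
    (v : Fin d → ℝ) : (transferMat μ r C v (-v)).mulVec (diagVec d) = diagVec d := by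
  funext p
  have h := congrFun (meanCoin_mulVec_diagVec μ hC) p
  simp only [Matrix.mulVec, dotProduct, transferMat_apply] at h ⊢
  simp only [mul_assoc, ← Finset.mul_sum]
  rw [h]
  by_cases hp : p.1 = p.2
  · rw [hp, ← mul_assoc, wave_mul_star, one_mul]
  · simp [diagVec, hp]

theorem diagVec_vecMul_transferMat
    (hC : ∀ τ σ, Measurable fun ω => (C ω : Matrix (Spin d) (Spin d) ℂ) τ σ)
    (v : Fin d → ℝ) : Matrix.vecMul (diagVec d) (transferMat μ r C v (-v)) = diagVec d := by
  funext q
  have h := congrFun (diagVec_vecMul_meanCoin μ hC) q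
  rw [Matrix.vecMul, sum_diagVec_mul] at h ⊢
  simp only [transferMat_apply, wave_mul_star, one_mul]
  exact h

theorem diagProj_mul_transferMat
    (hC : ∀ τ σ, Measurable fun ω => (C ω : Matrix (Spin d) (Spin d) ℂ) τ σ)
    (v : Fin d → ℝ) : diagProj d * transferMat μ r C v (-v) = diagProj d := by
  rw [diagProj, smul_mul_assoc, Matrix.vecMulVec_mul, diagVec_vecMul_transferMat μ r hC]

theorem transferMat_mul_diagProj
    (hC : ∀ τ σ, Measurable fun ω => (C ω : Matrix (Spin d) (Spin d) ℂ) τ σ)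
    (v : Fin d → ℝ) : transferMat μ r C v (-v) * diagProj d = diagProj d := by
  rw [diagProj, mul_smul_comm, Matrix.mul_vecMulVec, transferMat_mulVec_diagVec μ r hC]

/-- An average of contractions is a contraction; the work is to recognise the entrywise integral as
an integral of matrices. -/
theorem norm_entrywise_integral_le {n : Type*} [Fintype n] [DecidableEq n] {K : Ω → Matrix n n ℂ}
    (hi : ∀ p q, Integrable (fun ω => K ω p q) μ) (hK : ∀ ω, ‖K ω‖ ≤ 1) :
    ‖Matrix.of fun p q => ∫ ω, K ω p q ∂μ‖ ≤ 1 := by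
  have hKs : ∀ ω, K ω = ∑ p, ∑ q, K ω p q • Matrix.single p q (1 : ℂ) := fun ω => by
    conv_lhs => rw [Matrix.matrix_eq_sum_single (K ω)]
    simp only [Matrix.smul_single, smul_eq_mul, mul_one]
  have hi' : ∀ p q, Integrable (fun ω => K ω p q • (Matrix.single p q (1 : ℂ) : Matrix n n ℂ)) μ :=
    fun p q => (hi p q).smul_const _
  have e : (Matrix.of fun p q => ∫ ω, K ω p q ∂μ) = ∫ ω, K ω ∂μ := by
    rw [integral_congr_ae (ae_of_all _ hKs)]
    rw [integral_finsetSum _ fun p _ => integrable_finsetSum _ fun q _ => hi' p q]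
    conv_lhs => rw [Matrix.matrix_eq_sum_single (Matrix.of fun p q => ∫ ω, K ω p q ∂μ)]
    refine Finset.sum_congr rfl fun p _ => ?_
    rw [integral_finsetSum _ fun q _ => hi' p q]
    refine Finset.sum_congr rfl fun q _ => ?_
    rw [integral_smul_const, Matrix.smul_single, smul_eq_mul, mul_one]
    rfl
  rw [e]
  simpa using norm_integral_le_of_norm_le_const (μ := μ) (ae_of_all _ hK)

theorem norm_meanCoin_le [Nonempty (Spin d)]
    (hC : ∀ τ σ, Measurable fun ω => (C ω : Matrix (Spin d) (Spin d) ℂ) τ σ) :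
    ‖meanCoin μ C‖ ≤ 1 := by
  let K : Ω → CoinMat d := fun ω => Matrix.kronecker (C ω : Matrix (Spin d) (Spin d) ℂ)
    ((C ω : Matrix (Spin d) (Spin d) ℂ).map star)
  have hK : ∀ ω, ‖K ω‖ ≤ 1 := fun ω => by
    have hu : K ω ∈ unitary (CoinMat d) := Matrix.kronecker_mem_unitary (C ω).2
      (Matrix.map_star_mem_unitaryGroup_iff.2 (C ω).2)
    have := CStarRing.norm_of_mem_unitary hu
    exact this.le
  have hi : ∀ p q, Integrable (fun ω => K ω p q) μ := fun p q =>
    integrable_coin_mul μ hC p.1 q.1 p.2 q.2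
  exact norm_entrywise_integral_le μ hi hK

theorem norm_transferMat_le [Nonempty (Spin d)]
    (hC : ∀ τ σ, Measurable fun ω => (C ω : Matrix (Spin d) (Spin d) ℂ) τ σ)
    (v : Fin d → ℝ) : ‖transferMat μ r C v (-v)‖ ≤ 1 := by
  have e : transferMat μ r C v (-v) = Matrix.diagonal (fun p : Spin d × Spin d =>
      wave (r p.1) (fun j => (v j : ℂ)) * star (wave (r p.2) fun j => (v j : ℂ))) *
        meanCoin μ C := by
    ext p q
    rw [transferMat_apply, Matrix.diagonal_mul]
  rw [e]
  refine (norm_mul_le _ _).trans (mul_le_one₀ ?_ (norm_nonneg _) (norm_meanCoin_le μ hC))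
  rw [Matrix.l2_opNorm_diagonal]
  refine (pi_norm_le_iff_of_nonneg zero_le_one).2 fun p => ?_
  rw [norm_mul, norm_star, norm_wave_real, norm_wave_real, one_mul]

/-- Away from its simple eigenvalue `1`, the transfer matrix has spectral radius below `1`. -/
theorem spectralRadius_transferMat_sub [Nonempty (Spin d)]
    (hC : ∀ τ σ, Measurable fun ω => (C ω : Matrix (Spin d) (Spin d) ℂ) τ σ)
    (v : Fin d → ℝ)
    (hspec : spectrum ℂ (transferMat μ r C v (-v)) ∩ {z : ℂ | ‖z‖ = 1} = {1} ∧
      (transferMat μ r C v (-v)).charpoly.rootMultiplicity 1 = 1) :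
    spectralRadius ℂ (transferMat μ r C v (-v) - diagProj d) < 1 := by
  set A := transferMat μ r C v (-v) with hA
  refine spectrum.spectralRadius_lt_of_forall_lt (r := 1) _ fun z hz => ?_
  rw [← NNReal.coe_lt_coe, coe_nnnorm, NNReal.coe_one]
  by_contra! hz1
  rw [← Matrix.spectrum_toLin', ← Module.End.hasEigenvalue_iff_mem_spectrum] at hz
  obtain ⟨x, hx⟩ := hz.exists_hasEigenvector
  have hx0 := hx.2
  have hxz : (A - diagProj d).mulVec x = z • x := by
    have := hx.apply_eq_smul
    rwa [Matrix.toLin'_apply] at this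
  have hz0 : z ≠ 0 := by
    rintro rfl
    rw [norm_zero] at hz1
    linarith
  -- `P (A - P) = 0`, so an eigenvector of `A - P` with nonzero eigenvalue is killed by `P` and is
  -- an eigenvector of `A` itself.
  have hPx : (diagProj d).mulVec x = 0 := by
    have h1 : (diagProj d).mulVec ((A - diagProj d).mulVec x) = 0 := by
      rw [Matrix.mulVec_mulVec, mul_sub, diagProj_mul_transferMat μ r hC, diagProj_mul_self,
        sub_self, Matrix.zero_mulVec]
    rw [hxz, Matrix.mulVec_smul] at h1
    exact (smul_eq_zero.1 h1).resolve_left hz0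
  have hAx : A.mulVec x = z • x := by
    rw [← hxz, Matrix.sub_mulVec, hPx, sub_zero]
  have hzA : Module.End.HasEigenvector (Matrix.toLin' A) z x :=
    Module.End.hasEigenvector_iff.2 ⟨Module.End.mem_eigenspace_iff.2 (by simpa using hAx), hx0⟩
  have hzs : z ∈ spectrum ℂ A := by
    rw [← Matrix.spectrum_toLin', ← Module.End.hasEigenvalue_iff_mem_spectrum]
    exact Module.End.hasEigenvalue_of_hasEigenvector hzA
  -- `A` is a contraction, so an eigenvalue of modulus at least 1 lies on the unit circle and must
  -- be 1.
  have hz2 : ‖z‖ = 1 :=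
    le_antisymm ((spectrum.norm_le_norm_of_mem hzs).trans (norm_transferMat_le μ r hC v)) hz1
  have hz3 : z = 1 := by
    have : z ∈ spectrum ℂ A ∩ {z : ℂ | ‖z‖ = 1} := ⟨hzs, hz2⟩
    rw [hspec.1] at this
    exact this
  subst hz3
  -- The algebraic multiplicity bounds the geometric one. Hence `x` is a multiple of `diagVec d`,
  -- which `P` fixes, against `hPx`.
  have hfin := LinearMap.finrank_eigenspace_le (Matrix.toLin' A) 1
  rw [Matrix.charpoly_toLin', hspec.2] at hfin
  obtain ⟨⟨w, hw⟩, hws⟩ := finrank_le_one_iff.1 hfin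
  have hD : diagVec d ∈ Module.End.eigenspace (Matrix.toLin' A) 1 := by
    rw [Module.End.mem_eigenspace_iff, Matrix.toLin'_apply, one_smul,
      transferMat_mulVec_diagVec μ r hC]
  obtain ⟨a, ha⟩ := hws ⟨_, hD⟩
  obtain ⟨b, hb⟩ := hws ⟨x, hzA.1⟩
  have ha' : a • w = diagVec d := congrArg Subtype.val ha
  have hb' : b • w = x := congrArg Subtype.val hb
  have ha0 : a ≠ 0 := by
    rintro rfl
    rw [zero_smul] at ha'
    exact diagVec_ne_zero ha'.symm
  have hxD : x = (b * a⁻¹) • diagVec d := by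
    rw [← ha', smul_smul, mul_assoc, inv_mul_cancel₀ ha0, mul_one, hb']
  rw [hxD, Matrix.mulVec_smul, diagProj_mulVec_diagVec, ← hxD] at hPx
  exact hx0 hPx

end Spectral
end QWalk

namespace QWalk

/-! ### Analyticity of the resolvent and the uniform spectral gap -/

noncomputable section Diffusion

set_option linter.unusedSectionVars false

open scoped Matrix.Norms.L2Operator
open Matrix (vecMulVec)

/-- By Gelfand's formula the norms are eventually below `q ^ n` for any `q` strictly between the
spectral radius and 1. -/
theorem tendsto_norm_pow_of_spectralRadius_lt_one {𝔸 : Type*} [NormedRing 𝔸] [NormedAlgebra ℂ 𝔸]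
    [CompleteSpace 𝔸] {a : 𝔸} (ha : spectralRadius ℂ a < 1) :
    Tendsto (fun n : ℕ => ‖a ^ n‖) atTop (𝓝 0) := by
  obtain ⟨q, hq1, hq2⟩ := ENNReal.lt_iff_exists_nnreal_btwn.1 ha
  have hq : (q : ℝ) < 1 := by exact_mod_cast hq2
  have hev := (spectrum.pow_nnnorm_pow_one_div_tendsto_nhds_spectralRadius a).eventually
    (gt_mem_nhds hq1)
  refine squeeze_zero' (Eventually.of_forall fun n => norm_nonneg _) ?_
    (tendsto_pow_atTop_nhds_zero_of_lt_one q.2 hq)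
  filter_upwards [hev, eventually_ge_atTop 1] with n hn hn1
  have hn0 : (n : ℝ) ≠ 0 := by positivity
  have h1 := ENNReal.rpow_le_rpow hn.le (Nat.cast_nonneg (α := ℝ) n)
  rw [← ENNReal.rpow_mul, one_div, inv_mul_cancel₀ hn0, ENNReal.rpow_one, ENNReal.rpow_natCast] at h1
  exact_mod_cast h1

variable {d : ℕ} {Ω : Type*} [MeasurableSpace Ω] (μ : Measure Ω) [IsProbabilityMeasure μ]
  (r : Spin d → Lat d) (C : Ω → Matrix.unitaryGroup (Spin d) ℂ)

/-- The reduced resolvent of the transfer matrix at its eigenvalue `1`. -/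
def reducedRes (v : Fin d → ℝ) : CoinMat d :=
  Ring.inverse (1 - transferMat μ r C v (-v) + diagProj d)

/-- The spectral assumption of the theorem. -/
def SimplePeripheral : Prop := ∀ v : Fin d → ℝ,
  spectrum ℂ (transferMat μ r C v (-v)) ∩ {z : ℂ | ‖z‖ = 1} = {1} ∧
    (transferMat μ r C v (-v)).charpoly.rootMultiplicity 1 = 1

theorem star_wave_eq_neg (x : Lat d) (v : Fin d → ℝ) :
    star (wave x fun j => (v j : ℂ)) = wave (-x) fun j => (v j : ℂ) := by
  rw [star_wave]
  simp [wave]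

theorem analyticAt_wave (x : Lat d) (v : Fin d → ℝ) :
    AnalyticAt ℝ (fun v : Fin d → ℝ => wave x fun j => (v j : ℂ)) v := by
  unfold wave
  have h1 : AnalyticAt ℝ (fun v : Fin d → ℝ => Complex.I * ∑ j, (x j : ℂ) * (v j : ℂ)) v := by
    refine analyticAt_const.fun_mul (Finset.analyticAt_fun_sum _ fun j _ =>
      analyticAt_const.fun_mul ?_)
    exact (Complex.ofRealCLM.comp (ContinuousLinearMap.proj (R := ℝ) (φ := fun _ : Fin d => ℝ)
      j)).analyticAt v
  have h2 : AnalyticAt ℝ Complex.exp (Complex.I * ∑ j, (x j : ℂ) * (v j : ℂ)) :=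
    analyticAt_cexp.restrictScalars
  exact AnalyticAt.fun_comp h2 h1

theorem matrix_eq_sum_smul_single {n : Type*} [Fintype n] [DecidableEq n] (X : Matrix n n ℂ) :
    X = ∑ p, ∑ q, X p q • Matrix.single p q (1 : ℂ) := by
  conv_lhs => rw [Matrix.matrix_eq_sum_single X]
  simp only [Matrix.smul_single, smul_eq_mul, mul_one]

theorem analyticAt_matrix {n E : Type*} [Fintype n] [DecidableEq n] [NormedAddCommGroup E]
    [NormedSpace ℝ E] {f : E → Matrix n n ℂ} {v : E}
    (hf : ∀ p q, AnalyticAt ℝ (fun v => f v p q) v) : AnalyticAt ℝ f v := by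
  have e : f = fun v => ∑ p, ∑ q, f v p q • Matrix.single p q (1 : ℂ) :=
    funext fun v => matrix_eq_sum_smul_single (f v)
  rw [e]
  exact Finset.analyticAt_fun_sum _ fun p _ => Finset.analyticAt_fun_sum _ fun q _ =>
    (hf p q).fun_smul analyticAt_const

theorem analyticAt_transferMat (v : Fin d → ℝ) :
    AnalyticAt ℝ (fun v => transferMat μ r C v (-v)) v := by
  refine analyticAt_matrix fun p q => ?_
  simp only [transferMat_apply, star_wave_eq_neg]
  exact ((analyticAt_wave _ v).fun_mul (analyticAt_wave _ v)).fun_mul analyticAt_const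

variable {C}

/-- The element is `1 - (A - P)`, and 1 exceeds the spectral radius of `A - P`. -/
theorem isUnit_reducedRes [Nonempty (Spin d)]
    (hC : ∀ τ σ, Measurable fun ω => (C ω : Matrix (Spin d) (Spin d) ℂ) τ σ)
    (hspec : SimplePeripheral μ r C) (v : Fin d → ℝ) :
    IsUnit (1 - transferMat μ r C v (-v) + diagProj d) := by
  have h := spectralRadius_transferMat_sub μ r hC v (hspec v)
  have h1 : (1 : ℂ) ∈ resolventSet ℂ (transferMat μ r C v (-v) - diagProj d) :=
    spectrum.mem_resolventSet_of_spectralRadius_lt (by simpa using h)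
  rw [spectrum.mem_resolventSet_iff, map_one] at h1
  convert h1 using 1
  abel

theorem analyticAt_reducedRes [Nonempty (Spin d)]
    (hC : ∀ τ σ, Measurable fun ω => (C ω : Matrix (Spin d) (Spin d) ℂ) τ σ)
    (hspec : SimplePeripheral μ r C) (v : Fin d → ℝ) :
    AnalyticAt ℝ (reducedRes μ r C) v := by
  obtain ⟨u, hu⟩ := isUnit_reducedRes μ r hC hspec v
  have h1 : AnalyticAt ℝ (fun v => 1 - transferMat μ r C v (-v) + diagProj d) v :=
    (analyticAt_const.fun_sub (analyticAt_transferMat μ r C v)).fun_add analyticAt_const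
  have h2 : AnalyticAt ℝ Ring.inverse (1 - transferMat μ r C v (-v) + diagProj d) := by
    rw [← hu]; exact analyticAt_inverse u
  exact AnalyticAt.fun_comp (f := fun v => 1 - transferMat μ r C v (-v) + diagProj d) h2 h1

theorem continuous_transferMat : Continuous fun v => transferMat μ r C v (-v) :=
  continuous_iff_continuousAt.2 fun v => (analyticAt_transferMat μ r C v).continuousAt

/-- This makes the open cover in `exists_spectralGap` increasing, so that a single exponent serves a
whole compact set. -/
theorem norm_pow_mul_antitone [Nonempty (Spin d)]
    (hC : ∀ τ σ, Measurable fun ω => (C ω : Matrix (Spin d) (Spin d) ℂ) τ σ) (v : Fin d → ℝ) :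
    Antitone fun k : ℕ => ‖transferMat μ r C v (-v) ^ k * (1 - diagProj d)‖ :=
  antitone_nat_of_succ_le fun k => by
    rw [pow_succ', mul_assoc]
    exact (norm_mul_le _ _).trans
      (mul_le_of_le_one_left (norm_nonneg _) (norm_transferMat_le μ r hC v))

/-- `A - P = A (1 - P)` with commuting factors, the second idempotent. The exponent is `k + 1`
because at power 0 the left side is `1`, not `1 - P`. -/
theorem pow_sub_diagProj [Nonempty (Spin d)]
    (hC : ∀ τ σ, Measurable fun ω => (C ω : Matrix (Spin d) (Spin d) ℂ) τ σ) (v : Fin d → ℝ)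
    (k : ℕ) : (transferMat μ r C v (-v) - diagProj d) ^ (k + 1) =
      transferMat μ r C v (-v) ^ (k + 1) * (1 - diagProj d) := by
  have hAP := transferMat_mul_diagProj μ r hC v
  have hPA := diagProj_mul_transferMat μ r hC v
  have hPP := diagProj_mul_self (d := d)
  set A := transferMat μ r C v (-v)
  set P := diagProj d
  have hQ : A - P = A * (1 - P) := by rw [mul_sub, mul_one, hAP]
  have hc : Commute A (1 - P) := by
    change A * (1 - P) = (1 - P) * A
    rw [mul_sub, sub_mul, hAP, hPA, mul_one, one_mul]
  have hQQ : IsIdempotentElem (1 - P) := by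
    change (1 - P) * (1 - P) = 1 - P
    rw [mul_sub, mul_one, sub_mul, one_mul, hPP, sub_self, sub_zero]
  rw [hQ, hc.mul_pow, hQQ.pow_succ_eq]

/-- The spectral gap is uniform over quasi-momenta in a compact set. -/
theorem exists_spectralGap [Nonempty (Spin d)]
    (hC : ∀ τ σ, Measurable fun ω => (C ω : Matrix (Spin d) (Spin d) ℂ) τ σ)
    (hspec : SimplePeripheral μ r C) {K : Set (Fin d → ℝ)} (hK : IsCompact K) :
    ∃ (s : ℝ) (m : ℕ), ∀ v ∈ K,
      SpectralGap (transferMat μ r C v (-v)) (diagProj d) (reducedRes μ r C v) s m := by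
  have hcont := continuous_transferMat (C := C) μ r
  have hopen : ∀ k : ℕ, IsOpen
      {v | ‖transferMat μ r C v (-v) ^ k * (1 - diagProj d)‖ < 1 / 2} := fun k =>
    isOpen_lt ((hcont.pow k).mul continuous_const).norm continuous_const
  have hcover : K ⊆ ⋃ k : ℕ, {v | ‖transferMat μ r C v (-v) ^ k * (1 - diagProj d)‖ < 1 / 2} := by
    intro v _
    have h := tendsto_norm_pow_of_spectralRadius_lt_one
      (spectralRadius_transferMat_sub μ r hC v (hspec v))
    obtain ⟨k, hk⟩ := ((h.comp (tendsto_add_atTop_nat 1)).eventually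
      (gt_mem_nhds (show (0 : ℝ) < 1 / 2 by norm_num))).exists
    rw [Function.comp_apply, pow_sub_diagProj μ r hC] at hk
    exact Set.mem_iUnion.2 ⟨k + 1, hk⟩
  have hmono : Monotone fun k : ℕ =>
      {v | ‖transferMat μ r C v (-v) ^ k * (1 - diagProj d)‖ < 1 / 2} := fun k l hkl v hv =>
    (norm_pow_mul_antitone μ r hC v hkl).trans_lt hv
  obtain ⟨k, hk⟩ := hK.elim_directed_cover _ hopen hcover hmono.directed_le
  have hres : ContinuousOn (reducedRes μ r C) K := fun v _ =>
    (analyticAt_reducedRes μ r hC hspec v).continuousAt.continuousWithinAt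
  obtain ⟨s, hs⟩ := hK.exists_bound_of_continuousOn hres
  -- The maximum and the successor supply `one_le_s` and `one_le_m`; by monotonicity the gap
  -- persists at the larger exponent.
  refine ⟨max s 1, k + 1, fun v hv => ?_⟩
  have hu := isUnit_reducedRes μ r hC hspec v
  exact
    { PA := diagProj_mul_transferMat μ r hC v
      AP := transferMat_mul_diagProj μ r hC v
      PP := diagProj_mul_self
      inv_left := Ring.inverse_mul_cancel _ hu
      inv_right := Ring.mul_inverse_cancel _ hu
      norm_A := norm_transferMat_le μ r hC v
      norm_P := norm_diagProj
      one_le_s := le_max_right _ _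
      norm_S := (hs v hv).trans (le_max_left _ _)
      one_le_m := by omega
      gap := (norm_pow_mul_antitone μ r hC v (Nat.le_succ k)).trans (hk hv).le }

end Diffusion
end QWalk

namespace QWalk

/-! ### The diffusion matrix: reality, symmetry, positivity, analyticity -/

noncomputable section DiffusionMatrix

set_option linter.unusedSectionVars false

open scoped Matrix.Norms.L2Operator
open Matrix (vecMulVec)

variable {d : ℕ}

/-- `diagMean` as a linear map. -/
def diagMeanL (d : ℕ) : CoinMat d →ₗ[ℂ] ℂ where
  toFun := diagMean
  map_add' X Y := by rw [diagMean, Matrix.add_mulVec, dotProduct_add, mul_add]; rfl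
  map_smul' c X := by
    rw [diagMean, Matrix.smul_mulVec, dotProduct_smul, smul_eq_mul, RingHom.id_apply, smul_eq_mul,
      diagMean]
    ring

theorem diagMeanL_apply (X : CoinMat d) : diagMeanL d X = diagMean X := rfl

theorem diagMean_eq_sum (X : CoinMat d) :
    diagMean X = invCard d * ∑ τ, ∑ σ, X (τ, τ) (σ, σ) := by
  rw [diagMean, sum_diagVec_mul]
  refine congrArg _ (Finset.sum_congr rfl fun τ _ => ?_)
  rw [Matrix.mulVec, dotProduct_comm, sum_diagVec_mul]

/-- Complex conjugation combined with the exchange of the tensor factors. -/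
def flip (X : CoinMat d) : CoinMat d := (X.map star).submatrix Prod.swap Prod.swap

theorem flip_apply (X : CoinMat d) (p q : Spin d × Spin d) :
    flip X p q = star (X p.swap q.swap) := rfl

theorem flip_mul (X Y : CoinMat d) : flip (X * Y) = flip X * flip Y := by
  have h : (X * Y).map star = X.map star * Y.map star :=
    Matrix.map_mul (f := starRingEnd ℂ)
  rw [flip, h]
  exact (Matrix.submatrix_mul_equiv (X.map star) (Y.map star) Prod.swap
    (Equiv.prodComm (Spin d) (Spin d)) Prod.swap).symm

theorem flip_one : flip (1 : CoinMat d) = 1 := by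
  ext p q
  rw [flip_apply, Matrix.one_apply, Matrix.one_apply]
  simp [Prod.swap_inj]

/-- `diagVec` is real and invariant under the exchange of the factors. Hence `diagMean` is real on
the fixed points of `flip`, which is how the diffusion matrix is seen to be real. -/
theorem star_diagMean (X : CoinMat d) : star (diagMean X) = diagMean (flip X) := by
  simp only [diagMean_eq_sum, star_mul', star_sum, flip_apply, Prod.swap_prod_mk]
  congr 1
  simp [invCard]

theorem diagMean_proj_mul [Nonempty (Spin d)] (X : CoinMat d) :
    diagMean (diagProj d * X) = diagMean X := by
  rw [diagMean, diagMean, Matrix.dotProduct_mulVec, Matrix.dotProduct_mulVec]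
  have : Matrix.vecMul (diagVec d) (diagProj d) = diagVec d := by
    rw [diagProj, Matrix.vecMul_smul, Matrix.vecMul_vecMulVec, smul_smul,
      invCard_mul_dotProduct, one_smul]
  rw [← Matrix.vecMul_vecMul, this]

theorem diagMean_mul_proj [Nonempty (Spin d)] (X : CoinMat d) :
    diagMean (X * diagProj d) = diagMean X := by
  rw [diagMean, diagMean, ← Matrix.mulVec_mulVec, diagProj_mulVec_diagVec]

variable {Ω : Type*} [MeasurableSpace Ω] (μ : Measure Ω) [IsProbabilityMeasure μ]
  (r : Spin d → Lat d) (C : Ω → Matrix.unitaryGroup (Spin d) ℂ)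

/-- The centred jumps, as an operator on the first tensor factor. -/
def jumpMat (j : Fin d) : CoinMat d :=
  Matrix.diagonal fun p => (((r p.1 j : ℝ) - meanJump r j : ℝ) : ℂ)

/-- The Green-Kubo correlations. -/
def jumpCorr (v : Fin d → ℝ) (i j : Fin d) : ℂ :=
  diagMean (jumpMat r i * transferMat μ r C v (-v) * reducedRes μ r C v * jumpMat r j)

/-- The diffusion matrix. -/
def diffMat (v : Fin d → ℝ) : Matrix (Fin d) (Fin d) ℝ :=
  Matrix.of fun i j =>
    (diagMean (jumpMat r i * jumpMat r j) + jumpCorr μ r C v i j + jumpCorr μ r C v j i).re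

theorem flip_transferMat (v : Fin d → ℝ) :
    flip (transferMat μ r C v (-v)) = transferMat μ r C v (-v) := by
  ext p q
  rw [flip_apply, transferMat_apply, transferMat_apply, meanCoin_apply, meanCoin_apply,
    star_mul', star_mul', star_star]
  have : star (∫ ω, (C ω : Matrix (Spin d) (Spin d) ℂ) p.swap.1 q.swap.1 *
      star ((C ω : Matrix (Spin d) (Spin d) ℂ) p.swap.2 q.swap.2) ∂μ) =
      ∫ ω, (C ω : Matrix (Spin d) (Spin d) ℂ) p.1 q.1 *
        star ((C ω : Matrix (Spin d) (Spin d) ℂ) p.2 q.2) ∂μ := by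
    rw [← starRingEnd_apply, ← integral_conj]
    refine integral_congr_ae (ae_of_all _ fun ω => ?_)
    simp only [starRingEnd_apply, star_mul', star_star, Prod.fst_swap, Prod.snd_swap]
    ring
  rw [this, Prod.fst_swap, Prod.snd_swap]
  ring

theorem flip_diagProj : flip (diagProj d) = diagProj d := by
  have h1 : ∀ p : Spin d × Spin d, star (diagVec d p.swap) = diagVec d p := fun p => by
    by_cases h : p.1 = p.2
    · simp [diagVec, h]
    · simp [diagVec, h, Ne.symm h]
  ext p q
  rw [flip_apply, diagProj, Matrix.smul_apply, Matrix.smul_apply, Matrix.vecMulVec_apply,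
    Matrix.vecMulVec_apply, smul_eq_mul, smul_eq_mul, star_mul', star_mul', h1, h1]
  simp [invCard]

theorem flip_reducedRes {v : Fin d → ℝ} (hu : IsUnit (1 - transferMat μ r C v (-v) + diagProj d)) :
    flip (reducedRes μ r C v) = reducedRes μ r C v := by
  have hflip : flip (1 - transferMat μ r C v (-v) + diagProj d) =
      1 - transferMat μ r C v (-v) + diagProj d := by
    have hadd : ∀ X Y : CoinMat d, flip (X + Y) = flip X + flip Y := fun X Y => by
      ext p q; simp [flip_apply]
    have hsub : ∀ X Y : CoinMat d, flip (X - Y) = flip X - flip Y := fun X Y => by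
      ext p q; simp [flip_apply]
    rw [hadd, hsub, flip_one, flip_transferMat, flip_diagProj]
  have h1 := congrArg flip (Ring.inverse_mul_cancel _ hu)
  rw [flip_mul, hflip, flip_one] at h1
  exact left_inv_eq_right_inv h1 (Ring.mul_inverse_cancel _ hu)

/-- `jumpMat` acts on the first factor and is moved by `flip`; on the range of `diagProj` the two
spins agree and the difference disappears. -/
theorem flip_jumpMat_mul_proj (j : Fin d) :
    flip (jumpMat r j * diagProj d) = jumpMat r j * diagProj d := by
  ext p q
  rw [flip_apply, jumpMat, Matrix.diagonal_mul, Matrix.diagonal_mul, star_mul', ← flip_apply,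
    flip_diagProj]
  by_cases hp : p.1 = p.2
  · rw [Prod.fst_swap, ← hp]
    simp
  · simp [diagProj, Matrix.vecMulVec_apply, diagVec, hp]

theorem flip_proj_mul_jumpMat (j : Fin d) :
    flip (diagProj d * jumpMat r j) = diagProj d * jumpMat r j := by
  ext p q
  rw [flip_apply, jumpMat, Matrix.mul_diagonal, Matrix.mul_diagonal, star_mul', ← flip_apply,
    flip_diagProj]
  by_cases hq : q.1 = q.2
  · rw [Prod.fst_swap, ← hq]
    simp
  · simp [diagProj, Matrix.vecMulVec_apply, diagVec, hq]

theorem star_jumpCorr [Nonempty (Spin d)] {v : Fin d → ℝ}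
    (hu : IsUnit (1 - transferMat μ r C v (-v) + diagProj d)) (i j : Fin d) :
    star (jumpCorr μ r C v i j) = jumpCorr μ r C v i j := by
  have e : jumpCorr μ r C v i j = diagMean ((diagProj d * jumpMat r i) *
      transferMat μ r C v (-v) * reducedRes μ r C v * (jumpMat r j * diagProj d)) := by
    rw [jumpCorr, ← diagMean_proj_mul, ← diagMean_mul_proj]
    simp only [mul_assoc]
  rw [e, star_diagMean, flip_mul, flip_mul, flip_mul, flip_proj_mul_jumpMat, flip_transferMat,
    flip_reducedRes μ r C hu, flip_jumpMat_mul_proj]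

theorem diagMean_diagonal (g : Spin d × Spin d → ℂ) :
    diagMean (Matrix.diagonal g) = invCard d * ∑ τ, g (τ, τ) := by
  rw [diagMean, sum_diagVec_mul]
  refine congrArg _ (Finset.sum_congr rfl fun τ _ => ?_)
  rw [Matrix.mulVec_diagonal]
  simp [diagVec]

theorem card_spin : Fintype.card (Spin d) = 2 * d := by
  rw [Fintype.card_coe, Finset.card_erase_of_mem (by simp), Int.card_Icc]
  omega

/-- The invariant state weights all spins equally, which is why the drift is the plain average of
the jumps. This is the source of the solvability condition `first` in `SecondOrder`. -/
theorem diagMean_jumpMat [Nonempty (Spin d)] (j : Fin d) : diagMean (jumpMat r j) = 0 := by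
  have hc : (Fintype.card (Spin d) : ℝ) ≠ 0 := Nat.cast_ne_zero.2 Fintype.card_ne_zero
  have hc2 : (d : ℝ) ≠ 0 := by
    rw [card_spin] at hc
    intro h
    exact hc (by rw [Nat.cast_mul, h, mul_zero])
  rw [jumpMat, diagMean_diagonal]
  have : ∑ τ : Spin d, ((r τ j : ℝ) - meanJump r j) = 0 := by
    rw [Finset.sum_sub_distrib, Finset.sum_const, Finset.card_univ, card_spin, meanJump]
    rw [nsmul_eq_mul]
    push_cast
    field_simp
    ring
  rw [← Complex.ofReal_sum, this]
  simp

/-- The jump in the complex direction `y`. -/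
def jumpDir (y : Fin d → ℂ) : CoinMat d := ∑ j, y j • jumpMat r j

theorem diagMean_jumpDir [Nonempty (Spin d)] (y : Fin d → ℂ) : diagMean (jumpDir r y) = 0 := by
  rw [← diagMeanL_apply, jumpDir, map_sum]
  refine Finset.sum_eq_zero fun j _ => ?_
  rw [map_smul, diagMeanL_apply, diagMean_jumpMat, smul_zero]

theorem diagMean_jumpDir_mul (y : Fin d → ℂ) (X : CoinMat d) :
    diagMean (jumpDir r y * X * jumpDir r y) =
      ∑ i, ∑ j, y i * y j * diagMean (jumpMat r i * X * jumpMat r j) := by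
  rw [← diagMeanL_apply, jumpDir, Finset.sum_mul, Finset.sum_mul_sum, map_sum]
  refine Finset.sum_congr rfl fun i _ => ?_
  rw [map_sum]
  refine Finset.sum_congr rfl fun j _ => ?_
  rw [smul_mul_assoc, smul_mul_smul_comm, map_smul, diagMeanL_apply, smul_eq_mul]

theorem star_diagMean_diagonal (g : Spin d × Spin d → ℝ) :
    star (diagMean (Matrix.diagonal fun p => (g p : ℂ))) =
      diagMean (Matrix.diagonal fun p => (g p : ℂ)) := by
  rw [diagMean_diagonal, star_mul', star_sum]
  simp only [← starRingEnd_apply, Complex.conj_ofReal, invCard, map_inv₀, Complex.conj_natCast]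

theorem jumpMat_mul_jumpMat (i j : Fin d) : jumpMat r i * jumpMat r j =
    Matrix.diagonal fun p => ((((r p.1 i : ℝ) - meanJump r i) *
      ((r p.1 j : ℝ) - meanJump r j) : ℝ) : ℂ) := by
  rw [jumpMat, jumpMat, Matrix.diagonal_mul_diagonal]
  exact congrArg _ (funext fun p => (Complex.ofReal_mul _ _).symm)

/-- The real part in the definition loses nothing: each of the three terms is real. -/
theorem coe_diffMat [Nonempty (Spin d)] {v : Fin d → ℝ}
    (hu : IsUnit (1 - transferMat μ r C v (-v) + diagProj d)) (i j : Fin d) :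
    (diffMat μ r C v i j : ℂ) =
      diagMean (jumpMat r i * jumpMat r j) + jumpCorr μ r C v i j + jumpCorr μ r C v j i := by
  rw [diffMat, Matrix.of_apply]
  refine Complex.conj_eq_iff_re.1 ?_
  rw [map_add, map_add, starRingEnd_apply, starRingEnd_apply, starRingEnd_apply,
    star_jumpCorr μ r C hu, star_jumpCorr μ r C hu, jumpMat_mul_jumpMat, star_diagMean_diagonal]

/-- Summed against `y i * y j`, the two correlation terms coincide after renaming the indices. The
result is, up to sign, the coefficient `κ` of the perturbation theory. -/
theorem sum_diffMat [Nonempty (Spin d)] {v : Fin d → ℝ}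
    (hu : IsUnit (1 - transferMat μ r C v (-v) + diagProj d)) (y : Fin d → ℂ) :
    ∑ i, ∑ j, y i * (diffMat μ r C v i j : ℂ) * y j =
      diagMean (jumpDir r y * jumpDir r y) +
        2 * diagMean (jumpDir r y * (transferMat μ r C v (-v) * reducedRes μ r C v) *
          jumpDir r y) := by
  have h1 := diagMean_jumpDir_mul r y (1 : CoinMat d)
  simp only [mul_one] at h1
  rw [h1, diagMean_jumpDir_mul]
  have hsymm : ∑ i, ∑ j, y i * y j * jumpCorr μ r C v j i =
      ∑ i, ∑ j, y i * y j * jumpCorr μ r C v i j := by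
    rw [Finset.sum_comm]
    exact Finset.sum_congr rfl fun i _ => Finset.sum_congr rfl fun j _ => by ring
  have e : ∀ i j, y i * (diffMat μ r C v i j : ℂ) * y j =
      y i * y j * diagMean (jumpMat r i * jumpMat r j) + y i * y j * jumpCorr μ r C v i j +
        y i * y j * jumpCorr μ r C v j i := fun i j => by
    rw [coe_diffMat μ r C hu]; ring
  simp only [e, Finset.sum_add_distrib]
  rw [hsymm, two_mul, add_assoc]
  simp only [jumpCorr, mul_assoc]

theorem jumpDir_real (x : Fin d → ℝ) : jumpDir r (fun j => (x j : ℂ)) =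
    Matrix.diagonal fun p => ((∑ j, x j * ((r p.1 j : ℝ) - meanJump r j) : ℝ) : ℂ) := by
  ext p q
  rw [jumpDir, Matrix.sum_apply]
  by_cases h : p = q
  · subst h; simp [jumpMat]
  · simp [jumpMat, h]

theorem diffMat_isSymm (v : Fin d → ℝ) (i j : Fin d) :
    diffMat μ r C v i j = diffMat μ r C v j i := by
  have h : jumpMat r i * jumpMat r j = jumpMat r j * jumpMat r i := by
    rw [jumpMat_mul_jumpMat, jumpMat_mul_jumpMat]
    exact congrArg _ (funext fun p => by rw [mul_comm])
  rw [diffMat, Matrix.of_apply, Matrix.of_apply, h, add_right_comm]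

theorem re_star_dotProduct_self {n : Type*} [Fintype n] (w : n → ℂ) :
    (star w ⬝ᵥ w).re = ‖(WithLp.toLp 2 w : EuclideanSpace ℂ n)‖ ^ 2 := by
  rw [EuclideanSpace.norm_sq_eq, dotProduct, Complex.re_sum]
  refine Finset.sum_congr rfl fun i _ => ?_
  rw [Pi.star_apply, ← starRingEnd_apply, ← Complex.normSq_eq_conj_mul_self, Complex.ofReal_re,
    Complex.normSq_eq_norm_sq]

/-- For a contraction `A`, the form `⟨w - Aw, w - Aw⟩ + 2⟨w - Aw, Aw⟩` has nonnegative real part. -/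
theorem re_contraction_form_nonneg {n : Type*} [Fintype n] [DecidableEq n] {A : Matrix n n ℂ}
    (hA : ‖A‖ ≤ 1) (w : n → ℂ) :
    0 ≤ (star (w - A.mulVec w) ⬝ᵥ (w - A.mulVec w) +
      2 * (star (w - A.mulVec w) ⬝ᵥ A.mulVec w)).re := by
  have h1 : ‖(WithLp.toLp 2 (A.mulVec w) : EuclideanSpace ℂ n)‖ ≤
      ‖(WithLp.toLp 2 w : EuclideanSpace ℂ n)‖ :=
    (Matrix.l2_opNorm_mulVec A (WithLp.toLp 2 w)).trans
      (mul_le_of_le_one_left (norm_nonneg _) hA)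
  -- The form equals `⟨w - Aw, w + Aw⟩`, that is `‖w‖² - ‖Aw‖²` plus a purely imaginary term.
  have h2 : star (w - A.mulVec w) ⬝ᵥ (w - A.mulVec w) +
      2 * (star (w - A.mulVec w) ⬝ᵥ A.mulVec w) =
      star w ⬝ᵥ w - star (A.mulVec w) ⬝ᵥ A.mulVec w +
        (star w ⬝ᵥ A.mulVec w - star (star w ⬝ᵥ A.mulVec w)) := by
    rw [← Matrix.star_dotProduct]
    simp only [star_sub, sub_dotProduct, dotProduct_sub]
    ring
  rw [h2, Complex.add_re, Complex.sub_re, Complex.sub_re, re_star_dotProduct_self,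
    re_star_dotProduct_self, ← starRingEnd_apply (star w ⬝ᵥ A.mulVec w), Complex.conj_re, sub_self, add_zero, sub_nonneg]
  exact pow_le_pow_left₀ (norm_nonneg _) h1 2

/-- The vector `u = R diagVec` has no component along `P`, so `w = S u` solves `w - A w = u`. Since
`R` is real and diagonal it moves to the left entry, and the form becomes that of
`re_contraction_form_nonneg`. -/
theorem re_diffForm_nonneg [Nonempty (Spin d)] {A S : CoinMat d} (hA : ‖A‖ ≤ 1)
    (hinv : (1 - A + diagProj d) * S = 1) (hPS : diagProj d * S = diagProj d)
    {g : Spin d × Spin d → ℝ} (hg : diagMean (Matrix.diagonal fun p => (g p : ℂ)) = 0) :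
    0 ≤ (diagMean ((Matrix.diagonal fun p => (g p : ℂ)) * (Matrix.diagonal fun p => (g p : ℂ))) +
      2 * diagMean ((Matrix.diagonal fun p => (g p : ℂ)) * (A * S) *
        (Matrix.diagonal fun p => (g p : ℂ)))).re := by
  set R : CoinMat d := Matrix.diagonal fun p => (g p : ℂ) with hR
  set u := R.mulVec (diagVec d) with hu
  set w := S.mulVec u with hw
  have hPR : (diagProj d).mulVec u = 0 := by
    have h1 : diagProj d * R * diagProj d = 0 := by rw [diagProj_mul_mul, hg, zero_smul]
    rw [hu, ← diagProj_mulVec_diagVec, Matrix.mulVec_mulVec, Matrix.mulVec_mulVec, h1,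
      Matrix.zero_mulVec]
  have hPw : (diagProj d).mulVec w = 0 := by
    rw [hw, Matrix.mulVec_mulVec, hPS, hPR]
  have huw : u = w - A.mulVec w := by
    have h1 : (1 - A + diagProj d).mulVec w = u := by
      rw [hw, Matrix.mulVec_mulVec, hinv, Matrix.one_mulVec]
    rw [Matrix.add_mulVec, Matrix.sub_mulVec, Matrix.one_mulVec, hPw, add_zero] at h1
    exact h1.symm
  have hstar : ∀ z : Spin d × Spin d → ℂ, diagVec d ⬝ᵥ R.mulVec z = star u ⬝ᵥ z := by
    intro z
    rw [dotProduct, dotProduct]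
    refine Finset.sum_congr rfl fun p _ => ?_
    rw [hu, hR, Pi.star_apply, Matrix.mulVec_diagonal, Matrix.mulVec_diagonal, star_mul',
      diagVec]
    split_ifs <;> simp
  have e1 : diagMean (R * R) = invCard d * (star u ⬝ᵥ u) := by
    rw [diagMean, ← Matrix.mulVec_mulVec, hstar]
  have e2 : diagMean (R * (A * S) * R) = invCard d * (star u ⬝ᵥ A.mulVec w) := by
    rw [diagMean, ← Matrix.mulVec_mulVec, ← Matrix.mulVec_mulVec, hstar, ← Matrix.mulVec_mulVec]
  have e3 : invCard d = (((Fintype.card (Spin d) : ℝ)⁻¹ : ℝ) : ℂ) := by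
    rw [invCard]; push_cast; rfl
  rw [e1, e2, mul_left_comm, ← mul_add, e3, Complex.re_ofReal_mul]
  refine mul_nonneg (by positivity) ?_
  rw [huw]
  exact re_contraction_form_nonneg hA w

variable {C}

theorem diffMat_posSemidef [Nonempty (Spin d)]
    (hC : ∀ τ σ, Measurable fun ω => (C ω : Matrix (Spin d) (Spin d) ℂ) τ σ)
    (hspec : SimplePeripheral μ r C) (v : Fin d → ℝ) : (diffMat μ r C v).PosSemidef := by
  refine Matrix.PosSemidef.of_dotProduct_mulVec_nonneg ?_ fun x => ?_
  · ext i j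
    rw [Matrix.conjTranspose_apply, star_trivial]
    exact diffMat_isSymm μ r C v j i
  · have hu := isUnit_reducedRes μ r hC hspec v
    obtain ⟨s, m, hg⟩ := exists_spectralGap μ r hC hspec (isCompact_singleton (x := v))
    have hgap := hg v rfl
    have h := sum_diffMat μ r C hu (fun j => (x j : ℂ))
    have h0 := diagMean_jumpDir r (fun j => (x j : ℂ))
    rw [jumpDir_real] at h h0
    have hpos := re_diffForm_nonneg hgap.norm_A hgap.inv_right hgap.PS h0
    rw [← h] at hpos
    have e : star x ⬝ᵥ (diffMat μ r C v).mulVec x =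
        (∑ i, ∑ j, (x i : ℂ) * (diffMat μ r C v i j : ℂ) * (x j : ℂ)).re := by
      simp only [← Complex.ofReal_mul, ← Complex.ofReal_sum, Complex.ofReal_re]
      simp only [dotProduct, Matrix.mulVec, Finset.mul_sum, star_trivial, mul_assoc]
    rw [e]
    exact hpos

theorem analyticAt_diffMat [Nonempty (Spin d)]
    (hC : ∀ τ σ, Measurable fun ω => (C ω : Matrix (Spin d) (Spin d) ℂ) τ σ)
    (hspec : SimplePeripheral μ r C) (i j : Fin d) (v : Fin d → ℝ) :
    AnalyticAt ℝ (fun v => diffMat μ r C v i j) v := by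
  have hL : ∀ {f : (Fin d → ℝ) → CoinMat d}, AnalyticAt ℝ f v →
      AnalyticAt ℝ (fun v => diagMean (f v)) v := fun {f} hf => by
    let L : CoinMat d →L[ℝ] ℂ :=
      (LinearMap.toContinuousLinearMap (diagMeanL d)).restrictScalars ℝ
    exact AnalyticAt.fun_comp (L.analyticAt (f v)) hf
  have hcorr : ∀ i j, AnalyticAt ℝ (fun v => jumpCorr μ r C v i j) v := fun i j =>
    hL (((analyticAt_const.fun_mul (analyticAt_transferMat μ r C v)).fun_mul
      (analyticAt_reducedRes μ r hC hspec v)).fun_mul analyticAt_const)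
  have h := (analyticAt_const (v := diagMean (jumpMat r i * jumpMat r j))).fun_add
    (hcorr i j) |>.fun_add (hcorr j i)
  exact AnalyticAt.fun_comp (Complex.reCLM.analyticAt _) h

theorem wave_add_two_pi (x : Lat d) (v : Fin d → ℝ) (k : Fin d → ℤ) :
    wave x (fun j => ((v j + 2 * Real.pi * (k j : ℝ) : ℝ) : ℂ)) = wave x fun j => (v j : ℂ) := by
  rw [wave, wave, Complex.exp_eq_exp_iff_exists_int]
  refine ⟨∑ j, x j * k j, ?_⟩
  push_cast
  rw [Finset.mul_sum, Finset.mul_sum, Finset.sum_mul, ← Finset.sum_add_distrib]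
  exact Finset.sum_congr rfl fun j _ => by ring

theorem diffMat_periodic (v : Fin d → ℝ) (k : Fin d → ℤ) :
    diffMat μ r C (fun j => v j + 2 * Real.pi * (k j : ℝ)) = diffMat μ r C v := by
  have h : ∀ v' : Fin d → ℝ, v' = (fun j => v j + 2 * Real.pi * (k j : ℝ)) →
      transferMat μ r C v' (-v') = transferMat μ r C v (-v) := by
    rintro v' rfl
    ext p q
    rw [transferMat_apply, transferMat_apply, wave_add_two_pi, wave_add_two_pi]
  ext i j
  simp only [diffMat, jumpCorr, reducedRes, h _ rfl]

end DiffusionMatrix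
end QWalk

namespace QWalk

/-! ### The quantitative approximation of the characteristic function -/

noncomputable section MasterEstimate

set_option linter.unusedSectionVars false

open scoped Matrix.Norms.L2Operator

theorem norm_diagonal_le {n : Type*} [Fintype n] [DecidableEq n] {z : n → ℂ} {c : ℝ} (hc : 0 ≤ c)
    (h : ∀ p, ‖z p‖ ≤ c) : ‖Matrix.diagonal z‖ ≤ c := by
  rw [Matrix.l2_opNorm_diagonal]
  exact (pi_norm_le_iff_of_nonneg hc).2 h

/-- The Taylor remainder is at most `|z|³ e^{|z|} ≤ 3 c³`. The generous `(3 * c) ^ 3` is the cube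
required by `SecondOrder` with `ε = 3 * c`. -/
theorem norm_diagonal_exp_sub_le {n : Type*} [Fintype n] [DecidableEq n] {z : n → ℂ} {c : ℝ}
    (hc : 0 ≤ c) (hc1 : 3 * c ≤ 1) (h : ∀ p, ‖z p‖ ≤ c) :
    ‖Matrix.diagonal (fun p => Complex.exp (z p)) -
      (1 + Matrix.diagonal z + (1 / 2 : ℂ) • (Matrix.diagonal z * Matrix.diagonal z))‖ ≤
        (3 * c) ^ 3 := by
  have e : Matrix.diagonal (fun p => Complex.exp (z p)) -
      (1 + Matrix.diagonal z + (1 / 2 : ℂ) • (Matrix.diagonal z * Matrix.diagonal z)) =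
      Matrix.diagonal fun p => Complex.exp (z p) - (1 + z p + 1 / 2 * (z p * z p)) := by
    rw [Matrix.diagonal_mul_diagonal, ← Matrix.diagonal_one, Matrix.diagonal_add,
      ← Matrix.diagonal_smul, Matrix.diagonal_add, Matrix.diagonal_sub]
    rfl
  rw [e]
  refine norm_diagonal_le (by positivity) fun p => ?_
  have h1 := Complex.norm_exp_sub_sum_le_norm_mul_exp (z p) 3
  simp only [Finset.sum_range_succ, Finset.sum_range_zero, Nat.factorial] at h1
  have e2 : Complex.exp (z p) - (1 + z p + 1 / 2 * (z p * z p)) =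
      Complex.exp (z p) - (0 + z p ^ 0 / ((1 : ℕ) : ℂ) + z p ^ 1 / (((0 + 1) * 1 : ℕ) : ℂ) +
        z p ^ 2 / (((1 + 1) * ((0 + 1) * 1) : ℕ) : ℂ)) := by
    push_cast
    ring
  rw [e2]
  refine h1.trans ?_
  have h2 : Real.exp ‖z p‖ ≤ 3 := by
    have : Real.exp ‖z p‖ ≤ Real.exp 1 := Real.exp_le_exp.2 (by have := h p; linarith)
    linarith [Real.exp_one_lt_d9]
  have h3 : ‖z p‖ ^ 3 ≤ c ^ 3 := pow_le_pow_left₀ (norm_nonneg _) (h p) 3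
  have h4 : 0 ≤ c ^ 3 := by positivity
  calc ‖z p‖ ^ 3 * Real.exp ‖z p‖ ≤ c ^ 3 * 3 :=
        mul_le_mul h3 h2 (Real.exp_pos _).le h4
    _ ≤ (3 * c) ^ 3 := by rw [mul_pow]; linarith

variable {d : ℕ} {Ω : Type*} [MeasurableSpace Ω] (μ : Measure Ω) [IsProbabilityMeasure μ]
  (r : Spin d → Lat d) {C : Ω → Matrix.unitaryGroup (Spin d) ℂ}

/-- The exponents of the centred phases. -/
def jumpExp (y : Fin d → ℂ) (p : Spin d × Spin d) : ℂ :=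
  Complex.I * ∑ j, y j * (((r p.1 j : ℝ) - meanJump r j : ℝ) : ℂ)

/-- A bound for the centred jumps. -/
def jumpBound : ℝ := ∑ τ, ∑ j, |(r τ j : ℝ) - meanJump r j|

theorem jumpBound_nonneg : 0 ≤ jumpBound r :=
  Finset.sum_nonneg fun _ _ => Finset.sum_nonneg fun _ _ => abs_nonneg _

theorem norm_jumpExp_le (y : Fin d → ℂ) (p : Spin d × Spin d) :
    ‖jumpExp r y p‖ ≤ jumpBound r * ‖y‖ := by
  rw [jumpExp, norm_mul, Complex.norm_I, one_mul]
  refine (norm_sum_le _ _).trans ?_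
  have h1 : ∀ j ∈ (Finset.univ : Finset (Fin d)),
      ‖y j * (((r p.1 j : ℝ) - meanJump r j : ℝ) : ℂ)‖ ≤
        |(r p.1 j : ℝ) - meanJump r j| * ‖y‖ := fun j _ => by
    rw [norm_mul, Complex.norm_real, Real.norm_eq_abs, mul_comm]
    exact mul_le_mul_of_nonneg_left (norm_le_pi_norm y j) (abs_nonneg _)
  refine (Finset.sum_le_sum h1).trans ?_
  rw [← Finset.sum_mul]
  refine mul_le_mul_of_nonneg_right ?_ (norm_nonneg _)
  exact Finset.single_le_sum (f := fun τ => ∑ j, |(r τ j : ℝ) - meanJump r j|)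
    (fun _ _ => Finset.sum_nonneg fun _ _ => abs_nonneg _) (Finset.mem_univ p.1)

theorem smul_jumpDir (y : Fin d → ℂ) :
    Complex.I • jumpDir r y = Matrix.diagonal (jumpExp r y) := by
  ext p q
  rw [Matrix.smul_apply, jumpDir, Matrix.sum_apply]
  by_cases h : p = q
  · subst h
    rw [Matrix.diagonal_apply_eq, jumpExp, smul_eq_mul]
    simp only [Matrix.smul_apply, jumpMat, Matrix.diagonal_apply_eq, smul_eq_mul]
  · rw [Matrix.diagonal_apply_ne _ h, Finset.sum_eq_zero, smul_zero]
    intro j _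
    rw [Matrix.smul_apply, jumpMat, Matrix.diagonal_apply_ne _ h, smul_zero]

/-- One drift factor per time step centres the jumps, so the first order term acquires mean zero. -/
theorem smul_phaseLeft (y : Fin d → ℂ) :
    Complex.exp (-Complex.I * dotC (meanJump r) y) • phaseLeft r y =
      Matrix.diagonal fun p => Complex.exp (jumpExp r y p) := by
  rw [phaseLeft, ← Matrix.diagonal_smul]
  congr 1
  funext p
  rw [Pi.smul_apply, smul_eq_mul, wave, ← Complex.exp_add, jumpExp, dotC, neg_mul, ← mul_neg,
    ← mul_add, ← Finset.sum_neg_distrib, ← Finset.sum_add_distrib]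
  congr 2
  refine Finset.sum_congr rfl fun j _ => ?_
  push_cast
  ring

/-- The generator is `i` times the centred jump in direction `y`; the square of `i` puts the minus
sign in front of the diffusion form. -/
theorem secondOrder_jump [Nonempty (Spin d)] {v : Fin d → ℝ}
    (hu : IsUnit (1 - transferMat μ r C v (-v) + diagProj d)) {y : Fin d → ℂ}
    (hy : 3 * (jumpBound r * ‖y‖) ≤ 1) :
    SecondOrder (transferMat μ r C v (-v)) (diagProj d) (reducedRes μ r C v)
      (Complex.I • jumpDir r y) (Matrix.diagonal fun p => Complex.exp (jumpExp r y p))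
      (-∑ i, ∑ j, y i * (diffMat μ r C v i j : ℂ) * y j) (3 * (jumpBound r * ‖y‖)) where
  first := by
    rw [mul_smul_comm, smul_mul_assoc, diagProj_mul_mul, diagMean_jumpDir, zero_smul, smul_zero]
  second := by
    have hI : Complex.I * Complex.I = -1 := Complex.I_mul_I
    rw [sum_diffMat μ r C hu]
    simp only [mul_smul_comm, smul_mul_assoc, smul_smul, hI]
    have e1 : diagProj d * jumpDir r y * jumpDir r y * diagProj d =
        diagMean (jumpDir r y * jumpDir r y) • diagProj d := by
      rw [← diagProj_mul_mul, mul_assoc (diagProj d)]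
    have e2 : diagProj d * jumpDir r y * transferMat μ r C v (-v) * reducedRes μ r C v *
        jumpDir r y * diagProj d =
        diagMean (jumpDir r y * (transferMat μ r C v (-v) * reducedRes μ r C v) *
          jumpDir r y) • diagProj d := by
      rw [← diagProj_mul_mul]
      simp only [mul_assoc]
    rw [e1, e2, smul_smul, smul_smul, ← add_smul]
    congr 1
    ring
  norm_N := by
    have h0 : 0 ≤ jumpBound r * ‖y‖ := mul_nonneg (jumpBound_nonneg r) (norm_nonneg _)
    rw [smul_jumpDir]
    exact (norm_diagonal_le h0 (norm_jumpExp_le r y)).trans (by linarith)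
  norm_B := by
    rw [smul_jumpDir]
    exact norm_diagonal_exp_sub_le (mul_nonneg (jumpBound_nonneg r) (norm_nonneg _)) hy
      (norm_jumpExp_le r y)
  nonneg := mul_nonneg (by norm_num) (mul_nonneg (jumpBound_nonneg r) (norm_nonneg _))
  le_one := hy

variable (ψ₀ : EuclideanSpace ℂ (Spin d))

/-- The total mass of an operator applied to the initial state. -/
def massL : CoinMat d →ₗ[ℂ] ℂ where
  toFun X := diagVec d ⬝ᵥ X.mulVec (initialVec ψ₀)
  map_add' X Y := by rw [Matrix.add_mulVec, dotProduct_add]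
  map_smul' c X := by rw [Matrix.smul_mulVec, dotProduct_smul, RingHom.id_apply]

theorem massL_apply (X : CoinMat d) :
    massL ψ₀ X = diagVec d ⬝ᵥ X.mulVec (initialVec ψ₀) := rfl

/-- `diagVec` is a left fixed vector of `diagProj`, so a `P` may be inserted for free. This is why
only `P * (B * A) ^ n` had to be controlled. -/
theorem massL_proj_mul [Nonempty (Spin d)] (X : CoinMat d) :
    massL ψ₀ (diagProj d * X) = massL ψ₀ X := by
  rw [massL_apply, massL_apply, Matrix.dotProduct_mulVec, Matrix.dotProduct_mulVec]
  have : Matrix.vecMul (diagVec d) (diagProj d) = diagVec d := by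
    rw [diagProj, Matrix.vecMul_smul, Matrix.vecMul_vecMulVec, smul_smul,
      invCard_mul_dotProduct, one_smul]
  rw [← Matrix.vecMul_vecMul, this]

/-- The value is `‖ψ₀‖²`, so the initial state drops out of the limit. -/
theorem massL_proj [Nonempty (Spin d)] (hψ : ‖ψ₀‖ = 1) : massL ψ₀ (diagProj d) = 1 := by
  rw [← mul_one (diagProj d), massL_proj_mul, massL_apply, Matrix.one_mulVec, sum_diagVec_mul]
  have h1 : ∀ τ, initialVec ψ₀ (τ, τ) = ((‖ψ₀ τ‖ ^ 2 : ℝ) : ℂ) := fun τ => by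
    rw [initialVec, ← starRingEnd_apply, Complex.mul_conj, Complex.normSq_eq_norm_sq]
  simp only [h1]
  rw [← Complex.ofReal_sum, ← EuclideanSpace.norm_sq_eq, hψ]
  simp

theorem exp_mul_sum_fourierCorr
    (hC : ∀ τ σ, Measurable fun ω => (C ω : Matrix (Spin d) (Spin d) ℂ) τ σ)
    (v : Fin d → ℝ) (y : Fin d → ℂ) (n : ℕ) :
    Complex.exp (-Complex.I * n * dotC (meanJump r) y) *
      ∑ τ, fourierCorr μ r C ψ₀ v y n (τ, τ) =
    massL ψ₀ (((Matrix.diagonal fun p => Complex.exp (jumpExp r y p)) *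
      transferMat μ r C v (-v)) ^ n) := by
  rw [← smul_phaseLeft, smul_mul_assoc, smul_pow, map_smul, massL_apply, ← sum_diagVec_mul,
    fourierCorr_eq_pow μ r ψ₀ hC, ← Complex.exp_nat_mul, smul_eq_mul]
  congr 2
  ring

theorem measure_cell_lt_top : (volume : Measure (Fin d → ℝ)) (cell d) < ⊤ := by
  have hK : IsCompact (Set.univ.pi fun _ : Fin d => Set.Icc 0 (2 * Real.pi)) :=
    isCompact_univ_pi fun _ => isCompact_Icc
  exact (measure_mono (Set.pi_mono fun _ _ => Set.Ico_subset_Icc_self)).trans_lt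
    hK.measure_lt_top

theorem continuous_diffMat [Nonempty (Spin d)]
    (hC : ∀ τ σ, Measurable fun ω => (C ω : Matrix (Spin d) (Spin d) ℂ) τ σ)
    (hspec : SimplePeripheral μ r C) (i j : Fin d) :
    Continuous fun v => diffMat μ r C v i j :=
  continuous_iff_continuousAt.2 fun v => (analyticAt_diffMat μ r hC hspec i j v).continuousAt

theorem exp_mul_charFn_sub
    (hC : ∀ τ σ, Measurable fun ω => (C ω : Matrix (Spin d) (Spin d) ℂ) τ σ)
    [Nonempty (Spin d)] (hspec : SimplePeripheral μ r C) (n : ℕ) (y : Fin d → ℂ) :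
    Complex.exp (-Complex.I * n * dotC (meanJump r) y) * charFn μ r C ψ₀ n y -
        diffusiveLimit (diffMat μ r C) n y =
      (∫ v in cell d, (massL ψ₀ (((Matrix.diagonal fun p => Complex.exp (jumpExp r y p)) *
        transferMat μ r C v (-v)) ^ n) -
          Complex.exp (-((n : ℂ) / 2) * ∑ i, ∑ j, y i * (diffMat μ r C v i j : ℂ) * y j))) /
        (2 * Real.pi : ℂ) ^ d := by
  have h1 : Continuous fun v => massL ψ₀ (((Matrix.diagonal fun p =>
      Complex.exp (jumpExp r y p)) * transferMat μ r C v (-v)) ^ n) :=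
    (LinearMap.continuous_of_finiteDimensional (massL ψ₀)).comp
      ((continuous_const.mul (continuous_transferMat μ r)).pow n)
  have h2 : Continuous fun v =>
      Complex.exp (-((n : ℂ) / 2) * ∑ i, ∑ j, y i * (diffMat μ r C v i j : ℂ) * y j) := by
    refine Complex.continuous_exp.comp (continuous_const.mul (continuous_finsetSum _ fun i _ =>
      continuous_finsetSum _ fun j _ => ?_))
    exact (continuous_const.mul
      (Complex.continuous_ofReal.comp (continuous_diffMat μ r hC hspec i j))).mul continuous_const
  rw [integral_sub (integrableOn_cell h1) (integrableOn_cell h2), sub_div, charFn_eq_integral μ r ψ₀ hC,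
    diffusiveLimit, ← mul_div_assoc, ← integral_const_mul]
  simp only [exp_mul_sum_fourierCorr μ r ψ₀ hC]

/-- The quantitative form of the diffusive limit. -/
theorem exists_norm_charFn_sub_le [Nonempty (Spin d)]
    (hC : ∀ τ σ, Measurable fun ω => (C ω : Matrix (Spin d) (Spin d) ℂ) τ σ)
    (hspec : SimplePeripheral μ r C) (hψ : ‖ψ₀‖ = 1) :
    ∃ c > 0, ∃ δ > 0, ∀ (n : ℕ) (y : Fin d → ℂ), ‖y‖ ≤ δ →
      ‖Complex.exp (-Complex.I * n * dotC (meanJump r) y) * charFn μ r C ψ₀ n y -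
        diffusiveLimit (diffMat μ r C) n y‖ ≤
        c * (‖y‖ + n * ‖y‖ ^ 3) * Real.exp (c * (n * ‖y‖ ^ 2)) := by
  have hK : IsCompact (Set.univ.pi fun _ : Fin d => Set.Icc 0 (2 * Real.pi)) :=
    isCompact_univ_pi fun _ => isCompact_Icc
  obtain ⟨s, m, hgap⟩ := exists_spectralGap μ r hC hspec hK
  have hsub : cell d ⊆ Set.univ.pi fun _ : Fin d => Set.Icc 0 (2 * Real.pi) :=
    Set.pi_mono fun _ _ => Set.Ico_subset_Icc_self
  have hs : 1 ≤ s := (hgap 0 (fun i _ => ⟨le_rfl, by positivity⟩)).one_le_s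
  have hm : (1 : ℝ) ≤ m := by
    exact_mod_cast (hgap 0 (fun i _ => ⟨le_rfl, by positivity⟩)).one_le_m
  let L := LinearMap.toContinuousLinearMap (massL ψ₀)
  set b := jumpBound r + 1 with hb
  have hb1 : 1 ≤ b := by have := jumpBound_nonneg r; linarith
  have hbj : jumpBound r ≤ b := by linarith
  set V := (volume : Measure (Fin d → ℝ)).real (cell d) with hV
  have hV0 : 0 ≤ V := measureReal_nonneg
  set c0 := 210 * s ^ 3 * (s + m) * (3 * b) ^ 3 * ‖L‖ * V / ‖(2 * Real.pi : ℂ) ^ d‖ with hc0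
  have hc00 : 0 ≤ c0 := by positivity
  set c1 := 20 * s * (3 * b) ^ 2 with hc1
  have hc11 : 0 < c1 := by positivity
  -- `c0` bounds the prefactor, `c1` the exponent, and their sum serves as both. The radius is
  -- chosen to give `s m² ε ≤ 1/96`, which implies all three smallness conditions on `ε`.
  refine ⟨c0 + c1, by linarith, 1 / (96 * s * m ^ 2 * (3 * b)), by positivity, fun n y hy => ?_⟩
  rw [le_div_iff₀ (by positivity)] at hy
  set ε := 3 * (jumpBound r * ‖y‖) with hε
  have hy0 := norm_nonneg y
  have hε0 : 0 ≤ ε := by have := jumpBound_nonneg r; positivity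
  have hεb : ε ≤ 3 * b * ‖y‖ := by
    rw [hε, mul_assoc]
    have := mul_le_mul_of_nonneg_right hbj hy0
    linarith
  have hmm : (1 : ℝ) ≤ m ^ 2 := one_le_pow₀ hm
  have hsm : s * m ^ 2 * ε ≤ 1 / 96 := by
    have : s * m ^ 2 * ε ≤ s * m ^ 2 * (3 * b * ‖y‖) :=
      mul_le_mul_of_nonneg_left hεb (by positivity)
    linarith
  have hsε : s * ε ≤ 1 / 2 := by
    have : s * ε ≤ s * m ^ 2 * ε :=
      mul_le_mul_of_nonneg_right (le_mul_of_one_le_right (by positivity) hmm) hε0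
    linarith
  have hε1 : ε ≤ 1 := by
    have : ε ≤ s * ε := le_mul_of_one_le_left hε0 hs
    linarith
  have hmε : 48 * (m : ℝ) ^ 2 * ε ≤ 1 := by
    have : (m : ℝ) ^ 2 * ε ≤ s * m ^ 2 * ε :=
      mul_le_mul_of_nonneg_right (le_mul_of_one_le_left (by positivity) hs) hε0
    linarith
  set E := 210 * s ^ 3 * (s + m) * (ε + n * ε ^ 3) * Real.exp (20 * s * (n * ε ^ 2)) with hE
  have hE0 : 0 ≤ E := by positivity
  have hpt : ∀ v ∈ cell d, ‖massL ψ₀ (((Matrix.diagonal fun p => Complex.exp (jumpExp r y p)) *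
        transferMat μ r C v (-v)) ^ n) -
      Complex.exp (-((n : ℂ) / 2) * ∑ i, ∑ j, y i * (diffMat μ r C v i j : ℂ) * y j)‖ ≤
        ‖L‖ * E := by
    intro v hv
    have hso := secondOrder_jump μ r (isUnit_reducedRes μ r hC hspec v) (y := y) hε1
    have h1 := (hgap v (hsub hv)).norm_P_pow_sub_exp hso hsε hmε n
    have h2 := (L.le_opNorm _).trans (mul_le_mul_of_nonneg_left h1 (norm_nonneg L))
    refine le_trans (le_of_eq ?_) h2
    rw [map_sub, map_smul]
    change _ = ‖massL ψ₀ _ - _ • massL ψ₀ _‖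
    rw [massL_proj_mul, massL_proj ψ₀ hψ, smul_eq_mul, mul_one]
    congr 3
    ring
  rw [exp_mul_charFn_sub μ r ψ₀ hC hspec, norm_div]
  have hint := norm_setIntegral_le_of_norm_le_const measure_cell_lt_top hpt
  refine (div_le_div_of_nonneg_right hint (norm_nonneg _)).trans ?_
  have hp1 : ε + n * ε ^ 3 ≤ (3 * b) ^ 3 * (‖y‖ + n * ‖y‖ ^ 3) := by
    have a1 : ε ^ 3 ≤ (3 * b * ‖y‖) ^ 3 := pow_le_pow_left₀ hε0 hεb 3
    have a2 : (n : ℝ) * ε ^ 3 ≤ n * (3 * b * ‖y‖) ^ 3 :=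
      mul_le_mul_of_nonneg_left a1 (Nat.cast_nonneg n)
    have a3 : 3 * b * ‖y‖ ≤ (3 * b) ^ 3 * ‖y‖ :=
      mul_le_mul_of_nonneg_right (le_self_pow₀ (by linarith) (by norm_num)) hy0
    rw [mul_pow] at a2
    linarith
  have hp2 : Real.exp (20 * s * (n * ε ^ 2)) ≤ Real.exp ((c0 + c1) * (n * ‖y‖ ^ 2)) := by
    refine Real.exp_le_exp.2 ?_
    have a1 : ε ^ 2 ≤ (3 * b * ‖y‖) ^ 2 := pow_le_pow_left₀ hε0 hεb 2
    have a2 : 20 * s * (n * ε ^ 2) ≤ 20 * s * (n * (3 * b * ‖y‖) ^ 2) := by gcongr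
    have a3 : 20 * s * (n * (3 * b * ‖y‖) ^ 2) = c1 * (n * ‖y‖ ^ 2) := by rw [hc1]; ring
    have a4 : 0 ≤ c0 * (n * ‖y‖ ^ 2) := by positivity
    linarith
  have hp3 : E ≤ 210 * s ^ 3 * (s + m) * ((3 * b) ^ 3 * (‖y‖ + n * ‖y‖ ^ 3)) *
      Real.exp ((c0 + c1) * (n * ‖y‖ ^ 2)) := by
    rw [hE]; gcongr
  have hq : ‖L‖ * E * V / ‖(2 * Real.pi : ℂ) ^ d‖ ≤
      c0 * (‖y‖ + n * ‖y‖ ^ 3) * Real.exp ((c0 + c1) * (n * ‖y‖ ^ 2)) := by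
    calc ‖L‖ * E * V / ‖(2 * Real.pi : ℂ) ^ d‖ ≤
        ‖L‖ * (210 * s ^ 3 * (s + m) * ((3 * b) ^ 3 * (‖y‖ + n * ‖y‖ ^ 3)) *
          Real.exp ((c0 + c1) * (n * ‖y‖ ^ 2))) * V / ‖(2 * Real.pi : ℂ) ^ d‖ := by gcongr
      _ = c0 * (‖y‖ + n * ‖y‖ ^ 3) * Real.exp ((c0 + c1) * (n * ‖y‖ ^ 2)) := by
        rw [hc0]; ring
  refine hq.trans ?_
  gcongr
  linarith

end MasterEstimate
end QWalk

namespace QWalk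

/-! ### Analyticity and scaling of the limiting function -/

noncomputable section DiffusiveLimit

section IntegralExp

set_option linter.unusedSectionVars false

variable {X : Type*} [TopologicalSpace X] [CompactSpace X] [MeasurableSpace X] [BorelSpace X]
  (ν : Measure X) [IsFiniteMeasure ν]

theorem integrable_continuousMap (g : C(X, ℂ)) : Integrable g ν := by
  have := g.continuous.integrable_of_hasCompactSupport (μ := ν) (HasCompactSupport.of_compactSpace g)
  exact this

/-- Integration as a functional on continuous functions. -/
def integralCLM : C(X, ℂ) →L[ℂ] ℂ :=
  LinearMap.mkContinuous
    { toFun := fun g => ∫ x, g x ∂ν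
      map_add' := fun f g => integral_add (integrable_continuousMap ν f)
        (integrable_continuousMap ν g)
      map_smul' := fun c g => integral_const_mul c g }
    (ν.real Set.univ) fun g => by
      have := norm_integral_le_of_norm_le_const (μ := ν) (f := g)
        (ae_of_all _ fun x => g.norm_coe_le_norm x)
      rwa [mul_comm] at this

theorem integralCLM_apply (g : C(X, ℂ)) : integralCLM ν g = ∫ x, g x ∂ν := rfl

theorem continuousMap_exp_apply (g : C(X, ℂ)) (x : X) :
    NormedSpace.exp g x = Complex.exp (g x) := by
  have h := NormedSpace.map_exp (ContinuousMap.evalAlgHom ℂ ℂ x : C(X, ℂ) →ₐ[ℂ] ℂ)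
    (continuous_eval_const x) g
  rw [Complex.exp_eq_exp_ℂ]
  exact h

/-- The exponential is analytic on the Banach algebra `C(X, ℂ)` and integration is a bounded
functional on it, so no differentiation under the integral sign is needed. -/
theorem analyticAt_integral_exp {E : Type*} [NormedAddCommGroup E] [NormedSpace ℂ E]
    {g : E → C(X, ℂ)} {e : E} (hg : AnalyticAt ℂ g e) :
    AnalyticAt ℂ (fun e => ∫ x, Complex.exp (g e x) ∂ν) e := by
  have h1 := AnalyticAt.fun_comp (NormedSpace.exp_analytic (𝕂 := ℂ) (g e)) hg
  have h2 := AnalyticAt.fun_comp ((integralCLM ν).analyticAt _) h1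
  simpa only [integralCLM_apply, continuousMap_exp_apply] using h2

theorem hasDerivAt_integral_exp (g : C(X, ℂ)) :
    HasDerivAt (fun w : ℂ => ∫ x, Complex.exp (w * g x) ∂ν) (∫ x, g x ∂ν) 0 := by
  have h1 := hasDerivAt_exp_smul_const (𝕂 := ℂ) g (0 : ℂ)
  rw [zero_smul, NormedSpace.exp_zero, one_mul] at h1
  have h2 := (integralCLM ν).hasFDerivAt.comp_hasDerivAt (0 : ℂ) h1
  simp only [Function.comp_def, integralCLM_apply, continuousMap_exp_apply,
    ContinuousMap.smul_apply, smul_eq_mul] at h2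
  exact h2

end IntegralExp

variable {d : ℕ}

/-- The closed fundamental cell. -/
abbrev closedCell (d : ℕ) : Set (Fin d → ℝ) := Set.Icc 0 fun _ => 2 * Real.pi

/-- Lebesgue measure on the closed fundamental cell. -/
abbrev cellMeasure (d : ℕ) : Measure (closedCell d) := volume.comap Subtype.val

instance : IsFiniteMeasure (cellMeasure d) := by
  refine ⟨?_⟩
  rw [Measure.comap_apply _ Subtype.val_injective
    (fun s hs => MeasurableSet.subtype_image measurableSet_Icc hs) _ MeasurableSet.univ,
    Set.image_univ, Subtype.range_coe]
  exact isCompact_Icc.measure_lt_top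

/-- The half-open cell is not compact; closing it adds a null set and makes the algebra of
continuous functions available. -/
theorem setIntegral_cell (f : (Fin d → ℝ) → ℂ) :
    ∫ v in cell d, f v = ∫ x : closedCell d, f x ∂(cellMeasure d) := by
  rw [integral_subtype_comap measurableSet_Icc f]
  refine setIntegral_congr_set ?_
  exact Measure.univ_pi_Ico_ae_eq_Icc

/-- An entry of a matrix valued function on the closed fundamental cell. -/
def cellEntry {D : (Fin d → ℝ) → Matrix (Fin d) (Fin d) ℝ} (hD : ∀ i j, Continuous fun v => D v i j)
    (i j : Fin d) : C(closedCell d, ℂ) :=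
  ⟨fun x => (D x i j : ℂ), Complex.continuous_ofReal.comp ((hD i j).comp continuous_subtype_val)⟩

variable {D : (Fin d → ℝ) → Matrix (Fin d) (Fin d) ℝ}

theorem sum_cellEntry_apply (hD : ∀ i j, Continuous fun v => D v i j) (c : Fin d → Fin d → ℂ)
    (x : closedCell d) :
    (∑ i, ∑ j, c i j • cellEntry hD i j) x = ∑ i, ∑ j, c i j * (D x i j : ℂ) := by
  rw [ContinuousMap.sum_apply]
  refine Finset.sum_congr rfl fun i _ => ?_
  rw [ContinuousMap.sum_apply]
  rfl

theorem analyticOnNhd_diffusiveLimit (hD : ∀ i j, Continuous fun v => D v i j) :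
    AnalyticOnNhd ℂ (fun p : ℂ × (Fin d → ℂ) => diffusiveLimit D p.1 p.2) Set.univ := by
  intro p _
  have hproj : ∀ i : Fin d, AnalyticAt ℂ (fun p : ℂ × (Fin d → ℂ) => p.2 i) p := fun i =>
    ((ContinuousLinearMap.proj (R := ℂ) (φ := fun _ : Fin d => ℂ) i).comp
      (ContinuousLinearMap.snd ℂ ℂ (Fin d → ℂ))).analyticAt p
  have hg : AnalyticAt ℂ (fun p : ℂ × (Fin d → ℂ) =>
      ∑ i, ∑ j, (-(p.1 / 2) * (p.2 i * p.2 j)) • cellEntry hD i j) p := by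
    refine Finset.analyticAt_fun_sum _ fun i _ => Finset.analyticAt_fun_sum _ fun j _ => ?_
    refine AnalyticAt.fun_smul ?_ analyticAt_const
    exact ((analyticAt_fst.fun_div analyticAt_const two_ne_zero).fun_neg).fun_mul
      ((hproj i).fun_mul (hproj j))
  have h := analyticAt_integral_exp (cellMeasure d) hg
  have e : (fun p : ℂ × (Fin d → ℂ) => diffusiveLimit D p.1 p.2) = fun p =>
      (∫ x, Complex.exp ((∑ i, ∑ j, (-(p.1 / 2) * (p.2 i * p.2 j)) • cellEntry hD i j) x)
        ∂(cellMeasure d)) / (2 * Real.pi : ℂ) ^ d := by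
    funext p
    rw [diffusiveLimit, setIntegral_cell]
    congr 1
    refine integral_congr_ae (ae_of_all _ fun x => ?_)
    simp only [sum_cellEntry_apply]
    congr 1
    rw [Finset.mul_sum]
    refine Finset.sum_congr rfl fun i _ => ?_
    rw [Finset.mul_sum]
    exact Finset.sum_congr rfl fun j _ => by ring
  rw [e]
  exact h.fun_div analyticAt_const
    (pow_ne_zero _ (mul_ne_zero two_ne_zero (by exact_mod_cast Real.pi_ne_zero)))

/-- The time derivative at 0, from which the second moments are read off. -/
theorem hasDerivAt_diffusiveLimit (hD : ∀ i j, Continuous fun v => D v i j) (u : Fin d → ℂ) :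
    HasDerivAt (fun w : ℂ => diffusiveLimit D w u)
      (-(1 / 2) * ∑ i, ∑ j, u i * u j *
        (((∫ v in cell d, D v i j) / (2 * Real.pi) ^ d : ℝ) : ℂ)) 0 := by
  have h := (hasDerivAt_integral_exp (cellMeasure d)
    (∑ i, ∑ j, (-(1 / 2) * (u i * u j)) • cellEntry hD i j)).div_const ((2 * Real.pi : ℂ) ^ d)
  have e1 : (fun w : ℂ => diffusiveLimit D w u) = fun w =>
      (∫ x, Complex.exp (w * (∑ i, ∑ j, (-(1 / 2) * (u i * u j)) • cellEntry hD i j) x)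
        ∂(cellMeasure d)) / (2 * Real.pi : ℂ) ^ d := by
    funext w
    rw [diffusiveLimit, setIntegral_cell]
    congr 1
    refine integral_congr_ae (ae_of_all _ fun x => ?_)
    simp only [sum_cellEntry_apply]
    congr 1
    rw [Finset.mul_sum, Finset.mul_sum]
    refine Finset.sum_congr rfl fun i _ => ?_
    rw [Finset.mul_sum, Finset.mul_sum]
    exact Finset.sum_congr rfl fun j _ => by ring
  have e2 : -(1 / 2) * ∑ i, ∑ j, u i * u j *
        (((∫ v in cell d, D v i j) / (2 * Real.pi) ^ d : ℝ) : ℂ) =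
      (∫ x, (∑ i, ∑ j, (-(1 / 2) * (u i * u j)) • cellEntry hD i j) x ∂(cellMeasure d)) /
        (2 * Real.pi : ℂ) ^ d := by
    rw [← integralCLM_apply, map_sum, Finset.mul_sum, Finset.sum_div]
    refine Finset.sum_congr rfl fun i _ => ?_
    rw [map_sum, Finset.mul_sum, Finset.sum_div]
    refine Finset.sum_congr rfl fun j _ => ?_
    rw [map_smul, integralCLM_apply, smul_eq_mul]
    have : ∫ x, cellEntry hD i j x ∂(cellMeasure d) = ((∫ v in cell d, D v i j : ℝ) : ℂ) := by
      rw [← integral_complex_ofReal, setIntegral_cell]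
      rfl
    rw [this]
    push_cast
    ring
  rw [e1, e2]
  exact h

/-- The exponent is linear in time and quadratic in `y`: a long time at a small argument is traded
for a bounded time at a bounded argument. -/
theorem diffusiveLimit_smul (t : ℂ) (a : ℂ) (y : Fin d → ℂ) :
    diffusiveLimit D t (a • y) = diffusiveLimit D (t * a ^ 2) y := by
  rw [diffusiveLimit, diffusiveLimit]
  congr 1
  refine integral_congr_ae (ae_of_all _ fun v => ?_)
  simp only
  congr 1
  rw [Finset.mul_sum, Finset.mul_sum]
  refine Finset.sum_congr rfl fun i _ => ?_
  rw [Finset.mul_sum, Finset.mul_sum]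
  refine Finset.sum_congr rfl fun j _ => ?_
  rw [Pi.smul_apply, Pi.smul_apply, smul_eq_mul, smul_eq_mul]
  ring

theorem volume_cell : (volume : Measure (Fin d → ℝ)).real (cell d) = (2 * Real.pi) ^ d := by
  rw [measureReal_def, cell, Real.volume_pi_Ico_toReal fun _ => by positivity]
  simp

theorem diffusiveLimit_zero (y : Fin d → ℂ) : diffusiveLimit D 0 y = 1 := by
  rw [diffusiveLimit]
  simp only [zero_div, neg_zero, zero_mul, Complex.exp_zero]
  rw [setIntegral_const, volume_cell]
  have : (2 * Real.pi : ℂ) ^ d ≠ 0 :=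
    pow_ne_zero _ (mul_ne_zero two_ne_zero (by exact_mod_cast Real.pi_ne_zero))
  simp [this]

end DiffusiveLimit
end QWalk

namespace QWalk

/-! ### Ballistic and diffusive scaling limits -/

noncomputable section Limits

set_option linter.unusedSectionVars false

/-- With a continuous limit, joint convergence in the index and the point is locally uniform
convergence. Uniformity thus reduces to limits along `atTop ×ˢ 𝓝 p`. -/
theorem tendstoLocallyUniformlyOn_of_tendsto {X : Type*} [TopologicalSpace X] {S : Set X}
    {G : ℕ → X → ℂ} {f : X → ℂ} (hf : Continuous f)
    (h : ∀ p ∈ S, Tendsto (fun q : ℕ × X => G q.1 q.2) (atTop ×ˢ 𝓝 p) (𝓝 (f p))) :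
    TendstoLocallyUniformlyOn G f atTop S := by
  rw [tendstoLocallyUniformlyOn_iff_forall_tendsto]
  intro p hp
  have h1 : Tendsto (fun q : ℕ × X => f q.2) (atTop ×ˢ 𝓝[S] p) (𝓝 (f p)) :=
    (hf.tendsto p).comp (tendsto_snd.mono_right nhdsWithin_le_nhds)
  have h2 : Tendsto (fun q : ℕ × X => G q.1 q.2) (atTop ×ˢ 𝓝[S] p) (𝓝 (f p)) :=
    (h p hp).mono_left (Filter.prod_mono le_rfl nhdsWithin_le_nhds)
  exact (h1.prodMk_nhds h2).mono_right (nhds_le_uniformity _)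

theorem tendstoUniformlyOn_of_tendsto {X : Type*} [TopologicalSpace X] {S : Set X}
    (hS : IsCompact S) {G : ℕ → X → ℂ} {f : X → ℂ} (hf : Continuous f)
    (h : ∀ p ∈ S, Tendsto (fun q : ℕ × X => G q.1 q.2) (atTop ×ˢ 𝓝 p) (𝓝 (f p))) :
    TendstoUniformlyOn G f atTop S :=
  (tendstoLocallyUniformlyOn_iff_tendstoUniformlyOn_of_compact hS).1
    (tendstoLocallyUniformlyOn_of_tendsto hf h)

theorem tendsto_floor_mul_div {X : Type*} [TopologicalSpace X] {t₀ : ℝ} (ht : 0 < t₀) (x₀ : X) :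
    Tendsto (fun q : ℕ × (ℝ × X) => ((⌊q.2.1 * q.1⌋₊ : ℕ) : ℝ) / q.1) (atTop ×ˢ 𝓝 (t₀, x₀))
      (𝓝 t₀) := by
  have hfst : Tendsto (fun q : ℕ × (ℝ × X) => q.2.1) (atTop ×ˢ 𝓝 (t₀, x₀)) (𝓝 t₀) :=
    (continuous_fst.tendsto (t₀, x₀)).comp tendsto_snd
  have hn : Tendsto (fun q : ℕ × (ℝ × X) => (q.1 : ℝ)⁻¹) (atTop ×ˢ 𝓝 (t₀, x₀)) (𝓝 0) :=
    (tendsto_inv_atTop_zero.comp tendsto_natCast_atTop_atTop).comp tendsto_fst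
  have hlow : Tendsto (fun q : ℕ × (ℝ × X) => q.2.1 - (q.1 : ℝ)⁻¹) (atTop ×ˢ 𝓝 (t₀, x₀))
      (𝓝 t₀) := by simpa using hfst.sub hn
  have hev : ∀ᶠ q : ℕ × (ℝ × X) in atTop ×ˢ 𝓝 (t₀, x₀), 0 < q.2.1 ∧ 1 ≤ q.1 :=
    (hfst.eventually (lt_mem_nhds ht)).and (tendsto_fst.eventually (eventually_ge_atTop 1))
  refine tendsto_of_tendsto_of_tendsto_of_le_of_le' hlow hfst ?_ ?_
  · filter_upwards [hev] with q hq
    have hq0 : (0 : ℝ) < q.1 := by exact_mod_cast hq.2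
    rw [le_div_iff₀ hq0, sub_mul, inv_mul_cancel₀ hq0.ne']
    linarith [Nat.lt_floor_add_one (q.2.1 * q.1)]
  · filter_upwards [hev] with q hq
    have hq0 : (0 : ℝ) < q.1 := by exact_mod_cast hq.2
    rw [div_le_iff₀ hq0]
    exact Nat.floor_le (mul_nonneg hq.1.le hq0.le)

variable {d : ℕ} {Φ : ℕ → (Fin d → ℂ) → ℂ} {D : (Fin d → ℝ) → Matrix (Fin d) (Fin d) ℝ}
  {a : Fin d → ℝ}

/-- The quantitative diffusive approximation of a sequence of characteristic functions with drift
`a` by the diffusion matrices `D`. -/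
def DiffusiveApprox (Φ : ℕ → (Fin d → ℂ) → ℂ) (D : (Fin d → ℝ) → Matrix (Fin d) (Fin d) ℝ)
    (a : Fin d → ℝ) : Prop :=
  ∃ c > 0, ∃ δ > 0, ∀ (n : ℕ) (y : Fin d → ℂ), ‖y‖ ≤ δ →
    ‖Complex.exp (-Complex.I * n * dotC a y) * Φ n y - diffusiveLimit D n y‖ ≤
      c * (‖y‖ + n * ‖y‖ ^ 3) * Real.exp (c * (n * ‖y‖ ^ 2))

theorem dotC_smul (a : Fin d → ℝ) (c : ℂ) (y : Fin d → ℂ) : dotC a (c • y) = c * dotC a y := by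
  rw [dotC, dotC, Finset.mul_sum]
  refine Finset.sum_congr rfl fun j _ => ?_
  rw [Pi.smul_apply, smul_eq_mul]
  ring

theorem continuous_dotC (a : Fin d → ℝ) : Continuous (dotC a) :=
  continuous_finsetSum _ fun j _ => continuous_const.mul (continuous_apply j)

theorem continuous_diffusiveLimit (hD : ∀ i j, Continuous fun v => D v i j) :
    Continuous fun p : ℂ × (Fin d → ℂ) => diffusiveLimit D p.1 p.2 :=
  continuous_iff_continuousAt.2 fun p =>
    (analyticOnNhd_diffusiveLimit hD p (Set.mem_univ p)).continuousAt

/-- If `b → 0`, `y → y₀` and `N b² → w`, then the centred characteristic function at `b y` converges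
to the diffusive limit at time `w`. -/
theorem DiffusiveApprox.tendsto (h : DiffusiveApprox Φ D a)
    (hD : ∀ i j, Continuous fun v => D v i j) {ι : Type*} {l : Filter ι} {N : ι → ℕ} {b : ι → ℂ}
    {y : ι → Fin d → ℂ} {w : ℂ} {y₀ : Fin d → ℂ} (hb : Tendsto b l (𝓝 0))
    (hy : Tendsto y l (𝓝 y₀)) (hN : Tendsto (fun q => (N q : ℂ) * b q ^ 2) l (𝓝 w)) :
    Tendsto (fun q => Complex.exp (-Complex.I * N q * dotC a (b q • y q)) * Φ (N q) (b q • y q)) l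
      (𝓝 (diffusiveLimit D w y₀)) := by
  obtain ⟨c, hc, δ, hδ, hbound⟩ := h
  have hz : Tendsto (fun q => ‖b q • y q‖) l (𝓝 0) := by
    simpa using (hb.smul hy).norm
  have hNz : Tendsto (fun q => (N q : ℝ) * ‖b q • y q‖ ^ 2) l (𝓝 (‖w‖ * ‖y₀‖ ^ 2)) := by
    refine (hN.norm.mul (hy.norm.pow 2)).congr fun q => ?_
    rw [norm_smul, norm_mul, norm_pow, Complex.norm_natCast, mul_pow, mul_assoc]
  have hdiff : Tendsto (fun q => Complex.exp (-Complex.I * N q * dotC a (b q • y q)) *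
      Φ (N q) (b q • y q) - diffusiveLimit D (N q) (b q • y q)) l (𝓝 0) := by
    -- The error tends to 0 because `N ‖b y‖²` stays bounded: both the exponential factor and the
    -- coefficient of the remaining `‖b y‖` converge.
    have hlim : Tendsto (fun q => c * (‖b q • y q‖ + (N q * ‖b q • y q‖ ^ 2) * ‖b q • y q‖) *
        Real.exp (c * (N q * ‖b q • y q‖ ^ 2))) l
        (𝓝 (c * (0 + ‖w‖ * ‖y₀‖ ^ 2 * 0) * Real.exp (c * (‖w‖ * ‖y₀‖ ^ 2)))) :=
      ((hz.add (hNz.mul hz)).const_mul c).mul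
        ((Real.continuous_exp.tendsto _).comp (hNz.const_mul c))
    rw [mul_zero, add_zero, mul_zero, zero_mul] at hlim
    refine squeeze_zero_norm' ?_ hlim
    filter_upwards [hz.eventually (ge_mem_nhds hδ)] with q hq
    refine (hbound _ _ hq).trans (le_of_eq ?_)
    ring
  have hF : Tendsto (fun q => diffusiveLimit D (N q) (b q • y q)) l
      (𝓝 (diffusiveLimit D w y₀)) := by
    have hc : Tendsto (fun p : ℂ × (Fin d → ℂ) => diffusiveLimit D p.1 p.2) (𝓝 (w, y₀))
        (𝓝 (diffusiveLimit D w y₀)) := (continuous_diffusiveLimit hD).tendsto (w, y₀)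
    exact (hc.comp (hN.prodMk_nhds hy)).congr fun q => (diffusiveLimit_smul _ _ _).symm
  simpa using hdiff.add hF

/-- Here `b = 1/n`, so `N b² → 0`. The diffusive factor is then 1 and only the drift remains. -/
theorem DiffusiveApprox.tendstoUniformlyOn_ballistic (h : DiffusiveApprox Φ D a)
    (hD : ∀ i j, Continuous fun v => D v i j) {J : Set ℝ} {K : Set (Fin d → ℂ)} (hJ : IsCompact J)
    (hJ0 : J ⊆ Set.Ioi 0) (hK : IsCompact K) :
    TendstoUniformlyOn (fun (n : ℕ) (p : ℝ × (Fin d → ℂ)) => Φ ⌊p.1 * n⌋₊ ((n : ℂ)⁻¹ • p.2))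
      (fun p => Complex.exp (Complex.I * p.1 * dotC a p.2)) atTop (J ×ˢ K) := by
  refine tendstoUniformlyOn_of_tendsto (hJ.prod hK) ?_ fun p hp => ?_
  · exact Complex.continuous_exp.comp ((continuous_const.mul
      (Complex.continuous_ofReal.comp continuous_fst)).mul ((continuous_dotC a).comp continuous_snd))
  have hfl := tendsto_floor_mul_div (hJ0 hp.1) p.2
  have hflC : Tendsto (fun q : ℕ × (ℝ × (Fin d → ℂ)) => (⌊q.2.1 * q.1⌋₊ : ℂ) * (q.1 : ℂ)⁻¹)
      (atTop ×ˢ 𝓝 p) (𝓝 (p.1 : ℂ)) :=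
    ((Complex.continuous_ofReal.tendsto _).comp hfl).congr fun q => by
      simp [div_eq_mul_inv]
  have hb : Tendsto (fun q : ℕ × (ℝ × (Fin d → ℂ)) => (q.1 : ℂ)⁻¹) (atTop ×ˢ 𝓝 p) (𝓝 0) := by
    have : Tendsto (fun n : ℕ => (n : ℂ)⁻¹) atTop (𝓝 0) := tendsto_inv_atTop_nhds_zero_nat
    exact this.comp tendsto_fst
  have hy : Tendsto (fun q : ℕ × (ℝ × (Fin d → ℂ)) => q.2.2) (atTop ×ˢ 𝓝 p) (𝓝 p.2) :=
    (continuous_snd.tendsto p).comp tendsto_snd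
  have hN : Tendsto (fun q : ℕ × (ℝ × (Fin d → ℂ)) => (⌊q.2.1 * q.1⌋₊ : ℂ) * (q.1 : ℂ)⁻¹ ^ 2)
      (atTop ×ˢ 𝓝 p) (𝓝 0) := by
    have := hflC.mul hb
    rw [mul_zero] at this
    exact this.congr fun q => by ring
  have h1 := h.tendsto hD hb hy hN
  rw [diffusiveLimit_zero] at h1
  have h2 : Tendsto (fun q : ℕ × (ℝ × (Fin d → ℂ)) =>
      Complex.exp (Complex.I * ((⌊q.2.1 * q.1⌋₊ : ℂ) * (q.1 : ℂ)⁻¹) * dotC a q.2.2))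
      (atTop ×ˢ 𝓝 p) (𝓝 (Complex.exp (Complex.I * p.1 * dotC a p.2))) :=
    (Complex.continuous_exp.tendsto _).comp
      ((hflC.const_mul Complex.I).mul (((continuous_dotC a).tendsto _).comp hy))
  have h3 := h2.mul h1
  rw [mul_one] at h3
  refine h3.congr fun q => ?_
  rw [← mul_assoc, ← Complex.exp_add, dotC_smul]
  have : Complex.I * ((⌊q.2.1 * q.1⌋₊ : ℂ) * (q.1 : ℂ)⁻¹) * dotC a q.2.2 +
      -Complex.I * (⌊q.2.1 * q.1⌋₊ : ℂ) * ((q.1 : ℂ)⁻¹ * dotC a q.2.2) = 0 := by ring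
  rw [this, Complex.exp_zero, one_mul]

theorem tendsto_inv_sqrt_nat :
    Tendsto (fun n : ℕ => ((Real.sqrt n : ℝ) : ℂ)⁻¹) atTop (𝓝 0) := by
  have h1 : Tendsto (fun n : ℕ => (Real.sqrt n)⁻¹) atTop (𝓝 0) :=
    tendsto_inv_atTop_zero.comp (Real.tendsto_sqrt_atTop.comp tendsto_natCast_atTop_atTop)
  have h2 := (Complex.continuous_ofReal.tendsto 0).comp h1
  rw [Complex.ofReal_zero] at h2
  exact h2.congr fun n => by simp

theorem inv_sqrt_nat_sq (n : ℕ) : ((Real.sqrt n : ℝ) : ℂ)⁻¹ ^ 2 = (n : ℂ)⁻¹ := by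
  rw [inv_pow, ← Complex.ofReal_pow, Real.sq_sqrt (Nat.cast_nonneg n), Complex.ofReal_natCast]

/-- Here `b = n^{-1/2}`, so `N b²` converges to the macroscopic time. -/
theorem DiffusiveApprox.tendstoUniformlyOn_diffusive (h : DiffusiveApprox Φ D a)
    (hD : ∀ i j, Continuous fun v => D v i j) {J : Set ℝ} {K : Set (Fin d → ℂ)} (hJ : IsCompact J)
    (hJ0 : J ⊆ Set.Ioi 0) (hK : IsCompact K) :
    TendstoUniformlyOn
      (fun (n : ℕ) (p : ℝ × (Fin d → ℂ)) =>
        Complex.exp (-Complex.I * (⌊p.1 * n⌋₊ : ℂ) * (dotC a p.2 / (Real.sqrt n : ℂ))) *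
          Φ ⌊p.1 * n⌋₊ ((Real.sqrt n : ℂ)⁻¹ • p.2))
      (fun p => diffusiveLimit D (p.1 : ℂ) p.2) atTop (J ×ˢ K) := by
  refine tendstoUniformlyOn_of_tendsto (hJ.prod hK) ?_ fun p hp => ?_
  · exact (continuous_diffusiveLimit hD).comp
      ((Complex.continuous_ofReal.comp continuous_fst).prodMk continuous_snd)
  have hfl := tendsto_floor_mul_div (hJ0 hp.1) p.2
  have hb : Tendsto (fun q : ℕ × (ℝ × (Fin d → ℂ)) => ((Real.sqrt q.1 : ℝ) : ℂ)⁻¹) (atTop ×ˢ 𝓝 p)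
      (𝓝 0) := tendsto_inv_sqrt_nat.comp tendsto_fst
  have hy : Tendsto (fun q : ℕ × (ℝ × (Fin d → ℂ)) => q.2.2) (atTop ×ˢ 𝓝 p) (𝓝 p.2) :=
    (continuous_snd.tendsto p).comp tendsto_snd
  have hN : Tendsto (fun q : ℕ × (ℝ × (Fin d → ℂ)) =>
      (⌊q.2.1 * q.1⌋₊ : ℂ) * ((Real.sqrt q.1 : ℝ) : ℂ)⁻¹ ^ 2) (atTop ×ˢ 𝓝 p) (𝓝 (p.1 : ℂ)) :=
    ((Complex.continuous_ofReal.tendsto _).comp hfl).congr fun q => by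
      simp only [Function.comp_apply, inv_sqrt_nat_sq]
      push_cast
      rw [div_eq_mul_inv]
  refine (h.tendsto hD hb hy hN).congr fun q => ?_
  rw [dotC_smul, div_eq_inv_mul]

theorem differentiable_diffusiveLimit (hD : ∀ i j, Continuous fun v => D v i j) (u : Fin d → ℂ) :
    Differentiable ℂ fun w : ℂ => diffusiveLimit D w u := fun w =>
  (analyticOnNhd_diffusiveLimit hD (w, u) (Set.mem_univ _)).differentiableAt.comp w
    (f := fun w : ℂ => (w, u)) (by fun_prop)

theorem continuous_comp_sq {H : ℂ → ℂ} (hH : Continuous H) : Continuous fun s => H (s ^ 2) :=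
  hH.comp (continuous_pow 2)

/-- Here `b = s/√n` with complex `s`, so `n b² = s²`. Holomorphy in `s` is what later allows the
limit to be differentiated. -/
theorem DiffusiveApprox.tendstoLocallyUniformlyOn_line (h : DiffusiveApprox Φ D a)
    (hD : ∀ i j, Continuous fun v => D v i j) (u : Fin d → ℂ) :
    TendstoLocallyUniformlyOn
      (fun (n : ℕ) (s : ℂ) =>
        Complex.exp (-Complex.I * n * dotC a ((s * (Real.sqrt n : ℂ)⁻¹) • u)) *
          Φ n ((s * (Real.sqrt n : ℂ)⁻¹) • u))
      (fun s => diffusiveLimit D (s ^ 2) u) atTop Set.univ := by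
  refine tendstoLocallyUniformlyOn_of_tendsto
    (continuous_comp_sq (differentiable_diffusiveLimit hD u).continuous) fun s _ => ?_
  have hs : Tendsto (fun q : ℕ × ℂ => q.2) (atTop ×ˢ 𝓝 s) (𝓝 s) := tendsto_snd
  have hb : Tendsto (fun q : ℕ × ℂ => q.2 * ((Real.sqrt q.1 : ℝ) : ℂ)⁻¹) (atTop ×ˢ 𝓝 s) (𝓝 0) := by
    simpa using hs.mul (tendsto_inv_sqrt_nat.comp tendsto_fst)
  refine h.tendsto (N := fun q : ℕ × ℂ => q.1) (y := fun _ => u) (w := s ^ 2) hD hb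
    tendsto_const_nhds ?_
  refine (hs.pow 2).congr' ?_
  filter_upwards [tendsto_fst.eventually (eventually_ge_atTop 1)] with q hq
  have hq0 : (q.1 : ℂ) ≠ 0 := Nat.cast_ne_zero.2 (by omega)
  rw [mul_pow, inv_sqrt_nat_sq]
  field_simp

end Limits
end QWalk

namespace QWalk

/-! ### Moments from derivatives of the characteristic function -/

noncomputable section Moments

set_option linter.unusedSectionVars false

/-- The exponential sum with frequencies `c` and weights `p`. -/
def expSum {X : Type*} (S : Finset X) (c p : X → ℂ) (s : ℂ) : ℂ :=
  ∑ x ∈ S, Complex.exp (s * c x) * p x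

theorem hasDerivAt_expSum {X : Type*} (S : Finset X) (c p : X → ℂ) (s : ℂ) :
    HasDerivAt (expSum S c p) (expSum S c (fun x => c x * p x) s) s := by
  unfold expSum
  refine HasDerivAt.fun_sum fun x _ => ?_
  have h := (((hasDerivAt_id s).mul_const (c x)).cexp).mul_const (p x)
  simp only [id_eq, one_mul] at h
  exact h.congr_deriv (by ring)

theorem deriv_expSum {X : Type*} (S : Finset X) (c p : X → ℂ) :
    deriv (expSum S c p) = expSum S c fun x => c x * p x :=
  funext fun s => (hasDerivAt_expSum S c p s).deriv

theorem expSum_zero {X : Type*} (S : Finset X) (c p : X → ℂ) : expSum S c p 0 = ∑ x ∈ S, p x := by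
  simp [expSum]

/-- Weierstrass: locally uniform limits of holomorphic functions may be differentiated. The
derivative is again an exponential sum, so the lemma can be iterated. -/
theorem tendstoLocallyUniformlyOn_expSum_deriv {X : Type*} {S : ℕ → Finset X} {c p : ℕ → X → ℂ}
    {F : ℂ → ℂ}
    (h : TendstoLocallyUniformlyOn (fun n => expSum (S n) (c n) (p n)) F atTop Set.univ) :
    TendstoLocallyUniformlyOn (fun n => expSum (S n) (c n) fun x => c n x * p n x) (deriv F)
      atTop Set.univ := by
  have h1 := h.deriv (Eventually.of_forall fun n s _ =>
    (hasDerivAt_expSum (S n) (c n) (p n) s).differentiableAt.differentiableWithinAt) isOpen_univ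
  refine h1.congr fun _ s _ => ?_
  simp only [Function.comp_apply, deriv_expSum]

theorem tendsto_sum_of_expSum {X : Type*} {S : ℕ → Finset X} {c p : ℕ → X → ℂ}
    {F : ℂ → ℂ}
    (h : TendstoLocallyUniformlyOn (fun n => expSum (S n) (c n) (p n)) F atTop Set.univ) :
    Tendsto (fun n => ∑ x ∈ S n, p n x) atTop (𝓝 (F 0)) :=
  (h.tendsto_at (Set.mem_univ 0)).congr fun _ => expSum_zero _ _ _

theorem deriv_comp_sq {H : ℂ → ℂ} (hH : Differentiable ℂ H) :
    deriv (fun s => H (s ^ 2)) = fun s => deriv H (s ^ 2) * (2 * s) := by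
  funext s
  have h := (hH (s ^ 2)).hasDerivAt.comp s (hasDerivAt_pow 2 s)
  simpa [Function.comp_def] using h.deriv

theorem deriv_deriv_comp_sq {H : ℂ → ℂ} (hH : Differentiable ℂ H) :
    deriv (deriv fun s => H (s ^ 2)) 0 = 2 * deriv H 0 := by
  rw [deriv_comp_sq hH]
  have h2 : HasDerivAt (fun s : ℂ => 2 * s) 2 0 := by
    simpa using (hasDerivAt_id (0 : ℂ)).const_mul 2
  have hd : DifferentiableAt ℂ (fun s : ℂ => deriv H (s ^ 2)) 0 :=
    (hH.deriv).differentiableAt.comp 0 (differentiableAt_pow 2)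
  have h := hd.hasDerivAt.mul h2
  have h' := h.deriv
  simp only [mul_zero, zero_add, ne_eq, OfNat.ofNat_ne_zero, not_false_eq_true, zero_pow] at h'
  rw [mul_comm]
  exact h'

/-- The linear form `u` evaluated at the position `x` centred at `n a`. -/
def centredDot {d : ℕ} (a : Fin d → ℝ) (n : ℕ) (u : Fin d → ℂ) (x : Lat d) : ℂ :=
  ∑ j, u j * ((x j : ℂ) - n * (a j : ℂ))

theorem centredDot_add {d : ℕ} (a : Fin d → ℝ) (n : ℕ) (u w : Fin d → ℂ) (x : Lat d) :
    centredDot a n (u + w) x = centredDot a n u x + centredDot a n w x := by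
  simp only [centredDot, Pi.add_apply, add_mul, Finset.sum_add_distrib]

theorem centredDot_single {d : ℕ} (a : Fin d → ℝ) (n : ℕ) (i : Fin d) (x : Lat d) :
    centredDot a n (Pi.single i 1) x = (x i : ℂ) - n * (a i : ℂ) := by
  rw [centredDot, Finset.sum_eq_single i (fun j _ hj => by rw [Pi.single_eq_of_ne hj, zero_mul])
    (fun h => absurd (Finset.mem_univ i) h), Pi.single_eq_same, one_mul]

theorem exp_mul_wave {d : ℕ} (a : Fin d → ℝ) (n : ℕ) (b : ℂ) (u : Fin d → ℂ) (x : Lat d) :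
    Complex.exp (-Complex.I * n * dotC a (b • u)) * wave x (b • u) =
      Complex.exp (b * (Complex.I * centredDot a n u x)) := by
  rw [wave, ← Complex.exp_add, dotC, centredDot, Finset.mul_sum, Finset.mul_sum, Finset.mul_sum,
    Finset.mul_sum, ← Finset.sum_add_distrib]
  congr 1
  refine Finset.sum_congr rfl fun j _ => ?_
  rw [Pi.smul_apply, smul_eq_mul]
  ring

variable {d : ℕ} {S : ℕ → Finset (Lat d)} {p : ℕ → Lat d → ℂ} {Φ : ℕ → (Fin d → ℂ) → ℂ}
  {D : (Fin d → ℝ) → Matrix (Fin d) (Fin d) ℝ} {a : Fin d → ℝ}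

theorem DiffusiveApprox.tendstoLocallyUniformlyOn_expSum (h : DiffusiveApprox Φ D a)
    (hD : ∀ i j, Continuous fun v => D v i j)
    (hΦ : ∀ n y, Φ n y = ∑ x ∈ S n, wave x y * p n x) (u : Fin d → ℂ) :
    TendstoLocallyUniformlyOn
      (fun n => expSum (S n)
        (fun x => (Real.sqrt n : ℂ)⁻¹ * (Complex.I * centredDot a n u x)) (p n))
      (fun s => diffusiveLimit D (s ^ 2) u) atTop Set.univ := by
  refine (h.tendstoLocallyUniformlyOn_line hD u).congr fun n s _ => ?_
  simp only [hΦ, expSum, Finset.mul_sum]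
  refine Finset.sum_congr rfl fun x _ => ?_
  rw [← mul_assoc, exp_mul_wave, mul_assoc]

/-- Only the limit of the mass is used, so the exact normalisation of the weights need not be
computed. -/
theorem DiffusiveApprox.tendsto_mass (h : DiffusiveApprox Φ D a)
    (hD : ∀ i j, Continuous fun v => D v i j)
    (hΦ : ∀ n y, Φ n y = ∑ x ∈ S n, wave x y * p n x) :
    Tendsto (fun n => ∑ x ∈ S n, p n x) atTop (𝓝 1) := by
  have h0 := tendsto_sum_of_expSum (h.tendstoLocallyUniformlyOn_expSum hD hΦ 0)
  rwa [zero_pow two_ne_zero, diffusiveLimit_zero] at h0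

/-- The limit is a function of `s ^ 2`, so its first derivative at 0 vanishes: the centred first
moment is `o(√n)`. -/
theorem DiffusiveApprox.tendsto_centred (h : DiffusiveApprox Φ D a)
    (hD : ∀ i j, Continuous fun v => D v i j)
    (hΦ : ∀ n y, Φ n y = ∑ x ∈ S n, wave x y * p n x) (u : Fin d → ℂ) :
    Tendsto (fun n : ℕ => (Real.sqrt n : ℂ)⁻¹ * ∑ x ∈ S n, centredDot a n u x * p n x) atTop
      (𝓝 0) := by
  have h1 := tendsto_sum_of_expSum (tendstoLocallyUniformlyOn_expSum_deriv
    (h.tendstoLocallyUniformlyOn_expSum hD hΦ u))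
  rw [deriv_comp_sq (differentiable_diffusiveLimit hD u)] at h1
  dsimp only at h1
  rw [mul_zero, mul_zero] at h1
  have h2 := h1.const_mul (-Complex.I)
  rw [mul_zero] at h2
  refine h2.congr fun n => ?_
  rw [Finset.mul_sum, Finset.mul_sum]
  refine Finset.sum_congr rfl fun x _ => ?_
  linear_combination (-(Real.sqrt n : ℂ)⁻¹ * centredDot a n u x * p n x) * Complex.I_sq

/-- The second derivative of `H(s²)` at 0 is `2 H'(0)`. Its factor 2 cancels the `1/2` in the
diffusive exponent, and the minus sign cancels against `i²`. -/
theorem DiffusiveApprox.tendsto_centred_sq (h : DiffusiveApprox Φ D a)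
    (hD : ∀ i j, Continuous fun v => D v i j)
    (hΦ : ∀ n y, Φ n y = ∑ x ∈ S n, wave x y * p n x) (u : Fin d → ℂ) :
    Tendsto (fun n : ℕ => (∑ x ∈ S n, centredDot a n u x ^ 2 * p n x) / n) atTop
      (𝓝 (∑ i, ∑ j, u i * u j * (((∫ v in cell d, D v i j) / (2 * Real.pi) ^ d : ℝ) : ℂ))) := by
  have h1 := tendsto_sum_of_expSum (tendstoLocallyUniformlyOn_expSum_deriv
    (tendstoLocallyUniformlyOn_expSum_deriv (h.tendstoLocallyUniformlyOn_expSum hD hΦ u)))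
  rw [deriv_deriv_comp_sq (differentiable_diffusiveLimit hD u),
    (hasDerivAt_diffusiveLimit hD u).deriv] at h1
  have h2 := h1.neg
  refine (h2.congr fun n => ?_).trans (le_of_eq (congrArg 𝓝 (by ring)))
  rw [div_eq_mul_inv, ← inv_sqrt_nat_sq, Finset.sum_mul, ← Finset.sum_neg_distrib]
  refine Finset.sum_congr rfl fun x _ => ?_
  linear_combination (-((Real.sqrt n : ℂ)⁻¹ * centredDot a n u x) ^ 2 * p n x) * Complex.I_sq

theorem DiffusiveApprox.tendsto_first_moment (h : DiffusiveApprox Φ D a)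
    (hD : ∀ i j, Continuous fun v => D v i j)
    (hΦ : ∀ n y, Φ n y = ∑ x ∈ S n, wave x y * p n x) (i : Fin d) :
    Tendsto (fun n : ℕ => (∑ x ∈ S n, (x i : ℂ) * p n x) / n) atTop (𝓝 (a i : ℂ)) := by
  have h1 := (tendsto_inv_sqrt_nat.mul (h.tendsto_centred hD hΦ (Pi.single i 1))).add
    ((h.tendsto_mass hD hΦ).const_mul (a i : ℂ))
  rw [mul_zero, zero_add, mul_one] at h1
  refine h1.congr' ?_
  filter_upwards [eventually_ge_atTop 1] with n hn
  have hn0 : (n : ℂ) ≠ 0 := Nat.cast_ne_zero.2 (by omega)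
  simp only [centredDot_single]
  rw [← mul_assoc, ← pow_two, inv_sqrt_nat_sq]
  simp only [sub_mul, Finset.sum_sub_distrib, mul_assoc, ← Finset.mul_sum]
  field_simp
  ring

theorem DiffusiveApprox.tendsto_second_moment (h : DiffusiveApprox Φ D a)
    (hD : ∀ i j, Continuous fun v => D v i j) (hsymm : ∀ v i j, D v i j = D v j i)
    (hΦ : ∀ n y, Φ n y = ∑ x ∈ S n, wave x y * p n x) (i j : Fin d) :
    Tendsto (fun n : ℕ => (∑ x ∈ S n,
        (((x i : ℝ) - n * a i : ℝ) : ℂ) * (((x j : ℝ) - n * a j : ℝ) : ℂ) * p n x) / n)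
      atTop (𝓝 (((∫ v in cell d, D v i j) / (2 * Real.pi) ^ d : ℝ) : ℂ)) := by
  have hji : ((∫ v in cell d, D v j i) / (2 * Real.pi) ^ d : ℝ) =
      (∫ v in cell d, D v i j) / (2 * Real.pi) ^ d := by simp only [hsymm _ j i]
  -- Polarisation recovers the mixed moment from the quadratic form at `e_i + e_j`, `e_i` and `e_j`;
  -- symmetry of `D` merges the two cross terms.
  have hq := ((h.tendsto_centred_sq hD hΦ (Pi.single i 1 + Pi.single j 1)).sub
    ((h.tendsto_centred_sq hD hΦ (Pi.single i 1)).add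
      (h.tendsto_centred_sq hD hΦ (Pi.single j 1)))).const_mul (1 / 2 : ℂ)
  refine (hq.congr fun n => ?_).trans (le_of_eq (congrArg 𝓝 ?_))
  · rw [← add_div, ← sub_div, ← Finset.sum_add_distrib, ← Finset.sum_sub_distrib, mul_div_assoc',
      Finset.mul_sum]
    refine congrArg (· / (n : ℂ)) (Finset.sum_congr rfl fun x _ => ?_)
    rw [centredDot_add, centredDot_single, centredDot_single]
    push_cast
    ring
  · simp only [Pi.add_apply, add_mul, mul_add, Finset.sum_add_distrib, Pi.single_apply, ite_mul,
      mul_ite, one_mul, mul_one, zero_mul, mul_zero, Finset.sum_ite_eq', Finset.mem_univ, if_true]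
    rw [hji]
    ring

end Moments
end QWalk

theorem mainTheorem9 {d : ℕ} (hd : 1 ≤ d) {Ω : Type*} [MeasurableSpace Ω]
    (μ : Measure Ω) [IsProbabilityMeasure μ]
    (r : QWalk.Spin d → QWalk.Lat d)
    (C : Ω → Matrix.unitaryGroup (QWalk.Spin d) ℂ)
    (hC : ∀ τ σ, Measurable fun ω => (C ω : Matrix (QWalk.Spin d) (QWalk.Spin d) ℂ) τ σ)
    (hspec : ∀ v : Fin d → ℝ,
      spectrum ℂ (QWalk.transferMat μ r C v (-v)) ∩ {z : ℂ | ‖z‖ = 1} = {1} ∧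
      (QWalk.transferMat μ r C v (-v)).charpoly.rootMultiplicity 1 = 1) :
    ∃ D : (Fin d → ℝ) → Matrix (Fin d) (Fin d) ℝ,
      -- `D` is an analytic map from the torus to the nonnegative matrices
      (∀ i j, AnalyticOnNhd ℝ (fun v => D v i j) Set.univ) ∧
      (∀ (v : Fin d → ℝ) (k : Fin d → ℤ), D (fun j => v j + 2 * Real.pi * (k j : ℝ)) = D v) ∧
      (∀ v, (D v).PosSemidef) ∧
      -- the diffusive limit is analytic in `(t, y) ∈ ℂ × ℂ^d`
      AnalyticOnNhd ℂ (fun p : ℂ × (Fin d → ℂ) => QWalk.diffusiveLimit D p.1 p.2) Set.univ ∧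
      ∀ ψ₀ : EuclideanSpace ℂ (QWalk.Spin d), ‖ψ₀‖ = 1 →
        -- all traces and expectations involved converge absolutely
        (∀ (n : ℕ) (f : QWalk.Lat d → ℂ),
          (∀ ω, Summable (QWalk.traceTerm (QWalk.randomState r C ψ₀ n ω) f)) ∧
          Integrable (fun ω => QWalk.traceObs (QWalk.randomState r C ψ₀ n ω) f)
            (Measure.infinitePi fun _ : ℕ => μ)) ∧
        (∀ (J : Set ℝ) (K : Set (Fin d → ℂ)), IsCompact J → J ⊆ Set.Ioi 0 → IsCompact K →
          TendstoUniformlyOn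
            (fun (n : ℕ) (p : ℝ × (Fin d → ℂ)) =>
              QWalk.charFn μ r C ψ₀ ⌊p.1 * n⌋₊ ((n : ℂ)⁻¹ • p.2))
            (fun p => Complex.exp (Complex.I * p.1 * QWalk.dotC (QWalk.meanJump r) p.2))
            atTop (J ×ˢ K) ∧
          TendstoUniformlyOn
            (fun (n : ℕ) (p : ℝ × (Fin d → ℂ)) =>
              Complex.exp (-Complex.I * (⌊p.1 * n⌋₊ : ℂ) *
                  (QWalk.dotC (QWalk.meanJump r) p.2 / (Real.sqrt n : ℂ))) *
                QWalk.charFn μ r C ψ₀ ⌊p.1 * n⌋₊ ((Real.sqrt n : ℂ)⁻¹ • p.2))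
            (fun p => QWalk.diffusiveLimit D (p.1 : ℂ) p.2)
            atTop (J ×ˢ K)) ∧
        (∀ i : Fin d,
          Tendsto (fun n : ℕ => QWalk.mean μ r C ψ₀ n (fun x => (x i : ℂ)) / (n : ℂ))
            atTop (𝓝 (QWalk.meanJump r i : ℂ))) ∧
        (∀ i j : Fin d,
          Tendsto (fun n : ℕ =>
              QWalk.mean μ r C ψ₀ n (fun x =>
                (((x i : ℝ) - n * QWalk.meanJump r i : ℝ) : ℂ) *
                  (((x j : ℝ) - n * QWalk.meanJump r j : ℝ) : ℂ)) / (n : ℂ))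
            atTop (𝓝 (((∫ v in QWalk.cell d, D v i j) / (2 * Real.pi) ^ d : ℝ) : ℂ))) := by
  -- `d ≥ 1` makes the label set nonempty, as the normalisation `1 / 2d` demands.
  have : Nonempty (QWalk.Spin d) := by
    rw [← Fintype.card_pos_iff, QWalk.card_spin]
    omega
  have hcont := QWalk.continuous_diffMat μ r hC hspec
  refine ⟨QWalk.diffMat μ r C, fun i j v _ => QWalk.analyticAt_diffMat μ r hC hspec i j v,
    QWalk.diffMat_periodic μ r, QWalk.diffMat_posSemidef μ r hC hspec,
    QWalk.analyticOnNhd_diffusiveLimit hcont, fun ψ₀ hψ => ?_⟩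
  have h : QWalk.DiffusiveApprox (QWalk.charFn μ r C ψ₀) (QWalk.diffMat μ r C)
      (QWalk.meanJump r) := QWalk.exists_norm_charFn_sub_le μ r ψ₀ hC hspec hψ
  have hΦ := QWalk.charFn_eq_sum μ r ψ₀ hC
  refine ⟨fun n f => ⟨fun ω => QWalk.summable_traceTerm r _ ψ₀ n f,
    QWalk.integrable_traceObs μ r ψ₀ hC n f⟩, fun J K hJ hJ0 hK =>
    ⟨h.tendstoUniformlyOn_ballistic hcont hJ hJ0 hK,
      h.tendstoUniformlyOn_diffusive hcont hJ hJ0 hK⟩, fun i => ?_, fun i j => ?_⟩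
  · simp only [QWalk.mean_eq_sum μ r ψ₀ hC]
    exact h.tendsto_first_moment hcont hΦ i
  · simp only [QWalk.mean_eq_sum μ r ψ₀ hC]
    exact h.tendsto_second_moment hcont (QWalk.diffMat_isSymm μ r C) hΦ i j
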